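/- Let $m\ge 2$ be an integer, $1\le p\le\infty$, and define $q\in(0,1]$ by $\frac1q=\frac m2+\frac1p$. Let $\Omega\subset\mathbb R^2$ be a compact polygonal domain (a nonempty finite union of closed nondegenerate triangles) and let $f\in C^m(\Omega)$ be real valued (with derivatives up to order $m$ continuous up to the boundary). **Notation.** For a triangle $T$ and a continuous function $v$ on $T$, $I_{m,T}v$ is the unique polynomial of total degree at most $m-1$ that agrees with $v$ at all points of $T$ with barycentric coordinates in $\{0,\frac1{m-1},\frac2{m-1},\dots,1\}$, and $e_{m,T}(v)_p:=\|v-I_{m,T}v\|_{L^p(T)}$. For a finite set $\mathcal T$ of triangles, $e_{m,\mathcal T}(v)_p:=\big(\sum_{T\in\mathcal T}e_{m,T}(v)_p^p\big)^{1/p}$ if $p<\infty$, and $e_{m,\mathcal T}(v)_\infty:=\max_{T\in\mathcal T}e_{m,T}(v)_\infty$. For a homogeneous polynomial $\pi$ of degree $m$ in two variables, $K_{m,p}(\pi):=\inf_{|T|=1}e_{m,T}(\pi)_p$, the infimum being over all triangles of area $1$. The derivative $\frac{d^mf}{m!}$ at a point is identified with the homogeneous polynomial $\sum_{k+l=m}\frac{\partial^mf}{\partial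 x^k\partial y^l}\frac{x^k}{k!}\frac{y^l}{l!}$, and $\|g\|_{L^q(\Omega)}:=\big(\int_\Omega|g|^q\big)^{1/q}$. A triangulation of $\Omega$ is a finite set of nondegenerate closed triangles with pairwise disjoint interiors and union $\Omega$; it is conforming if any two distinct triangles of it meet in the empty set, a common vertex or a common edge. A sequence $(\mathcal T_N)_{N\ge N_0}$ of triangulations of $\Omega$ with $\#(\mathcal T_N)=N$ is admissible if there is a constant $C_A>0$ independent of $N$ such that $\operatorname{diam}(T)\le C_AN^{-1/2}$ for all $N\ge N_0$ and $T\in\mathcal T_N$. **Theorem.** 1. For every admissible sequence $(\mathcal T_N)_{N\ge N_0}$ of (not necessarily conforming) triangulations of $\Omega$, $$\liminf_{N\to\infty}N^{m/2}e_{m,\mathcal T_N}(f)_p\ \ge\ \left\|K_{m,p}\!\left(\frac{d^mf}{m!}\right)\right\|_{L^q(\Omega)}.$$ 2. For every $\varepsilon>0$ there exists an admissible sequence $(\mathcal T^\varepsilon_N)_{N\ge N_0}$ of triangulations of $\Omega$, all of them conforming if $p<\infty$ (and possibly non-conforming if $p=\infty$), such that $$\limsup_{N\to\infty}N^{m/2}e_{m,\mathcal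 T^\varepsilon_N}(f)_p\ \le\ \left\|K_{m,p}\!\left(\frac{d^mf}{m!}\right)\right\|_{L^q(\Omega)}+\varepsilon.$$ -/

import Mathlib

open MeasureTheory Filter Topology
open scoped ENNReal

noncomputable section

namespace OptimalMesh

/-- The Euclidean plane. -/
abbrev Plane : Type := EuclideanSpace ℝ (Fin 2)

/-- Nondegenerate triangles of the plane, given by three affinely independent vertices. -/
abbrev Tri : Type := Affine.Triangle ℝ Plane

/-- The closed triangle, as a subset of the plane. -/
def body (T : Tri) : Set Plane := convexHull ℝ (Set.range T.points)

/-! ### Polygonal domains and triangulations -/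

/-- A compact polygonal domain: a nonempty finite union of closed nondegenerate triangles. -/
def IsPolygonalDomain (Ω : Set Plane) : Prop :=
  ∃ P : Finset Tri, P.Nonempty ∧ Ω = ⋃ T ∈ P, body T

/-- `𝒯` is a (possibly non-conforming) triangulation of `Ω`: the triangles cover exactly `Ω` and
have pairwise disjoint interiors. -/
structure IsTriangulation (𝒯 : Finset Tri) (Ω : Set Plane) : Prop where
  cover : (⋃ T ∈ 𝒯, body T) = Ω
  nonoverlap : ∀ S ∈ 𝒯, ∀ T ∈ 𝒯, S ≠ T → Disjoint (interior (body S)) (interior (body T))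

/-- A family of triangles is conforming if any two of its members meet exactly in the convex hull
of their common vertices: the empty set, a common vertex or a common edge when the two
triangles are distinct and do not overlap. -/
def IsConforming (𝒯 : Finset Tri) : Prop :=
  ∀ S ∈ 𝒯, ∀ T ∈ 𝒯, body S ∩ body T = convexHull ℝ (Set.range S.points ∩ Set.range T.points)

/-- `(𝒯 N)_{N ≥ N₀}` is an admissible sequence of triangulations of `Ω`: each `𝒯 N` is a
triangulation of cardinality `N`, whose triangles have diameter at most `C N^(-1/2)`, with
`C` independent of `N`. -/
structure IsAdmissible (Ω : Set Plane) (N₀ : ℕ) (𝒯 : ℕ → Finset Tri) : Prop where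
  triangulation : ∀ N, N₀ ≤ N → IsTriangulation (𝒯 N) Ω
  card_eq : ∀ N, N₀ ≤ N → (𝒯 N).card = N
  diam_le : ∃ C : ℝ, 0 < C ∧ ∀ N, N₀ ≤ N → ∀ T ∈ 𝒯 N,
    Metric.diam (body T) ≤ C * (N : ℝ) ^ (-(1 / 2) : ℝ)

/-! ### Lagrange interpolation -/

/-- Value of a bivariate polynomial at a point of the plane. -/
def evalAt (P : MvPolynomial (Fin 2) ℝ) (z : Plane) : ℝ := MvPolynomial.eval (fun i => z i) P

/-- The point of `T` with barycentric coordinates `w i / n`. -/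
def node (n : ℕ) (T : Tri) (w : Fin 3 → ℕ) : Plane := ∑ i, ((w i : ℝ) / n) • T.points i

/-- `P` has total degree at most `n` and agrees with `v` at all the points of `T` with barycentric
coordinates in `{0, 1/n, 2/n, …, 1}`. -/
def IsInterpolant (n : ℕ) (T : Tri) (v : Plane → ℝ) (P : MvPolynomial (Fin 2) ℝ) : Prop :=
  P.totalDegree ≤ n ∧
    ∀ w : Fin 3 → ℕ, ∑ i, w i = n → evalAt P (node n T w) = v (node n T w)

theorem exists_isInterpolant {n : ℕ} (hn : 1 ≤ n) (T : Tri) (v : Plane → ℝ) :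
    ∃ P, IsInterpolant n T v P := by
  classical
  have hn' : (n : ℝ) ≠ 0 := by positivity
  have htop : affineSpan ℝ (Set.range T.points) = ⊤ :=
    (T.independent.affineSpan_eq_top_iff_card_eq_finrank_add_one).2 (by simp)
  let b : AffineBasis (Fin 3) ℝ Plane := ⟨T.points, T.independent, htop⟩
  let L : Fin 3 → MvPolynomial (Fin 2) ℝ := fun i =>
    MvPolynomial.C (b.coord i 0) + ∑ j : Fin 2,
      MvPolynomial.C ((b.coord i).linear (EuclideanSpace.single j 1)) * MvPolynomial.X j
  have hLev : ∀ i z, evalAt (L i) z = b.coord i z := by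
    intro i z
    have h1 : b.coord i z = (b.coord i).linear z + b.coord i 0 := by
      have := (b.coord i).map_vadd 0 z
      simpa using this
    have h2 : z = ∑ j : Fin 2, z j • (EuclideanSpace.single j (1 : ℝ) : Plane) := by
      ext k
      fin_cases k <;> simp
    rw [h1]
    conv_rhs => rw [h2, map_sum]
    simp [L, evalAt]
    ring
  have hLdeg : ∀ i, (L i).totalDegree ≤ 1 := by
    intro i
    refine (MvPolynomial.totalDegree_add _ _).trans (max_le (by simp) ?_)
    refine MvPolynomial.totalDegree_finsetSum_le fun j _ => ?_
    refine (MvPolynomial.totalDegree_mul _ _).trans ?_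
    rw [MvPolynomial.totalDegree_C, MvPolynomial.totalDegree_X]
  have hnode : ∀ w : Fin 3 → ℕ, ∑ i, w i = n → ∀ i, evalAt (L i) (node n T w) = w i / n := by
    intro w hw i
    rw [hLev]
    have hs : ∑ i, ((w i : ℝ) / n) = 1 := by
      rw [← Finset.sum_div, ← Nat.cast_sum, hw, div_self hn']
    have h3 : node n T w = Finset.univ.affineCombination ℝ b (fun i => (w i : ℝ) / n) := by
      rw [Finset.affineCombination_eq_linear_combination _ _ _ hs]
      rfl
    rw [h3, b.coord_apply_combination_of_mem (Finset.mem_univ i) hs]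
  let B : (Fin 3 → ℕ) → MvPolynomial (Fin 2) ℝ := fun w =>
    ∏ i, ∏ a ∈ Finset.range (w i),
      (MvPolynomial.C ((n : ℝ) / ((w i : ℝ) - a)) * L i - MvPolynomial.C ((a : ℝ) / ((w i : ℝ) - a)))
  have hBdeg : ∀ w : Fin 3 → ℕ, ∑ i, w i = n → (B w).totalDegree ≤ n := by
    intro w hw
    refine (MvPolynomial.totalDegree_finsetProd _ _).trans ?_
    rw [← hw]
    refine Finset.sum_le_sum fun i _ => ?_
    refine (MvPolynomial.totalDegree_finsetProd _ _).trans ?_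
    refine (Finset.sum_le_card_nsmul _ _ 1 fun a _ => ?_).trans (by simp)
    refine (MvPolynomial.totalDegree_sub _ _).trans (max_le ?_ (by simp))
    exact (MvPolynomial.totalDegree_mul _ _).trans (by simpa using hLdeg i)
  have hBev : ∀ w w' : Fin 3 → ℕ, ∑ i, w i = n → ∑ i, w' i = n →
      evalAt (B w) (node n T w') =
        ∏ i, ∏ a ∈ Finset.range (w i), (((w' i : ℝ) - a) / ((w i : ℝ) - a)) := by
    intro w w' _ hw'
    simp only [B, evalAt, map_prod, map_sub, map_mul, MvPolynomial.eval_C]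
    refine Finset.prod_congr rfl fun i _ => Finset.prod_congr rfl fun a _ => ?_
    have := hnode w' hw' i
    unfold evalAt at this
    rw [this]
    field_simp
  have hBself : ∀ w : Fin 3 → ℕ, ∑ i, w i = n → evalAt (B w) (node n T w) = 1 := by
    intro w hw
    rw [hBev w w hw hw]
    refine Finset.prod_eq_one fun i _ => Finset.prod_eq_one fun a ha => div_self ?_
    have : (a : ℝ) < w i := by exact_mod_cast Finset.mem_range.1 ha
    linarith
  have hBne : ∀ w w' : Fin 3 → ℕ, ∑ i, w i = n → ∑ i, w' i = n → w ≠ w' →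
      evalAt (B w) (node n T w') = 0 := by
    intro w w' hw hw' hne
    rw [hBev w w' hw hw']
    have : ∃ i, w' i < w i := by
      by_contra! h
      apply hne
      funext i
      by_contra hi
      have : ∑ i, w i < ∑ i, w' i :=
        Finset.sum_lt_sum (fun i _ => h i) ⟨i, Finset.mem_univ i, lt_of_le_of_ne (h i) hi⟩
      omega
    obtain ⟨i, hi⟩ := this
    exact Finset.prod_eq_zero (Finset.mem_univ i)
      (Finset.prod_eq_zero (Finset.mem_range.2 hi) (by simp))
  let P : MvPolynomial (Fin 2) ℝ :=
    ∑ w ∈ Finset.piAntidiag Finset.univ n, MvPolynomial.C (v (node n T w)) * B w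
  refine ⟨P, ?_, ?_⟩
  · refine MvPolynomial.totalDegree_finsetSum_le fun w hw => ?_
    refine (MvPolynomial.totalDegree_mul _ _).trans ?_
    simpa using hBdeg w (by simpa using hw)
  · intro w hw
    have : evalAt P (node n T w) = ∑ w' ∈ Finset.piAntidiag Finset.univ n,
        v (node n T w') * evalAt (B w') (node n T w) := by
      simp [P, evalAt]
    rw [this, Finset.sum_eq_single w]
    · rw [hBself w hw, mul_one]
    · intro w' hw' hne
      rw [hBne w' w (by simpa using hw') hw hne, mul_zero]
    · intro h
      exact absurd (by simpa using hw) h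

theorem existsUnique_isInterpolant {n : ℕ} (hn : 1 ≤ n) (T : Tri) (v : Plane → ℝ) :
    ∃! P, IsInterpolant n T v P := by
  classical
  let V := MvPolynomial.restrictTotalDegree (Fin 2) ℝ n
  let I := {w : Fin 3 → ℕ // ∑ i, w i = n}
  let S : Set (Fin 2 →₀ ℕ) := {d | (d.sum fun _ e => e) ≤ n}
  have hS : ∀ d : Fin 2 →₀ ℕ, d ∈ S ↔ d 0 + d 1 ≤ n := by
    intro d
    show (d.sum fun _ e => e) ≤ n ↔ _
    rw [Finsupp.sum_fintype _ _ (fun _ => rfl), Fin.sum_univ_two]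
  let e : I ≃ S :=
    { toFun := fun w => ⟨Finsupp.equivFunOnFinite.symm ![w.1 0, w.1 1], by
        have := w.2
        rw [Fin.sum_univ_three] at this
        rw [hS]
        simp
        omega⟩
      invFun := fun d => ⟨![d.1 0, d.1 1, n - d.1 0 - d.1 1], by
        have := (hS d.1).1 d.2
        rw [Fin.sum_univ_three]
        simp
        omega⟩
      left_inv := by
        rintro ⟨w, hw⟩
        rw [Fin.sum_univ_three] at hw
        ext i
        fin_cases i
        · simp
        · simp
        · simp
          omega
      right_inv := by
        rintro ⟨d, hd⟩
        ext i
        fin_cases i <;> simp }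
  have hI : Finite I := by
    refine Finite.of_injective
      (fun w : I => (⟨w.1, by simpa using w.2⟩ :
        (Finset.piAntidiag (Finset.univ : Finset (Fin 3)) n))) ?_
    intro a b h
    exact Subtype.ext (by simpa using h)
  have : Fintype I := Fintype.ofFinite I
  let bV : Module.Basis I ℝ V :=
    (MvPolynomial.basisRestrictSupport ℝ S).reindex e.symm
  have hfin : Module.Finite ℝ V := Module.Finite.of_basis bV
  have hrank : Module.finrank ℝ V = Module.finrank ℝ (I → ℝ) := by
    rw [Module.finrank_eq_card_basis bV, Module.finrank_fintype_fun_eq_card]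
  let E : V →ₗ[ℝ] (I → ℝ) :=
    { toFun := fun P w => evalAt P.1 (node n T w.1)
      map_add' := by intro P Q; ext w; simp [evalAt]
      map_smul' := by intro c P; ext w; simp [evalAt] }
  have hsurj : Function.Surjective E := by
    intro g
    have hinj : ∀ w w' : I, node n T w.1 = node n T w'.1 → w = w' := by
      intro w w' h
      have hn' : (n : ℝ) ≠ 0 := by positivity
      have hs : ∀ w : I, ∑ i, ((w.1 i : ℝ) / n) = 1 := by
        intro w
        rw [← Finset.sum_div, ← Nat.cast_sum, w.2, div_self hn']
      have h3 : ∀ w : I, node n T w.1 =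
          Finset.univ.affineCombination ℝ T.points (fun i => (w.1 i : ℝ) / n) := by
        intro w
        rw [Finset.affineCombination_eq_linear_combination _ _ _ (hs w)]
        rfl
      rw [h3, h3] at h
      have h4 := (affineIndependent_iff_eq_of_fintype_affineCombination_eq ℝ T.points).1
        T.independent _ _ (hs w) (hs w') h
      ext i
      have h5 := congrFun h4 i
      have h6 : (w.1 i : ℝ) / n = (w'.1 i : ℝ) / n := h5
      rw [div_left_inj' hn'] at h6
      exact_mod_cast h6
    obtain ⟨P, hP, hPv⟩ := exists_isInterpolant hn T
      (fun z => if h : ∃ w : I, node n T w.1 = z then g h.choose else 0)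
    refine ⟨⟨P, (MvPolynomial.mem_restrictTotalDegree _ _ _).2 hP⟩, ?_⟩
    ext w
    have h1 := hPv w.1 w.2
    have hex : ∃ w' : I, node n T w'.1 = node n T w.1 := ⟨w, rfl⟩
    have h2 : (if h : ∃ w' : I, node n T w'.1 = node n T w.1 then g h.choose else 0) = g w := by
      rw [dif_pos hex, hinj _ _ hex.choose_spec]
    exact h1.trans h2
  have hinj : Function.Injective E :=
    (LinearMap.injective_iff_surjective_of_finrank_eq_finrank hrank).2 hsurj
  obtain ⟨P, hP⟩ := exists_isInterpolant hn T v
  refine ⟨P, hP, fun Q hQ => ?_⟩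
  have : (⟨Q, (MvPolynomial.mem_restrictTotalDegree _ _ _).2 hQ.1⟩ : V) =
      ⟨P, (MvPolynomial.mem_restrictTotalDegree _ _ _).2 hP.1⟩ := by
    apply hinj
    ext w
    exact (hQ.2 w.1 w.2).trans (hP.2 w.1 w.2).symm
  exact congrArg Subtype.val this

/-- The local interpolation operator `I_{m,T}`: the unique polynomial of total degree at most
`m - 1` that agrees with `v` at the points of `T` with barycentric coordinates in
`{0, 1/(m-1), …, 1}` (for `m ≥ 2`). -/
def interp (m : ℕ) (T : Tri) (v : Plane → ℝ) : MvPolynomial (Fin 2) ℝ :=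
  Classical.epsilon (IsInterpolant (m - 1) T v)

theorem interp_spec {m : ℕ} (hm : 2 ≤ m) (T : Tri) (v : Plane → ℝ) :
    IsInterpolant (m - 1) T v (interp m T v) :=
  Classical.epsilon_spec (exists_isInterpolant (by omega) T v)

/-! ### Interpolation errors and the shape function -/

/-- The local error `e_{m,T}(v)_p = ‖v - I_{m,T} v‖_{L^p(T)}`. -/
def localError (m : ℕ) (p : ℝ≥0∞) (T : Tri) (v : Plane → ℝ) : ℝ≥0∞ :=
  eLpNorm (fun z => v z - evalAt (interp m T v) z) p (volume.restrict (body T))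

/-- The global error `e_{m,𝒯}(v)_p`: the `ℓ^p` norm over `T ∈ 𝒯` of the local errors. -/
def globalError (m : ℕ) (p : ℝ≥0∞) (𝒯 : Finset Tri) (v : Plane → ℝ) : ℝ≥0∞ :=
  if p = ∞ then ⨆ T ∈ 𝒯, localError m p T v
  else (∑ T ∈ 𝒯, localError m p T v ^ p.toReal) ^ (1 / p.toReal)

/-- The shape function `K_{m,p}(π)`: the infimum of `e_{m,T}(π)_p` over triangles of unit area. -/
def shapeFun (m : ℕ) (p : ℝ≥0∞) (π : MvPolynomial (Fin 2) ℝ) : ℝ≥0∞ :=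
  ⨅ (T : Tri) (_ : volume (body T) = 1), localError m p T (evalAt π)

/-- The homogeneous polynomial
`d^m f_z / m! = ∑_{k+l=m} ∂^m f/∂x^k∂y^l (z) x^k/k! y^l/l!`, the derivatives being those
of `f` as a function on `Ω`. -/
def derivForm (m : ℕ) (f : Plane → ℝ) (Ω : Set Plane) (z : Plane) : MvPolynomial (Fin 2) ℝ :=
  ∑ k ∈ Finset.range (m + 1),
    MvPolynomial.C
        (iteratedFDerivWithin ℝ m f Ω z
            (fun i : Fin m => EuclideanSpace.single (if (i : ℕ) < k then (0 : Fin 2) else 1) 1) /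
          ((Nat.factorial k : ℝ) * (Nat.factorial (m - k) : ℝ))) *
      MvPolynomial.X 0 ^ k * MvPolynomial.X 1 ^ (m - k)

/-- The quantity `‖K_{m,p}(d^m f / m!)‖_{L^q(Ω)}` with `1/q = m/2 + 1/p`; here `q ∈ (0, 1]`, and
`‖g‖_{L^q(Ω)} = (∫_Ω |g|^q)^{1/q}`. -/
def shapeNorm (m : ℕ) (p : ℝ≥0∞) (f : Plane → ℝ) (Ω : Set Plane) : ℝ≥0∞ :=
  eLpNorm (fun z => shapeFun m p (derivForm m f Ω z)) ((m : ℝ≥0∞) / 2 + 1 / p)⁻¹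
    (volume.restrict Ω)

end OptimalMesh

end

noncomputable section

namespace OptimalMesh

/-! Write `r = rexp m p = m / 2 + 1 / p`, so that `q = 1 / r`. Interpolation reproduces polynomials
of degree below `m` and is stable in the uniform norm with a constant independent of the shape of
the triangle (`abs_resid_le`). Hence, by Taylor's formula, the error of `f` on a small triangle is
that of the homogeneous form `π = d^m f / m!` frozen at a nearby point, up to `diam ^ m` times an
oscillation of the `m`-th derivative. The error of a form `π` is invariant under translation, and a
homothety of any sign multiplies it by the `r`-th power of the ratio of the areas. Therefore `K(π)
|T| ^ r ≤ e_T(π)` for every `T` (`shapeFun_mul_le`).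

Lower bound. Raised to the power `q`, the last inequality integrates to `∫ K ^ q ≤ ∑ (e_T(f) + s) ^
q`, where `s` bounds the Taylor remainders. Hölder and Minkowski turn this into `‖K‖_q ≤ N ^ (m / 2)
(e(f) + N ^ (1 / p) s)`, and admissibility gives `s = o(N ^ (-r))` (`sum_rpow_le_globalError`,
`shapeNorm_le_liminf`).

Upper bound. The error is equidistributed. The domain is divided into triangles `R` on which `π`
hardly varies; for each, an almost optimal triangle is scaled so that its copies of ratio `h` all
have error at most `h ^ (2 r)`. About `h ^ (-2) ∫ K ^ q` copies are then needed (`exists_shapes`).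
To control Taylor remainders, `K` is first replaced by the infimum over triangles of diameter at
most `n`, which is continuous in the point and decreases to `K`. Each `R` is tiled by translates of
a triangle and of its reflection; tiles meeting the boundary of `R` are cut along it, and there are
only `o(h ^ (-2))` of them (`exists_local_mesh`). Between neighbouring triangles `R` the meshes do
not match, but every triangle carries boundedly many hanging nodes, so splitting repairs this at the
cost of a constant factor on the `o(h ^ (-2))` exceptional triangles (`exists_global_mesh`).

It remains to have exactly `N` triangles. With `h` chosen so that `N h ^ 2` is a constant slightly
above `∫ K ^ q`, the mesh has too few, and the missing ones are added inside a single triangle. If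
`p < ∞`, they come from splitting repeatedly at points of the boundary of the domain, which keeps
conformity, and the exceptional triangles matter little because their total area is small
(`exists_conforming_mesh`). If `p = ∞`, each exceptional triangle must itself have a small error, so
all are subdivided further and conformity is given up (`exists_uniform_mesh`). -/

/-! ### Barycentric coordinates -/

/-- The vertices of a triangle as an affine basis of the plane. -/
def bary (T : Tri) : AffineBasis (Fin 3) ℝ Plane :=
  ⟨T.points, T.independent,
    (T.independent.affineSpan_eq_top_iff_card_eq_finrank_add_one).2 (by simp)⟩

/-- The barycentric coordinate functions of a triangle. -/
def bco (T : Tri) (i : Fin 3) : Plane →ᵃ[ℝ] ℝ := (bary T).coord i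

theorem mem_body_iff {T : Tri} {z : Plane} : z ∈ body T ↔ ∀ i, 0 ≤ bco T i z := by
  have := (bary T).convexHull_eq_nonneg_coord
  exact Set.ext_iff.1 this z

theorem mem_interior_body_iff {T : Tri} {z : Plane} :
    z ∈ interior (body T) ↔ ∀ i, 0 < bco T i z := by
  have := (bary T).interior_convexHull
  exact Set.ext_iff.1 this z

theorem sum_bco (T : Tri) (z : Plane) : ∑ i, bco T i z = 1 :=
  (bary T).sum_coord_apply_eq_one z

theorem bco_le_one {T : Tri} {z : Plane} (hz : z ∈ body T) (i : Fin 3) : bco T i z ≤ 1 := by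
  rw [← sum_bco T z]
  exact Finset.single_le_sum (f := fun i => bco T i z) (fun j _ => mem_body_iff.1 hz j)
    (Finset.mem_univ i)

theorem bco_points (T : Tri) (i j : Fin 3) : bco T i (T.points j) = if i = j then 1 else 0 :=
  (bary T).coord_apply i j

theorem sum_bco_smul (T : Tri) (z : Plane) : ∑ i, bco T i z • T.points i = z :=
  (bary T).linear_combination_coord_eq_self z

theorem bco_sum_smul (T : Tri) (w : Fin 3 → ℝ) (hw : ∑ i, w i = 1) (i : Fin 3) :
    bco T i (∑ j, w j • T.points j) = w i := by
  have h3 : ∑ j, w j • T.points j = Finset.univ.affineCombination ℝ (bary T) w := by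
    rw [Finset.affineCombination_eq_linear_combination _ _ _ hw]
    rfl
  rw [h3]
  exact (bary T).coord_apply_combination_of_mem (Finset.mem_univ i) hw

theorem ext_bco (T : Tri) {x y : Plane} (h : ∀ i, bco T i x = bco T i y) : x = y := by
  rw [← sum_bco_smul T x, ← sum_bco_smul T y]
  exact Finset.sum_congr rfl fun i _ => by rw [h]

/-- An affine function is determined by its values at the vertices. -/
theorem affine_eq_sum (T : Tri) (l : Plane →ᵃ[ℝ] ℝ) (z : Plane) :
    l z = ∑ i, bco T i z * l (T.points i) := by
  have h1 : Finset.univ.affineCombination ℝ (bary T) (fun i => bco T i z) = z :=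
    (bary T).affineCombination_coord_eq_self z
  conv_lhs => rw [← h1]
  rw [Finset.map_affineCombination _ _ _ (sum_bco T z),
    Finset.affineCombination_eq_linear_combination _ _ _ (sum_bco T z)]
  rfl

theorem points_mem_body (T : Tri) (i : Fin 3) : T.points i ∈ body T :=
  subset_convexHull ℝ _ (Set.mem_range_self i)

theorem convex_body (T : Tri) : Convex ℝ (body T) := convex_convexHull ℝ _

theorem isCompact_body (T : Tri) : IsCompact (body T) :=
  (Set.finite_range _).isCompact_convexHull ℝ

theorem isClosed_body (T : Tri) : IsClosed (body T) := (isCompact_body T).isClosed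

theorem isBounded_body (T : Tri) : Bornology.IsBounded (body T) := (isCompact_body T).isBounded

theorem measurableSet_body (T : Tri) : MeasurableSet (body T) := (isClosed_body T).measurableSet

theorem nonempty_interior_body (T : Tri) : (interior (body T)).Nonempty :=
  ⟨_, (bary T).centroid_mem_interior_convexHull⟩

theorem nonempty_body (T : Tri) : (body T).Nonempty := ⟨_, points_mem_body T 0⟩

theorem closure_interior_body (T : Tri) : closure (interior (body T)) = body T := by
  rw [(convex_body T).closure_interior_eq_closure_of_nonempty_interior (nonempty_interior_body T),
    (isClosed_body T).closure_eq]

theorem volume_body_pos (T : Tri) : 0 < volume (body T) :=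
  MeasureTheory.Measure.measure_pos_of_nonempty_interior _ (nonempty_interior_body T)

theorem volume_body_ne_top (T : Tri) : volume (body T) ≠ ∞ := (isCompact_body T).measure_lt_top.ne

theorem volume_frontier_body (T : Tri) : volume (frontier (body T)) = 0 :=
  (convex_body T).addHaar_frontier _

theorem continuous_bco (T : Tri) (i : Fin 3) : Continuous (bco T i) :=
  (bco T i).continuous_of_finiteDimensional

theorem body_subset_iff {T : Tri} {s : Set Plane} (hs : Convex ℝ s) :
    body T ⊆ s ↔ ∀ i, T.points i ∈ s := by
  rw [body, hs.convexHull_subset_iff, Set.range_subset_iff]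

theorem dist_le_diam {T : Tri} {x y : Plane} (hx : x ∈ body T) (hy : y ∈ body T) :
    dist x y ≤ Metric.diam (body T) := Metric.dist_le_diam_of_mem (isBounded_body T) hx hy

theorem diam_le_of_subset {S T : Tri} (h : body S ⊆ body T) :
    Metric.diam (body S) ≤ Metric.diam (body T) := Metric.diam_mono h (isBounded_body T)

theorem node_mem_body {n : ℕ} (hn : 1 ≤ n) (T : Tri) {w : Fin 3 → ℕ} (hw : ∑ i, w i = n) :
    node n T w ∈ body T ∧ ∀ i, bco T i (node n T w) = w i / n := by
  have hn' : (n : ℝ) ≠ 0 := by positivity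
  have hs : ∑ i, ((w i : ℝ) / n) = 1 := by
    rw [← Finset.sum_div, ← Nat.cast_sum, hw, div_self hn']
  have h : ∀ i, bco T i (node n T w) = w i / n := fun i => bco_sum_smul T _ hs i
  exact ⟨mem_body_iff.2 fun i => by rw [h]; positivity, h⟩

/-! ### Polynomial functions -/

/-- `g` is a polynomial function of total degree at most `n`. -/
def IsPoly (n : ℕ) (g : Plane → ℝ) : Prop :=
  ∃ P : MvPolynomial (Fin 2) ℝ, P.totalDegree ≤ n ∧ ∀ z, evalAt P z = g z

theorem IsPoly.mono {n k : ℕ} {g : Plane → ℝ} (h : IsPoly n g) (hk : n ≤ k) : IsPoly k g := by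
  obtain ⟨P, h1, h2⟩ := h
  exact ⟨P, h1.trans hk, h2⟩

theorem isPoly_const (n : ℕ) (c : ℝ) : IsPoly n (fun _ => c) :=
  ⟨MvPolynomial.C c, by simp, fun z => by simp [evalAt]⟩

theorem IsPoly.add {n : ℕ} {g h : Plane → ℝ} (hg : IsPoly n g) (hh : IsPoly n h) :
    IsPoly n (fun z => g z + h z) := by
  obtain ⟨P, h1, h2⟩ := hg
  obtain ⟨Q, h3, h4⟩ := hh
  exact ⟨P + Q, (MvPolynomial.totalDegree_add _ _).trans (max_le h1 h3), fun z => by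
    simp only [← h2, ← h4]; simp [evalAt]⟩

theorem IsPoly.mul {n k : ℕ} {g h : Plane → ℝ} (hg : IsPoly n g) (hh : IsPoly k h) :
    IsPoly (n + k) (fun z => g z * h z) := by
  obtain ⟨P, h1, h2⟩ := hg
  obtain ⟨Q, h3, h4⟩ := hh
  exact ⟨P * Q, (MvPolynomial.totalDegree_mul _ _).trans (add_le_add h1 h3), fun z => by
    simp only [← h2, ← h4]; simp [evalAt]⟩

theorem IsPoly.const_mul {n : ℕ} {g : Plane → ℝ} (c : ℝ) (hg : IsPoly n g) :
    IsPoly n (fun z => c * g z) := by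
  simpa using (isPoly_const 0 c).mul hg

theorem IsPoly.sub {n : ℕ} {g h : Plane → ℝ} (hg : IsPoly n g) (hh : IsPoly n h) :
    IsPoly n (fun z => g z - h z) := by
  simpa [sub_eq_add_neg] using hg.add (hh.const_mul (-1))

theorem IsPoly.sum {ι : Type*} {n : ℕ} {s : Finset ι} {g : ι → Plane → ℝ}
    (h : ∀ i ∈ s, IsPoly n (g i)) : IsPoly n (fun z => ∑ i ∈ s, g i z) := by
  classical
  induction s using Finset.induction_on with
  | empty => simpa using isPoly_const n 0
  | insert a s ha ih =>
    simp only [Finset.sum_insert ha]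
    exact (h _ (Finset.mem_insert_self _ _)).add
      (ih fun i hi => h i (Finset.mem_insert_of_mem hi))

theorem IsPoly.prod {ι : Type*} {n : ι → ℕ} {s : Finset ι} {g : ι → Plane → ℝ}
    (h : ∀ i ∈ s, IsPoly (n i) (g i)) :
    IsPoly (∑ i ∈ s, n i) (fun z => ∏ i ∈ s, g i z) := by
  classical
  induction s using Finset.induction_on with
  | empty => simpa using isPoly_const 0 1
  | insert a s ha ih =>
    simp only [Finset.prod_insert ha, Finset.sum_insert ha]
    exact (h _ (Finset.mem_insert_self _ _)).mul
      (ih fun i hi => h i (Finset.mem_insert_of_mem hi))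

theorem isPoly_coord (j : Fin 2) : IsPoly 1 (fun z => z j) :=
  ⟨MvPolynomial.X j, by simp, fun z => by simp [evalAt]⟩

theorem plane_eq_sum (z : Plane) : z = ∑ j : Fin 2, z j • (EuclideanSpace.single j (1 : ℝ)) := by
  ext k
  fin_cases k <;> simp

theorem isPoly_affine (l : Plane →ᵃ[ℝ] ℝ) : IsPoly 1 (fun z => l z) := by
  have h : ∀ z, l z = l 0 + ∑ j : Fin 2, l.linear (EuclideanSpace.single j 1) * z j := by
    intro z
    have h1 : l z = l.linear z + l 0 := by
      have := l.map_vadd 0 z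
      simpa using this
    rw [h1]
    rw [add_comm, add_right_inj]
    conv_lhs => rw [plane_eq_sum z, map_sum]
    exact Finset.sum_congr rfl fun j _ => by rw [map_smul, smul_eq_mul, mul_comm]
  rw [funext h]
  exact (isPoly_const 1 _).add (IsPoly.sum fun j _ => (isPoly_coord j).const_mul _)

theorem continuous_evalAt (P : MvPolynomial (Fin 2) ℝ) : Continuous (evalAt P) := by
  have h : Continuous fun z : Plane => (fun i => z i : Fin 2 → ℝ) := by fun_prop
  exact (MvPolynomial.continuous_eval P).comp h

theorem IsPoly.continuous {n : ℕ} {g : Plane → ℝ} (h : IsPoly n g) : Continuous g := by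
  obtain ⟨P, -, h2⟩ := h
  exact (continuous_evalAt P).congr h2

theorem evalAt_eq_sum (P : MvPolynomial (Fin 2) ℝ) (z : Plane) :
    evalAt P z = ∑ d ∈ P.support, P.coeff d * (z 0 ^ d 0 * z 1 ^ d 1) := by
  rw [evalAt, MvPolynomial.eval_eq']
  simp [Fin.prod_univ_two]

theorem totalDegree_le_iff {P : MvPolynomial (Fin 2) ℝ} {d : Fin 2 →₀ ℕ} (hd : d ∈ P.support) :
    d 0 + d 1 ≤ P.totalDegree := by
  have := MvPolynomial.le_totalDegree hd
  rwa [Finsupp.sum_fintype _ _ (fun _ => rfl), Fin.sum_univ_two] at this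

theorem isPoly_monomial (a b : ℕ) : IsPoly (a + b) (fun z => z 0 ^ a * z 1 ^ b) := by
  have := (IsPoly.prod (s := Finset.range a) (n := fun _ => 1) (g := fun _ z => z 0)
    fun i _ => isPoly_coord 0).mul (IsPoly.prod (s := Finset.range b) (n := fun _ => 1)
      (g := fun _ z => z 1) fun i _ => isPoly_coord 1)
  simpa using this

/-- Polynomial functions are stable under affine substitutions of the form `x ↦ σ x + c`. -/
theorem IsPoly.comp_hom {n : ℕ} {g : Plane → ℝ} (h : IsPoly n g) (σ : ℝ) (c : Plane) :
    IsPoly n (fun z => g (σ • z + c)) := by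
  obtain ⟨P, h1, h2⟩ := h
  have hc : ∀ j : Fin 2, IsPoly 1 (fun z : Plane => (σ • z + c) j) := fun j => by
    simpa using ((isPoly_coord j).const_mul σ).add (isPoly_const 1 (c j))
  have : ∀ z, g (σ • z + c) = ∑ d ∈ P.support, P.coeff d *
      ((∏ _i ∈ Finset.range (d 0), (σ • z + c) 0) * ∏ _i ∈ Finset.range (d 1), (σ • z + c) 1) := by
    intro z
    rw [← h2, evalAt_eq_sum]
    simp
  simp_rw [this]
  refine IsPoly.sum fun d hd => IsPoly.const_mul _ ?_
  have := (IsPoly.prod (s := Finset.range (d 0)) (n := fun _ => 1)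
    (g := fun _ z => (σ • z + c) 0) fun i _ => hc 0).mul
      (IsPoly.prod (s := Finset.range (d 1)) (n := fun _ => 1)
      (g := fun _ z => (σ • z + c) 1) fun i _ => hc 1)
  refine this.mono ?_
  simpa using (totalDegree_le_iff hd).trans h1

/-- Translating a homogeneous polynomial changes it by a polynomial of lower degree. -/
theorem isPoly_monomial_translate_sub (a b n : ℕ) (hab : a + b = n + 1) (c : Plane) :
    IsPoly n (fun z => (z + c) 0 ^ a * (z + c) 1 ^ b - z 0 ^ a * z 1 ^ b) := by
  have key : ∀ (j : Fin 2) (k : ℕ) (u : Plane → ℝ),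
      IsPoly (k + 1) (fun z => u (z + c)) → IsPoly k (fun z => u (z + c) - u z) →
      IsPoly (k + 1) (fun z => (z + c) j * u (z + c) - z j * u z) := by
    intro j k u h1 h2
    have h3 := ((isPoly_coord j).mul h2).add ((h1.const_mul (c j)).mono (by omega : k + 1 ≤ 1 + k))
    rw [add_comm 1 k] at h3
    refine cast ?_ h3
    congr 1
    funext z
    simp
    ring
  have ht : ∀ {k : ℕ} {u : Plane → ℝ}, IsPoly k u → IsPoly k (fun z => u (z + c)) := by
    intro k u h
    simpa using h.comp_hom 1 c
  have hone : ∀ j : Fin 2, IsPoly 0 (fun z : Plane => (z + c) j - z j) := fun j => by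
    simpa using isPoly_const 0 (c j)
  induction n generalizing a b with
  | zero =>
    rcases a with _ | a
    · obtain rfl : b = 1 := by omega
      simpa using hone 1
    · obtain ⟨rfl, rfl⟩ : a = 0 ∧ b = 0 := by omega
      simpa using hone 0
  | succ n ih =>
    rcases a with _ | a
    · obtain ⟨b, rfl⟩ : ∃ b', b = b' + 1 := ⟨b - 1, by omega⟩
      have h1 := ih 0 b (by omega)
      have h2 := ht ((isPoly_monomial 0 b).mono (by omega : 0 + b ≤ n + 1))
      have := key 1 n (fun z => z 0 ^ 0 * z 1 ^ b) h2 h1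
      refine cast ?_ this
      congr 1
      funext z
      simp only [pow_succ, pow_zero]
      ring
    · have h1 := ih a b (by omega)
      have h2 := ht ((isPoly_monomial a b).mono (by omega : a + b ≤ n + 1))
      have := key 0 n (fun z => z 0 ^ a * z 1 ^ b) h2 h1
      refine cast ?_ this
      congr 1
      funext z
      simp only [pow_succ]
      ring

/-- Interpolation is exact in degree at most `m - 1`, so this makes the residual of a homogeneous
form insensitive to translations. -/
theorem isPoly_translate_sub {m : ℕ} (hm : 1 ≤ m) {P : MvPolynomial (Fin 2) ℝ}
    (hP : P.IsHomogeneous m) (c : Plane) :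
    IsPoly (m - 1) (fun z => evalAt P (z + c) - evalAt P z) := by
  simp_rw [evalAt_eq_sum, ← Finset.sum_sub_distrib, ← mul_sub]
  refine IsPoly.sum fun d hd => IsPoly.const_mul _ ?_
  refine isPoly_monomial_translate_sub _ _ _ ?_ c
  have := hP (MvPolynomial.mem_support_iff.1 hd)
  rw [Finsupp.weight_apply, Finsupp.sum_fintype _ _ (by simp), Fin.sum_univ_two] at this
  simp at this
  omega

theorem evalAt_smul {m : ℕ} {P : MvPolynomial (Fin 2) ℝ} (hP : P.IsHomogeneous m) (σ : ℝ)
    (z : Plane) : evalAt P (σ • z) = σ ^ m * evalAt P z := by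
  rw [evalAt_eq_sum, evalAt_eq_sum, Finset.mul_sum]
  refine Finset.sum_congr rfl fun d hd => ?_
  have := hP (MvPolynomial.mem_support_iff.1 hd)
  rw [Finsupp.weight_apply, Finsupp.sum_fintype _ _ (by simp), Fin.sum_univ_two] at this
  simp at this
  rw [← this]
  simp
  ring

/-! ### The interpolation operator -/

/-- The Lagrange basis in barycentric coordinates. -/
def lag (n : ℕ) (w : Fin 3 → ℕ) (μ : Fin 3 → ℝ) : ℝ :=
  ∏ i, ∏ a ∈ Finset.range (w i), (((n : ℝ) * μ i - a) / ((w i : ℝ) - a))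

theorem isPoly_lag (n : ℕ) (T : Tri) {w : Fin 3 → ℕ} (hw : ∑ i, w i = n) :
    IsPoly n (fun z => lag n w fun i => bco T i z) := by
  have : IsPoly (∑ i, ∑ _a ∈ Finset.range (w i), 1)
      (fun z => lag n w fun i => bco T i z) := by
    refine IsPoly.prod fun i _ => IsPoly.prod fun a _ => ?_
    have h := (((isPoly_affine (bco T i)).const_mul n).sub (isPoly_const 1 (a : ℝ))).const_mul
      (((w i : ℝ) - a)⁻¹)
    refine cast ?_ h
    congr 1
    funext z
    rw [div_eq_inv_mul]
  simpa [hw] using this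

theorem lag_node {n : ℕ} (hn : 1 ≤ n) {w w' : Fin 3 → ℕ} (hw : ∑ i, w i = n)
    (hw' : ∑ i, w' i = n) : lag n w (fun i => (w' i : ℝ) / n) = if w = w' then 1 else 0 := by
  have hn' : (n : ℝ) ≠ 0 := by positivity
  have h0 : lag n w (fun i => (w' i : ℝ) / n) =
      ∏ i, ∏ a ∈ Finset.range (w i), (((w' i : ℝ) - a) / ((w i : ℝ) - a)) := by
    refine Finset.prod_congr rfl fun i _ => Finset.prod_congr rfl fun a _ => ?_
    rw [mul_div_cancel₀ _ hn']
  rw [h0]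
  split_ifs with h
  · subst h
    refine Finset.prod_eq_one fun i _ => Finset.prod_eq_one fun a ha => div_self ?_
    have : (a : ℝ) < w i := by exact_mod_cast Finset.mem_range.1 ha
    linarith
  -- Distinct multi-indices with equal sums satisfy `w' i < w i` for some `i`; the factor `a = w' i`
  -- then vanishes.
  · have : ∃ i, w' i < w i := by
      by_contra! hle
      apply h
      funext i
      by_contra hi
      have : ∑ i, w i < ∑ i, w' i :=
        Finset.sum_lt_sum (fun i _ => hle i) ⟨i, Finset.mem_univ i, lt_of_le_of_ne (hle i) hi⟩
      omega
    obtain ⟨i, hi⟩ := this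
    exact Finset.prod_eq_zero (Finset.mem_univ i)
      (Finset.prod_eq_zero (Finset.mem_range.2 hi) (by simp))

/-- There are `n` factors in all; each numerator lies between `-n` and `n`, and each denominator `w
i - a` is at least `1`. -/
theorem abs_lag_le (n : ℕ) {w : Fin 3 → ℕ} (hw : ∑ i, w i = n) {μ : Fin 3 → ℝ}
    (h0 : ∀ i, 0 ≤ μ i) (h1 : ∀ i, μ i ≤ 1) : |lag n w μ| ≤ (n : ℝ) ^ n := by
  have hwn : ∀ i, w i ≤ n := fun i => by
    rw [← hw]; exact Finset.single_le_sum (f := w) (fun _ _ => Nat.zero_le _) (Finset.mem_univ i)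
  rw [lag, Finset.abs_prod]
  calc ∏ i, |∏ a ∈ Finset.range (w i), (((n : ℝ) * μ i - a) / ((w i : ℝ) - a))|
      ≤ ∏ i, (n : ℝ) ^ (w i) := by
        refine Finset.prod_le_prod (fun _ _ => abs_nonneg _) fun i _ => ?_
        rw [Finset.abs_prod]
        have : (n : ℝ) ^ (w i) = ∏ _a ∈ Finset.range (w i), (n : ℝ) := by simp
        rw [this]
        refine Finset.prod_le_prod (fun _ _ => abs_nonneg _) fun a ha => ?_
        have ha1 : a + 1 ≤ w i := Finset.mem_range.1 ha
        have ha2 : (a : ℝ) + 1 ≤ w i := by exact_mod_cast ha1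
        have ha3 : (w i : ℝ) ≤ n := by exact_mod_cast hwn i
        have ha0 : (0 : ℝ) ≤ a := by positivity
        have hn0 : (0 : ℝ) ≤ n := by positivity
        rw [abs_div, abs_of_pos (by linarith : (0 : ℝ) < (w i : ℝ) - a),
          div_le_iff₀ (by linarith)]
        have h3 : |(n : ℝ) * μ i - a| ≤ n := by
          rw [abs_le]
          have := mul_nonneg hn0 (h0 i)
          have := mul_le_mul_of_nonneg_left (h1 i) hn0
          constructor <;> linarith
        exact h3.trans (le_mul_of_one_le_right hn0 (by linarith))
    _ = (n : ℝ) ^ n := by rw [Finset.prod_pow_eq_pow_sum, hw]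

/-- The multi-indices of the interpolation nodes. -/
def nodeIdx (n : ℕ) : Finset (Fin 3 → ℕ) := Finset.piAntidiag Finset.univ n

theorem mem_nodeIdx {n : ℕ} {w : Fin 3 → ℕ} : w ∈ nodeIdx n ↔ ∑ i, w i = n := by
  simp [nodeIdx]

theorem eval_interp_eq_of_isPoly {m : ℕ} (hm : 2 ≤ m) {T : Tri} {v g : Plane → ℝ}
    (hg : IsPoly (m - 1) g)
    (h : ∀ w : Fin 3 → ℕ, ∑ i, w i = m - 1 → g (node (m - 1) T w) = v (node (m - 1) T w))
    (z : Plane) : evalAt (interp m T v) z = g z := by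
  obtain ⟨P, h1, h2⟩ := hg
  have hP : IsInterpolant (m - 1) T v P := ⟨h1, fun w hw => by rw [h2, h w hw]⟩
  rw [(existsUnique_isInterpolant (by omega) T v).unique (interp_spec hm T v) hP, h2]

/-- Lagrange's formula for the interpolant. -/
theorem eval_interp {m : ℕ} (hm : 2 ≤ m) (T : Tri) (v : Plane → ℝ) (z : Plane) :
    evalAt (interp m T v) z =
      ∑ w ∈ nodeIdx (m - 1), v (node (m - 1) T w) * lag (m - 1) w fun i => bco T i z := by
  have hn : 1 ≤ m - 1 := by omega
  refine eval_interp_eq_of_isPoly hm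
    (IsPoly.sum fun w hw => (isPoly_lag _ T (mem_nodeIdx.1 hw)).const_mul _) (fun w hw => ?_) z
  rw [Finset.sum_eq_single w]
  · simp_rw [(node_mem_body hn T hw).2]
    rw [lag_node hn hw hw, if_pos rfl, mul_one]
  · intro w' hw' hne
    simp_rw [(node_mem_body hn T hw).2]
    rw [lag_node hn (mem_nodeIdx.1 hw') hw, if_neg hne, mul_zero]
  · exact fun h => absurd (mem_nodeIdx.2 hw) h

/-- The residual `v - I_{m,T} v`. -/
def resid (m : ℕ) (T : Tri) (v : Plane → ℝ) (z : Plane) : ℝ := v z - evalAt (interp m T v) z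

theorem localError_eq (m : ℕ) (p : ℝ≥0∞) (T : Tri) (v : Plane → ℝ) :
    localError m p T v = eLpNorm (resid m T v) p (volume.restrict (body T)) := rfl

theorem resid_add {m : ℕ} (hm : 2 ≤ m) (T : Tri) (v w : Plane → ℝ) (z : Plane) :
    resid m T (fun x => v x + w x) z = resid m T v z + resid m T w z := by
  simp only [resid, eval_interp hm, add_mul, Finset.sum_add_distrib]
  ring

theorem resid_const_mul {m : ℕ} (hm : 2 ≤ m) (T : Tri) (c : ℝ) (v : Plane → ℝ) (z : Plane) :
    resid m T (fun x => c * v x) z = c * resid m T v z := by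
  simp only [resid, eval_interp hm, mul_sub, Finset.mul_sum, mul_assoc]

theorem resid_isPoly {m : ℕ} (hm : 2 ≤ m) (T : Tri) {g : Plane → ℝ} (hg : IsPoly (m - 1) g)
    (z : Plane) : resid m T g z = 0 := by
  rw [resid, eval_interp_eq_of_isPoly hm hg (fun _ _ => rfl), sub_self]

/-- A bound for the norm of `v ↦ v - I_{m,T} v` in the uniform norm. -/
def stab (m : ℕ) : ℝ := 1 + (nodeIdx (m - 1)).card * ((m - 1 : ℕ) : ℝ) ^ (m - 1)

theorem one_le_stab (m : ℕ) : 1 ≤ stab m := by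
  have : (0 : ℝ) ≤ (nodeIdx (m - 1)).card * ((m - 1 : ℕ) : ℝ) ^ (m - 1) := by positivity
  unfold stab
  linarith

/-- The Lagrange basis depends on the triangle only through barycentric coordinates, so the constant
is the same for all shapes. This uniformity is indispensable, since nothing prevents the triangles
of a mesh from being very flat. -/
theorem abs_resid_le {m : ℕ} (hm : 2 ≤ m) (T : Tri) {v : Plane → ℝ} {B : ℝ}
    (hv : ∀ z ∈ body T, |v z| ≤ B) {z : Plane} (hz : z ∈ body T) :
    |resid m T v z| ≤ stab m * B := by
  have hB : 0 ≤ B := (abs_nonneg _).trans (hv z hz)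
  have h1 : |evalAt (interp m T v) z| ≤
      (nodeIdx (m - 1)).card * ((m - 1 : ℕ) : ℝ) ^ (m - 1) * B := by
    rw [eval_interp hm]
    refine (Finset.abs_sum_le_sum_abs _ _).trans ?_
    rw [mul_assoc, ← nsmul_eq_mul]
    refine Finset.sum_le_card_nsmul _ _ _ fun w hw => ?_
    rw [abs_mul, mul_comm]
    have hw' := mem_nodeIdx.1 hw
    exact mul_le_mul (abs_lag_le _ hw' (mem_body_iff.1 hz) (bco_le_one hz))
      (hv _ (node_mem_body (by omega) T hw').1) (abs_nonneg _) (by positivity)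
  calc |resid m T v z| ≤ |v z| + |evalAt (interp m T v) z| := abs_sub _ _
    _ ≤ B + (nodeIdx (m - 1)).card * ((m - 1 : ℕ) : ℝ) ^ (m - 1) * B := add_le_add (hv z hz) h1
    _ = stab m * B := by unfold stab; ring

theorem continuousOn_resid {m : ℕ} (T : Tri) {v : Plane → ℝ}
    {s : Set Plane} (hv : ContinuousOn v s) : ContinuousOn (resid m T v) s :=
  hv.sub (continuous_evalAt _).continuousOn

/-- For `p = ∞` the convention `p.toReal⁻¹ = 0` makes the power of the area equal to `1`, so one
formula serves every `p`, here and below. -/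
theorem localError_le_of_bound {m : ℕ} (hm : 2 ≤ m) (p : ℝ≥0∞) (T : Tri) {v : Plane → ℝ} {B : ℝ}
    (hv : ∀ z ∈ body T, |v z| ≤ B) :
    localError m p T v ≤ ENNReal.ofReal (stab m * B) * volume (body T) ^ p.toReal⁻¹ := by
  rw [localError_eq, mul_comm]
  have := eLpNorm_le_of_ae_bound (p := p) (μ := volume.restrict (body T)) (f := resid m T v)
    (C := stab m * B) ?_
  · simpa using this
  · exact (ae_restrict_mem (measurableSet_body T)).mono fun z hz => by
      rw [Real.norm_eq_abs]; exact abs_resid_le hm T hv hz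

/-- Comparison of local errors of functions which are close up to polynomials of low degree. -/
theorem localError_le_add {m : ℕ} (hm : 2 ≤ m) {p : ℝ≥0∞} (hp : 1 ≤ p) (T : Tri)
    {v w Q : Plane → ℝ} {B : ℝ} (hv : ContinuousOn v (body T)) (hw : ContinuousOn w (body T))
    (hQ : IsPoly (m - 1) Q) (hB : ∀ z ∈ body T, |v z - w z - Q z| ≤ B) :
    localError m p T v ≤
      localError m p T w + ENNReal.ofReal (stab m * B) * volume (body T) ^ p.toReal⁻¹ := by
  set g : Plane → ℝ := fun z => v z - w z - Q z with hg
  have hgc : ContinuousOn g (body T) := (hv.sub hw).sub hQ.continuous.continuousOn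
  have h1 : resid m T v = resid m T w + resid m T g := by
    funext z
    have h2 : v = fun x => (w x + g x) + Q x := by funext x; simp only [hg]; ring
    rw [h2, resid_add hm, resid_add hm, resid_isPoly hm T hQ, add_zero]
    rfl
  rw [localError_eq, h1]
  refine (eLpNorm_add_le ?_ ?_ hp).trans (add_le_add le_rfl (localError_le_of_bound hm p T hB))
  · exact (continuousOn_resid T hw).aestronglyMeasurable (measurableSet_body T)
  · exact (continuousOn_resid T hgc).aestronglyMeasurable (measurableSet_body T)

theorem localError_ne_top {m : ℕ} (hm : 2 ≤ m) (p : ℝ≥0∞) (T : Tri) {v : Plane → ℝ}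
    (hv : ContinuousOn v (body T)) : localError m p T v ≠ ∞ := by
  obtain ⟨B, hB⟩ := (isCompact_body T).exists_bound_of_continuousOn hv
  refine ne_top_of_le_ne_top ?_ (localError_le_of_bound hm p T hB)
  exact ENNReal.mul_ne_top ENNReal.ofReal_ne_top
    (ENNReal.rpow_ne_top_of_nonneg (by positivity) (volume_body_ne_top T))

/-! ### Homothetic triangles -/

/-- The map `x ↦ σ x + c`. -/
def hom (σ : ℝ) (c : Plane) (z : Plane) : Plane := σ • z + c

/-- The map `x ↦ σ x + c`, `σ ≠ 0`, as an affine equivalence. -/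
def homEquiv (σ : ℝ) (hσ : σ ≠ 0) (c : Plane) : Plane ≃ᵃ[ℝ] Plane :=
  (LinearEquiv.smulOfNeZero ℝ Plane σ hσ).toAffineEquiv.trans (AffineEquiv.constVAdd ℝ Plane c)

theorem homEquiv_apply (σ : ℝ) (hσ : σ ≠ 0) (c z : Plane) :
    homEquiv σ hσ c z = hom σ c z := by
  simp [homEquiv, hom, add_comm]

/-- The image of a triangle under `x ↦ σ x + c`. -/
def homTri (σ : ℝ) (hσ : σ ≠ 0) (c : Plane) (T : Tri) : Tri where
  points i := hom σ c (T.points i)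
  independent := by
    have := T.independent.map' (homEquiv σ hσ c).toAffineMap (homEquiv σ hσ c).injective
    refine cast ?_ this
    congr 1
    funext i
    exact homEquiv_apply σ hσ c _

theorem homTri_points (σ : ℝ) (hσ : σ ≠ 0) (c : Plane) (T : Tri) (i : Fin 3) :
    (homTri σ hσ c T).points i = hom σ c (T.points i) := rfl

theorem bco_homTri (σ : ℝ) (hσ : σ ≠ 0) (c : Plane) (T : Tri) (i : Fin 3) (z : Plane) :
    bco (homTri σ hσ c T) i (hom σ c z) = bco T i z := by
  have h : hom σ c z = ∑ j, bco T j z • (homTri σ hσ c T).points j := by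
    conv_lhs => rw [← sum_bco_smul T z]
    simp only [hom, homTri_points, smul_add, Finset.sum_add_distrib, ← Finset.sum_smul, sum_bco,
      one_smul, Finset.smul_sum]
    simp only [smul_comm σ]
  rw [h]
  exact bco_sum_smul _ _ (sum_bco T z) i

theorem hom_surjective (σ : ℝ) (hσ : σ ≠ 0) (c x : Plane) : ∃ z, hom σ c z = x :=
  ⟨σ⁻¹ • (x - c), by simp [hom, smul_smul, mul_inv_cancel₀ hσ]⟩

theorem body_homTri (σ : ℝ) (hσ : σ ≠ 0) (c : Plane) (T : Tri) :
    body (homTri σ hσ c T) = hom σ c '' body T := by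
  ext x
  obtain ⟨z, rfl⟩ := hom_surjective σ hσ c x
  have hinj : Function.Injective (hom σ c) := fun a b h => by
    simpa [hom, hσ] using h
  rw [hinj.mem_set_image, mem_body_iff, mem_body_iff]
  simp_rw [bco_homTri]

theorem node_homTri {n : ℕ} (hn : 1 ≤ n) (σ : ℝ) (hσ : σ ≠ 0) (c : Plane) (T : Tri)
    {w : Fin 3 → ℕ} (hw : ∑ i, w i = n) :
    node n (homTri σ hσ c T) w = hom σ c (node n T w) :=
  ext_bco (homTri σ hσ c T) fun i => by
    rw [bco_homTri, (node_mem_body hn _ hw).2, (node_mem_body hn _ hw).2]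

theorem resid_homTri {m : ℕ} (hm : 2 ≤ m) (σ : ℝ) (hσ : σ ≠ 0) (c : Plane) (T : Tri)
    (v : Plane → ℝ) (z : Plane) :
    resid m (homTri σ hσ c T) v (hom σ c z) = resid m T (fun x => v (hom σ c x)) z := by
  simp only [resid, eval_interp hm, bco_homTri]
  congr 1
  refine Finset.sum_congr rfl fun w hw => ?_
  rw [node_homTri (by omega) _ _ _ _ (mem_nodeIdx.1 hw)]

theorem measurableEmbedding_hom (σ : ℝ) (hσ : σ ≠ 0) (c : Plane) :
    MeasurableEmbedding (hom σ c) := by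
  have : hom σ c = (Homeomorph.smulOfNeZero σ hσ).trans (Homeomorph.addRight c) := by
    funext z; simp [hom]
  rw [this]
  exact Homeomorph.measurableEmbedding _

theorem map_hom_volume (σ : ℝ) (hσ : σ ≠ 0) (c : Plane) :
    (volume : Measure Plane) = ENNReal.ofReal (σ ^ 2) • (volume.map (hom σ c)) := by
  have h1 : hom σ c = (fun x => x + c) ∘ (fun x => σ • x) := rfl
  rw [h1, ← Measure.map_map (by fun_prop) (by fun_prop), Measure.map_addHaar_smul _ hσ,
    Measure.map_smul, map_add_right_eq_self, smul_smul, ← ENNReal.ofReal_mul (by positivity)]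
  have : σ ^ 2 * |(σ ^ Module.finrank ℝ Plane)⁻¹| = 1 := by
    simp [hσ]
  rw [this]
  simp

theorem volume_homTri (σ : ℝ) (hσ : σ ≠ 0) (c : Plane) (T : Tri) :
    volume (body (homTri σ hσ c T)) = ENNReal.ofReal (σ ^ 2) * volume (body T) := by
  have hinj : Function.Injective (hom σ c) := (measurableEmbedding_hom σ hσ c).injective
  rw [body_homTri]
  conv_lhs => rw [map_hom_volume σ hσ c]
  rw [Measure.smul_apply, (measurableEmbedding_hom σ hσ c).map_apply, hinj.preimage_image]
  rfl

theorem localError_homTri {m : ℕ} (hm : 2 ≤ m) (p : ℝ≥0∞) (σ : ℝ) (hσ : σ ≠ 0) (c : Plane)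
    (T : Tri) (v : Plane → ℝ) :
    localError m p (homTri σ hσ c T) v =
      ENNReal.ofReal (σ ^ 2) ^ p.toReal⁻¹ * localError m p T (fun x => v (hom σ c x)) := by
  have he := measurableEmbedding_hom σ hσ c
  have hinj : Function.Injective (hom σ c) := he.injective
  have h0 : ENNReal.ofReal (σ ^ 2) ≠ 0 := by
    simp only [ne_eq, ENNReal.ofReal_eq_zero, not_le]; positivity
  have h1 : volume.restrict (body (homTri σ hσ c T)) =
      ENNReal.ofReal (σ ^ 2) • (volume.restrict (body T)).map (hom σ c) := by
    conv_lhs => rw [map_hom_volume σ hσ c]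
    rw [Measure.restrict_smul, he.restrict_map, body_homTri, hinj.preimage_image]
  rw [localError_eq, localError_eq, h1, eLpNorm_smul_measure_of_ne_zero h0,
    he.eLpNorm_map_measure]
  simp only [one_div, ENNReal.toReal_inv, smul_eq_mul]
  congr 2
  funext z
  exact resid_homTri hm σ hσ c T v z

/-- Scaling of the interpolation error of a homogeneous polynomial. -/
theorem localError_homTri_evalAt {m : ℕ} (hm : 2 ≤ m) (p : ℝ≥0∞) (σ : ℝ) (hσ : σ ≠ 0) (c : Plane)
    (T : Tri) {P : MvPolynomial (Fin 2) ℝ} (hP : P.IsHomogeneous m) :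
    localError m p (homTri σ hσ c T) (evalAt P) =
      ENNReal.ofReal (σ ^ 2) ^ ((m : ℝ) / 2 + p.toReal⁻¹) * localError m p T (evalAt P) := by
  have hs : 0 < σ ^ 2 := by positivity
  have h1 : localError m p T (fun x => evalAt P (hom σ c x)) =
      ENNReal.ofReal (σ ^ 2) ^ ((m : ℝ) / 2) * localError m p T (evalAt P) := by
    rw [localError_eq, localError_eq]
    have : resid m T (fun x => evalAt P (hom σ c x)) = (σ ^ m) • resid m T (evalAt P) := by
      funext z
      -- The pulled-back form is `σ ^ m` times the form plus a polynomial of degree below `m`, whose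
      -- residual is zero.
      have h2 : (fun x => evalAt P (hom σ c x)) = fun x =>
          σ ^ m * evalAt P x + (evalAt P (σ • x + c) - evalAt P (σ • x)) := by
        funext x
        rw [evalAt_smul hP, hom]
        ring
      have h3 : IsPoly (m - 1) (fun x => evalAt P (σ • x + c) - evalAt P (σ • x)) := by
        simpa using (isPoly_translate_sub (by omega : 1 ≤ m) hP c).comp_hom σ 0
      rw [h2, resid_add hm, resid_isPoly hm T h3, resid_const_mul hm, add_zero]
      rfl
    rw [this, eLpNorm_const_smul]
    congr 1
    rw [ENNReal.ofReal_rpow_of_pos hs, ← ofReal_norm, norm_pow, Real.norm_eq_abs]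
    congr 1
    rw [← sq_abs, ← Real.rpow_natCast, ← Real.rpow_natCast, ← Real.rpow_mul (abs_nonneg _)]
    congr 1
    push_cast
    ring
  rw [localError_homTri hm, h1, ← mul_assoc, ENNReal.rpow_add _ _ _ ENNReal.ofReal_ne_top,
    mul_comm (ENNReal.ofReal (σ ^ 2) ^ p.toReal⁻¹)]
  simp only [ne_eq, ENNReal.ofReal_eq_zero, not_le]
  exact hs

/-- A homothety brings `T` to unit area, where it competes in the infimum; the error scales with the
area to the power `m / 2 + 1 / p`. -/
theorem shapeFun_mul_le {m : ℕ} (hm : 2 ≤ m) (p : ℝ≥0∞) (T : Tri) {P : MvPolynomial (Fin 2) ℝ}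
    (hP : P.IsHomogeneous m) :
    shapeFun m p P * volume (body T) ^ ((m : ℝ) / 2 + p.toReal⁻¹) ≤
      localError m p T (evalAt P) := by
  set a := (volume (body T)).toReal with ha
  have ha0 : 0 < a := ENNReal.toReal_pos (volume_body_pos T).ne' (volume_body_ne_top T)
  have haE : volume (body T) = ENNReal.ofReal a := (ENNReal.ofReal_toReal (volume_body_ne_top T)).symm
  have hs : (√a)⁻¹ ≠ 0 := by positivity
  have hsq : (√a)⁻¹ ^ 2 = a⁻¹ := by rw [inv_pow, Real.sq_sqrt ha0.le]
  have h1 : volume (body (homTri _ hs 0 T)) = 1 := by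
    rw [volume_homTri, hsq, haE, ← ENNReal.ofReal_mul (by positivity), inv_mul_cancel₀ ha0.ne',
      ENNReal.ofReal_one]
  have h2 : shapeFun m p P ≤ localError m p (homTri _ hs 0 T) (evalAt P) := iInf₂_le (homTri _ hs 0 T) h1
  rw [localError_homTri_evalAt hm _ _ _ _ _ hP, hsq] at h2
  calc shapeFun m p P * volume (body T) ^ ((m : ℝ) / 2 + p.toReal⁻¹)
      ≤ _ := mul_le_mul_left h2 _
    _ = localError m p T (evalAt P) := by
      rw [haE, mul_comm, ← mul_assoc, ← ENNReal.mul_rpow_of_nonneg _ _ (by positivity),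
        ← ENNReal.ofReal_mul ha0.le, mul_inv_cancel₀ ha0.ne']
      simp

/-! ### Symmetry of higher derivatives -/

section DirectionalDerivatives

variable {E : Type*} [NormedAddCommGroup E] [NormedSpace ℝ E]

/-- Iterated directional derivatives of `f` within `s` along a list of directions. -/
def dirD (f : E → ℝ) (s : Set E) : List E → E → ℝ
  | [] => f
  | v :: l => fun x => fderivWithin ℝ (dirD f s l) s x v

theorem contDiffOn_dirD {f : E → ℝ} {s : Set E} {n : ℕ} (hf : ContDiffOn ℝ n f s)
    (hs : UniqueDiffOn ℝ s) (l : List E) :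
    ∀ k : ℕ, k + l.length ≤ n → ContDiffOn ℝ k (dirD f s l) s := by
  induction l with
  | nil =>
    intro k hk
    exact hf.of_le (by exact_mod_cast hk)
  | cons v l ih =>
    intro k hk
    have h1 := ih (k + 1) (by simp at hk; omega)
    have h2 : ContDiffOn ℝ k (fderivWithin ℝ (dirD f s l) s) s :=
      h1.fderivWithin hs (by norm_cast)
    exact h2.clm_apply contDiffOn_const

theorem iteratedFDerivWithin_eq_dirD {f : E → ℝ} {s : Set E} {n : ℕ} (hf : ContDiffOn ℝ n f s)
    (hs : UniqueDiffOn ℝ s) (k : ℕ) (hk : k ≤ n) (v : Fin k → E) {x : E} (hx : x ∈ s) :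
    iteratedFDerivWithin ℝ k f s x v = dirD f s (List.ofFn v) x := by
  induction k generalizing x with
  | zero => simp [dirD]
  | succ k ih =>
    rw [iteratedFDerivWithin_succ_apply_left, List.ofFn_succ, dirD]
    have hd : DifferentiableOn ℝ (iteratedFDerivWithin ℝ k f s) s :=
      hf.differentiableOn_iteratedFDerivWithin (by exact_mod_cast hk) hs
    rw [← fderivWithin_continuousMultilinear_apply_const_apply (hs x hx) (hd x hx)]
    rw [fderivWithin_congr' (fun y hy => ih (by omega) (Fin.tail v) hy) hx]
    rfl

/-- List permutations are generated by swaps of two head entries below a common prefix, and such a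
swap is the symmetry of a second derivative within `s`. At boundary points that symmetry requires
`s` to lie in the closure of its interior. -/
theorem dirD_perm {f : E → ℝ} {s : Set E} {n : ℕ} (hf : ContDiffOn ℝ n f s)
    (hs : UniqueDiffOn ℝ s) (hcl : s ⊆ closure (interior s)) {l l' : List E} (h : l.Perm l') :
    l.length ≤ n → ∀ x ∈ s, dirD f s l x = dirD f s l' x := by
  induction h with
  | nil => exact fun _ _ _ => rfl
  | cons v _ ih =>
    intro hl x hx
    simp only [List.length_cons] at hl
    simp only [dirD]
    rw [fderivWithin_congr' (fun y hy => ih (by omega) y hy) hx]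
  | swap v w l =>
    intro hl x hx
    simp only [List.length_cons] at hl
    have hc : ContDiffOn ℝ (2 : ℕ) (dirD f s l) s := contDiffOn_dirD hf hs l 2 (by omega)
    have hsym := (hc x hx).isSymmSndFDerivWithinAt (by simp) hs (hcl hx) hx
    have hd : DifferentiableWithinAt ℝ (fderivWithin ℝ (dirD f s l) s) s x :=
      ((hc.fderivWithin hs (m := 1) (by norm_cast)).differentiableOn (by simp)) x hx
    have key : ∀ v w : E, fderivWithin ℝ (fun y => fderivWithin ℝ (dirD f s l) s y v) s x w =
        fderivWithin ℝ (fderivWithin ℝ (dirD f s l) s) s x w v := by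
      intro v w
      rw [fderivWithin_clm_apply (hs x hx) hd (differentiableWithinAt_const v)]
      simp
    simp only [dirD]
    rw [key, key]
    exact hsym.eq _ _
  | trans h1 _ ih1 ih2 =>
    intro hl x hx
    rw [ih1 hl x hx, ih2 (h1.length_eq ▸ hl) x hx]

theorem iteratedFDerivWithin_comp_perm {f : E → ℝ} {s : Set E} {n : ℕ}
    (hf : ContDiffOn ℝ n f s) (hs : UniqueDiffOn ℝ s) (hcl : s ⊆ closure (interior s)) {x : E}
    (hx : x ∈ s) (v : Fin n → E) (σ : Equiv.Perm (Fin n)) :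
    iteratedFDerivWithin ℝ n f s x (v ∘ σ) = iteratedFDerivWithin ℝ n f s x v := by
  rw [iteratedFDerivWithin_eq_dirD hf hs n le_rfl _ hx,
    iteratedFDerivWithin_eq_dirD hf hs n le_rfl _ hx]
  exact dirD_perm hf hs hcl (Equiv.Perm.ofFn_comp_perm σ v) (by simp) x hx

end DirectionalDerivatives

/-! ### Taylor expansion -/

/-- The binomial expansion of a symmetric form on the diagonal. -/
theorem symmetric_apply_diag {m : ℕ} (M : ContinuousMultilinearMap ℝ (fun _ : Fin m => Plane) ℝ)
    (hM : ∀ (v : Fin m → Plane) (σ : Equiv.Perm (Fin m)), M (v ∘ σ) = M v) (h : Plane) :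
    M (fun _ => h) = ∑ k ∈ Finset.range (m + 1), (m.choose k : ℝ) *
      (h 0 ^ k * h 1 ^ (m - k) * M (fun i : Fin m =>
        EuclideanSpace.single (if (i : ℕ) < k then (0 : Fin 2) else 1) 1)) := by
  classical
  set e : Fin 2 → Plane := fun j => EuclideanSpace.single j 1 with he
  have h1 : (fun _ : Fin m => h) = (fun _ => h 0 • e 0) + (fun _ => h 1 • e 1) := by
    funext i
    conv_lhs => rw [plane_eq_sum h]
    simp [he]
  have h2 : ∀ s : Finset (Fin m), M (s.piecewise (fun _ => h 0 • e 0) (fun _ => h 1 • e 1)) =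
      h 0 ^ s.card * h 1 ^ (m - s.card) *
        M (fun i : Fin m => e (if (i : ℕ) < s.card then (0 : Fin 2) else 1)) := by
    intro s
    have h3 : s.piecewise (fun _ => h 0 • e 0) (fun _ => h 1 • e 1) =
        fun i => (if i ∈ s then h 0 else h 1) • e (if i ∈ s then 0 else 1) := by
      funext i
      by_cases hi : i ∈ s <;> simp [hi]
    have hsm : s.card ≤ m := by simpa using s.card_le_univ
    have hcard : Fintype.card {i : Fin m // i ∈ s} =
        Fintype.card {i : Fin m // (i : ℕ) < s.card} := by
      rw [Fintype.card_coe, Fintype.card_subtype, Fin.card_filter_val_lt, min_eq_right hsm]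
    let eq := Fintype.equivOfCardEq hcard
    -- A permutation carrying `s` onto the first `s.card` indices puts the directions in the order
    -- of the statement; symmetry of `M` makes it harmless.
    have h4 : (fun i : Fin m => e (if i ∈ s then (0 : Fin 2) else 1)) =
        (fun i : Fin m => e (if (i : ℕ) < s.card then (0 : Fin 2) else 1)) ∘ eq.extendSubtype := by
      funext i
      by_cases hi : i ∈ s
      · have := eq.extendSubtype_mem i hi
        simp [hi, this]
      · have := eq.extendSubtype_not_mem i hi
        simp [hi, this]
    rw [h3, M.map_smul_univ, h4, hM, Finset.prod_ite]
    simp only [Finset.prod_const, smul_eq_mul]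
    rw [Finset.filter_mem_eq_inter, Finset.univ_inter, ← Finset.compl_filter,
      Finset.card_compl, Finset.filter_mem_eq_inter, Finset.univ_inter, Fintype.card_fin]
  rw [h1, M.map_add_univ]
  simp_rw [h2]
  have := Finset.sum_powerset_apply_card (x := (Finset.univ : Finset (Fin m)))
    (fun k => h 0 ^ k * h 1 ^ (m - k) *
      M (fun i : Fin m => e (if (i : ℕ) < k then (0 : Fin 2) else 1)))
  rw [Finset.powerset_univ, Finset.card_univ, Fintype.card_fin] at this
  rw [this]
  simp [nsmul_eq_mul, he]

theorem isHomogeneous_derivForm (m : ℕ) (f : Plane → ℝ) (Ω : Set Plane) (z : Plane) :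
    (derivForm m f Ω z).IsHomogeneous m := by
  refine MvPolynomial.IsHomogeneous.sum _ _ _ fun k hk => ?_
  have hk' : 0 + 1 * k + 1 * (m - k) = m := by
    have := Finset.mem_range.1 hk
    omega
  have := ((MvPolynomial.isHomogeneous_C (Fin 2) (iteratedFDerivWithin ℝ m f Ω z
    (fun i : Fin m => EuclideanSpace.single (if (i : ℕ) < k then (0 : Fin 2) else 1) 1) /
          ((Nat.factorial k : ℝ) * (Nat.factorial (m - k) : ℝ)))).mul
    ((MvPolynomial.isHomogeneous_X ℝ (0 : Fin 2)).pow k)).mul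
      ((MvPolynomial.isHomogeneous_X ℝ (1 : Fin 2)).pow (m - k))
  rwa [hk'] at this

/-- Each mixed derivative enters `derivForm` in one fixed order of the directions, so comparison
with the diagonal of the `m`-th derivative rests on symmetry; the binomial coefficients then match
`1 / (k! (m - k)!)` up to `m!`. -/
theorem evalAt_derivForm {m : ℕ} {f : Plane → ℝ} {Ω : Set Plane} (hf : ContDiffOn ℝ m f Ω)
    (hs : UniqueDiffOn ℝ Ω) (hcl : Ω ⊆ closure (interior Ω)) {z : Plane} (hz : z ∈ Ω)
    (h : Plane) :
    evalAt (derivForm m f Ω z) h =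
      iteratedFDerivWithin ℝ m f Ω z (fun _ => h) / (Nat.factorial m : ℝ) := by
  rw [symmetric_apply_diag _ (fun v σ => iteratedFDerivWithin_comp_perm hf hs hcl hz v σ),
    evalAt, derivForm, map_sum, Finset.sum_div]
  refine Finset.sum_congr rfl fun k hk => ?_
  have hk' : k ≤ m := by
    have := Finset.mem_range.1 hk
    omega
  simp only [map_mul, MvPolynomial.eval_C, map_pow, MvPolynomial.eval_X]
  rw [Nat.cast_choose ℝ hk']
  have h1 : (m.factorial : ℝ) ≠ 0 := by positivity
  field_simp

theorem isPoly_multilinear {k : ℕ} (M : ContinuousMultilinearMap ℝ (fun _ : Fin k => Plane) ℝ)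
    (x₀ : Plane) : IsPoly k (fun x => M (fun _ => x - x₀)) := by
  classical
  have h : ∀ x, M (fun _ => x - x₀) = ∑ r : Fin k → Fin 2,
      M (fun i => EuclideanSpace.single (r i) 1) * ∏ i, (x - x₀) (r i) := by
    intro x
    have h1 : (fun _ : Fin k => x - x₀) = fun _ => ∑ j : Fin 2,
        (x - x₀) j • (EuclideanSpace.single j (1 : ℝ) : Plane) := by
      funext i; exact plane_eq_sum _
    rw [h1, M.map_sum]
    refine Finset.sum_congr rfl fun r _ => ?_
    rw [M.map_smul_univ, smul_eq_mul, mul_comm]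
  rw [funext h]
  refine IsPoly.sum fun r _ => IsPoly.const_mul _ ?_
  have := IsPoly.prod (s := (Finset.univ : Finset (Fin k))) (n := fun _ => 1)
    (g := fun i x => (x - x₀) (r i)) fun i _ => by
      simpa using (isPoly_coord (r i)).sub (isPoly_const 1 (x₀ (r i)))
  simpa using this

/-- Induction on `m`: the derivative of the remainder for `ψ` is the remainder for the shifted
sequence, and the mean value inequality on the unit interval carries the bound over. The possible
gain of a factor `1 / m!` is not tracked. -/
theorem taylor_seq_bound {m : ℕ} (ψ : ℕ → ℝ → ℝ) (A w : ℝ)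
    (hψ : ∀ k < m, ∀ t ∈ Set.Icc (0 : ℝ) 1,
      HasDerivWithinAt (ψ k) (ψ (k + 1) t) (Set.Icc 0 1) t)
    (hA : ∀ t ∈ Set.Icc (0 : ℝ) 1, |ψ m t - A| ≤ w) :
    ∀ t ∈ Set.Icc (0 : ℝ) 1, |ψ 0 t - ∑ k ∈ Finset.range m, ψ k 0 * (t ^ k / k.factorial) -
      A * (t ^ m / m.factorial)| ≤ w := by
  induction m generalizing ψ with
  | zero => simpa using hA
  | succ m ih =>
    intro t ht
    have h1 := ih (fun k => ψ (k + 1)) (fun k hk => hψ (k + 1) (by omega)) hA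
    have hpow : ∀ (k : ℕ) (s : ℝ), HasDerivAt (fun s : ℝ => s ^ (k + 1) / (k + 1).factorial)
        (s ^ k / k.factorial) s := by
      intro k s
      have := (hasDerivAt_pow (k + 1) s).div_const ((k + 1).factorial : ℝ)
      refine this.congr_deriv ?_
      rw [Nat.factorial_succ]
      have h2 : (k.factorial : ℝ) ≠ 0 := by positivity
      push_cast
      field_simp
    set g : ℝ → ℝ := fun t => ψ 0 t - ∑ k ∈ Finset.range m, ψ (k + 1) 0 *
      (t ^ (k + 1) / (k + 1).factorial) - A * (t ^ (m + 1) / (m + 1).factorial) with hg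
    have hgd : ∀ s ∈ Set.Icc (0 : ℝ) 1, HasDerivWithinAt g (ψ 1 s -
        ∑ k ∈ Finset.range m, ψ (k + 1) 0 * (s ^ k / k.factorial) - A * (s ^ m / m.factorial))
        (Set.Icc 0 1) s := by
      intro s hs
      refine ((hψ 0 (by omega) s hs).sub ?_).sub ((hpow m s).hasDerivWithinAt.const_mul A)
      exact HasDerivWithinAt.fun_sum fun k _ => (hpow k s).hasDerivWithinAt.const_mul _
    have hb := (convex_Icc (0 : ℝ) 1).norm_image_sub_le_of_norm_hasDerivWithin_le hgd
      (fun s hs => by rw [Real.norm_eq_abs]; exact h1 s hs) (Set.left_mem_Icc.2 zero_le_one) ht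
    have hw : 0 ≤ w := (abs_nonneg _).trans (hA t ht)
    have hg0 : g 0 = ψ 0 0 := by simp [hg]
    rw [hg0, Real.norm_eq_abs, Real.norm_eq_abs] at hb
    have ht1 : |t - 0| ≤ 1 := by rw [sub_zero, abs_of_nonneg ht.1]; exact ht.2
    rw [Finset.sum_range_succ']
    have : ψ 0 t - (∑ k ∈ Finset.range m, ψ (k + 1) 0 * (t ^ (k + 1) / (k + 1).factorial) +
        ψ 0 0 * (t ^ 0 / (0).factorial)) - A * (t ^ (m + 1) / (m + 1).factorial) = g t - ψ 0 0 := by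
      simp [hg]
      ring
    rw [this]
    exact hb.trans (mul_le_of_le_one_right hw ht1)

/-- Taylor's formula on a triangle, with the top order term frozen at a point `z`. -/
theorem exists_taylor_triangle {m : ℕ} (hm : 1 ≤ m) {f : Plane → ℝ} {Ω : Set Plane}
    (hf : ContDiffOn ℝ m f Ω) (hs : UniqueDiffOn ℝ Ω) {T : Tri} (hT : body T ⊆ Ω)
    (M : ContinuousMultilinearMap ℝ (fun _ : Fin m => Plane) ℝ) {w : ℝ}
    (hw : ∀ y ∈ body T, ‖iteratedFDerivWithin ℝ m f Ω y - M‖ ≤ w) :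
    ∃ Q x₀, IsPoly (m - 1) Q ∧ ∀ x ∈ body T,
      |f x - M (fun _ => x - x₀) / m.factorial - Q x| ≤ w * Metric.diam (body T) ^ m := by
  set x₀ := T.points 0 with hx₀
  have hx₀T : x₀ ∈ body T := points_mem_body T 0
  have hser := (hf.ftaylorSeriesWithin hs).mono hT
  refine ⟨fun x => ∑ k ∈ Finset.range m, (1 / k.factorial : ℝ) *
    iteratedFDerivWithin ℝ k f Ω x₀ (fun _ => x - x₀), x₀, ?_, ?_⟩
  · refine IsPoly.sum fun k hk => IsPoly.const_mul _ ((isPoly_multilinear _ x₀).mono ?_)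
    have := Finset.mem_range.1 hk
    omega
  intro x hx
  set d := x - x₀ with hd
  have hw0 : 0 ≤ w := (norm_nonneg _).trans (hw x hx)
  have hpath : ∀ t ∈ Set.Icc (0 : ℝ) 1, x₀ + t • d ∈ body T := by
    intro t ht
    exact (convex_body T).add_smul_sub_mem hx₀T hx ht
  have hpd : ∀ t, HasDerivAt (fun t : ℝ => x₀ + t • d) d t := by
    intro t
    simpa using ((hasDerivAt_id t).smul_const d).const_add x₀
  have hnd : ‖d‖ ≤ Metric.diam (body T) := by
    rw [hd, ← dist_eq_norm]; exact dist_le_diam hx hx₀T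
  -- One-dimensional Taylor expansion along the segment from the vertex `x₀` to `x`; it stays in the
  -- triangle, so only the deviation from `M` there matters.
  have hmain := taylor_seq_bound (m := m)
    (fun k t => iteratedFDerivWithin ℝ k f Ω (x₀ + t • d) (fun _ => d)) (M fun _ => d)
    (w * Metric.diam (body T) ^ m) ?_ ?_ 1 (Set.right_mem_Icc.2 zero_le_one)
  · simp only [one_smul, zero_smul, add_zero, one_pow] at hmain
    have h1 : x₀ + d = x := by rw [hd]; abel
    rw [h1] at hmain
    have h2 : iteratedFDerivWithin ℝ 0 f Ω x (fun _ => d) = f x := rfl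
    rw [h2] at hmain
    convert hmain using 2
    rw [sub_right_comm]
    congr 2
    · exact Finset.sum_congr rfl fun k _ => mul_comm _ _
    · ring
  · intro k hk t ht
    have h1 := hser.fderivWithin k (by exact_mod_cast hk) _ (hpath t ht)
    have h2 := h1.comp_hasDerivWithinAt t (hpd t).hasDerivWithinAt hpath
    have h3 := (ContinuousMultilinearMap.apply ℝ (fun _ : Fin k => Plane) ℝ
      (fun _ => d)).hasFDerivAt.comp_hasDerivWithinAt t h2
    refine h3.congr_deriv ?_
    simp only [ContinuousMultilinearMap.apply_apply, ContinuousMultilinearMap.curryLeft_apply]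
    congr 1
    funext i
    refine Fin.cases ?_ (fun j => ?_) i <;> simp
  · intro t ht
    have h1 := (iteratedFDerivWithin ℝ m f Ω (x₀ + t • d) - M).le_opNorm (fun _ => d)
    rw [Finset.prod_const, Finset.card_univ, Fintype.card_fin, Real.norm_eq_abs] at h1
    refine h1.trans ?_
    exact mul_le_mul (hw _ (hpath t ht)) (pow_le_pow_left₀ (norm_nonneg _) hnd m)
      (by positivity) hw0

/-- The frozen form first appears centred at a vertex. Recentring it at the origin costs a
polynomial of degree below `m`, which joins `Q`, and the form no longer depends on the triangle. -/
theorem exists_taylor_derivForm {m : ℕ} (hm : 1 ≤ m) {f : Plane → ℝ} {Ω : Set Plane}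
    (hf : ContDiffOn ℝ m f Ω) (hs : UniqueDiffOn ℝ Ω) (hcl : Ω ⊆ closure (interior Ω)) {T : Tri}
    (hT : body T ⊆ Ω) {z : Plane} (hz : z ∈ Ω) {w : ℝ}
    (hw : ∀ y ∈ body T, ‖iteratedFDerivWithin ℝ m f Ω y - iteratedFDerivWithin ℝ m f Ω z‖ ≤ w) :
    ∃ Q, IsPoly (m - 1) Q ∧ ∀ x ∈ body T,
      |f x - evalAt (derivForm m f Ω z) x - Q x| ≤ w * Metric.diam (body T) ^ m := by
  obtain ⟨Q, x₀, hQ, h⟩ := exists_taylor_triangle hm hf hs hT _ hw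
  refine ⟨fun x => Q x + (evalAt (derivForm m f Ω z) (x + -x₀) - evalAt (derivForm m f Ω z) x),
    hQ.add (isPoly_translate_sub hm (isHomogeneous_derivForm m f Ω z) _), fun x hx => ?_⟩
  have := h x hx
  rw [← evalAt_derivForm hf hs hcl hz] at this
  beta_reduce
  rw [← sub_eq_add_neg]
  convert this using 2
  ring

theorem abs_evalAt_derivForm_sub_le {m : ℕ} {f : Plane → ℝ} {Ω : Set Plane}
    (hf : ContDiffOn ℝ m f Ω) (hs : UniqueDiffOn ℝ Ω) (hcl : Ω ⊆ closure (interior Ω))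
    {z z' : Plane} (hz : z ∈ Ω) (hz' : z' ∈ Ω) {w : ℝ}
    (hw : ‖iteratedFDerivWithin ℝ m f Ω z - iteratedFDerivWithin ℝ m f Ω z'‖ ≤ w) (h : Plane) :
    |evalAt (derivForm m f Ω z) h - evalAt (derivForm m f Ω z') h| ≤ w * ‖h‖ ^ m := by
  rw [evalAt_derivForm hf hs hcl hz, evalAt_derivForm hf hs hcl hz', ← sub_div, abs_div]
  have h1 := (iteratedFDerivWithin ℝ m f Ω z - iteratedFDerivWithin ℝ m f Ω z').le_opNorm
    (fun _ => h)
  rw [Finset.prod_const, Finset.card_univ, Fintype.card_fin, Real.norm_eq_abs] at h1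
  have h2 : (1 : ℝ) ≤ |(m.factorial : ℝ)| := by
    rw [Nat.abs_cast]; exact_mod_cast Nat.factorial_pos m
  refine (div_le_self (abs_nonneg _) h2).trans (h1.trans ?_)
  gcongr

/-! ### Consequences for local errors -/

/-- By Taylor's formula `f` and its frozen form differ by a polynomial that interpolation reproduces
and a remainder to which stability applies. Together with the converse below, this allows `f` and
the form to be exchanged. -/
theorem localError_le_localError_derivForm {m : ℕ} (hm : 2 ≤ m) {p : ℝ≥0∞} (hp : 1 ≤ p)
    {f : Plane → ℝ} {Ω : Set Plane}
    (hf : ContDiffOn ℝ m f Ω) (hs : UniqueDiffOn ℝ Ω) (hcl : Ω ⊆ closure (interior Ω)) {T : Tri}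
    (hT : body T ⊆ Ω) {z : Plane} (hz : z ∈ Ω) {w : ℝ}
    (hw : ∀ y ∈ body T, ‖iteratedFDerivWithin ℝ m f Ω y - iteratedFDerivWithin ℝ m f Ω z‖ ≤ w) :
    localError m p T f ≤ localError m p T (evalAt (derivForm m f Ω z)) +
      ENNReal.ofReal (stab m * (w * Metric.diam (body T) ^ m)) * volume (body T) ^ p.toReal⁻¹ := by
  obtain ⟨Q, hQ, h⟩ := exists_taylor_derivForm (by omega) hf hs hcl hT hz hw
  exact localError_le_add hm hp T (hf.continuousOn.mono hT) (continuous_evalAt _).continuousOn hQ h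

theorem localError_derivForm_le_localError {m : ℕ} (hm : 2 ≤ m) {p : ℝ≥0∞} (hp : 1 ≤ p)
    {f : Plane → ℝ} {Ω : Set Plane}
    (hf : ContDiffOn ℝ m f Ω) (hs : UniqueDiffOn ℝ Ω) (hcl : Ω ⊆ closure (interior Ω)) {T : Tri}
    (hT : body T ⊆ Ω) {z : Plane} (hz : z ∈ Ω) {w : ℝ}
    (hw : ∀ y ∈ body T, ‖iteratedFDerivWithin ℝ m f Ω y - iteratedFDerivWithin ℝ m f Ω z‖ ≤ w) :
    localError m p T (evalAt (derivForm m f Ω z)) ≤ localError m p T f +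
      ENNReal.ofReal (stab m * (w * Metric.diam (body T) ^ m)) * volume (body T) ^ p.toReal⁻¹ := by
  obtain ⟨Q, hQ, h⟩ := exists_taylor_derivForm (by omega) hf hs hcl hT hz hw
  refine localError_le_add hm hp T (continuous_evalAt _).continuousOn (hf.continuousOn.mono hT)
    (Q := fun x => -1 * Q x) (hQ.const_mul _) fun x hx => ?_
  rw [← abs_neg]
  convert h x hx using 2
  ring

/-- Taylor's formula with the zero form as frozen form. This crude bound serves for the triangles of
the mesh that do not have the optimal shape. -/
theorem localError_le_of_derivative_bound {m : ℕ} (hm : 2 ≤ m) {p : ℝ≥0∞}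
    (hp : 1 ≤ p) {f : Plane → ℝ} {Ω : Set Plane} (hf : ContDiffOn ℝ m f Ω)
    (hs : UniqueDiffOn ℝ Ω) {T : Tri} (hT : body T ⊆ Ω) {w : ℝ}
    (hw : ∀ y ∈ Ω, ‖iteratedFDerivWithin ℝ m f Ω y‖ ≤ w) :
    localError m p T f ≤
      ENNReal.ofReal (stab m * (w * Metric.diam (body T) ^ m)) * volume (body T) ^ p.toReal⁻¹ := by
  obtain ⟨Q, x₀, hQ, h⟩ := exists_taylor_triangle (by omega) hf hs hT 0 (w := w)
    fun y hy => by simpa using hw y (hT hy)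
  have h0 : localError m p T (fun _ => 0) = 0 := by
    have : resid m T (fun _ => 0) = 0 := funext fun z => resid_isPoly hm T (isPoly_const _ 0) z
    rw [localError_eq, this, eLpNorm_zero]
  have := localError_le_add hm hp T (hf.continuousOn.mono hT) (w := fun _ => 0)
    continuousOn_const hQ (B := w * Metric.diam (body T) ^ m) fun x hx => by simpa using h x hx
  rwa [h0, zero_add] at this

/-- Here `T` is a reference triangle lying anywhere in the plane. Both forms are recentred at one of
its vertices, which interpolation does not see, so that `‖x + c‖` is at most the diameter. -/
theorem localError_derivForm_le_derivForm {m : ℕ} (hm : 2 ≤ m) {p : ℝ≥0∞} (hp : 1 ≤ p)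
    {f : Plane → ℝ} {Ω : Set Plane}
    (hf : ContDiffOn ℝ m f Ω) (hs : UniqueDiffOn ℝ Ω) (hcl : Ω ⊆ closure (interior Ω)) (T : Tri)
    {z z' : Plane} (hz : z ∈ Ω) (hz' : z' ∈ Ω) {w : ℝ}
    (hw : ‖iteratedFDerivWithin ℝ m f Ω z - iteratedFDerivWithin ℝ m f Ω z'‖ ≤ w) :
    localError m p T (evalAt (derivForm m f Ω z)) ≤
      localError m p T (evalAt (derivForm m f Ω z')) +
      ENNReal.ofReal (stab m * (w * Metric.diam (body T) ^ m)) * volume (body T) ^ p.toReal⁻¹ := by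
  have hw0 : 0 ≤ w := (norm_nonneg _).trans hw
  set c : Plane := -T.points 0
  refine localError_le_add hm hp T (continuous_evalAt _).continuousOn
    (continuous_evalAt _).continuousOn
    (Q := fun x => (evalAt (derivForm m f Ω z') (x + c) - evalAt (derivForm m f Ω z') x) -
      (evalAt (derivForm m f Ω z) (x + c) - evalAt (derivForm m f Ω z) x))
    ((isPoly_translate_sub (by omega) (isHomogeneous_derivForm m f Ω z') _).sub
      (isPoly_translate_sub (by omega) (isHomogeneous_derivForm m f Ω z) _)) fun x hx => ?_
  have h1 := abs_evalAt_derivForm_sub_le hf hs hcl hz hz' hw (x + c)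
  have h2 : ‖x + c‖ ≤ Metric.diam (body T) := by
    rw [← sub_eq_add_neg, ← dist_eq_norm]; exact dist_le_diam hx (points_mem_body T 0)
  calc _ = |evalAt (derivForm m f Ω z) (x + c) - evalAt (derivForm m f Ω z') (x + c)| := by
        congr 1; ring
    _ ≤ w * ‖x + c‖ ^ m := h1
    _ ≤ w * Metric.diam (body T) ^ m := by gcongr

/-! ### Polygonal domains -/

theorem IsPolygonalDomain.isCompact {Ω : Set Plane} (h : IsPolygonalDomain Ω) : IsCompact Ω := by
  obtain ⟨P, -, rfl⟩ := h
  exact P.isCompact_biUnion fun T _ => isCompact_body T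

theorem IsPolygonalDomain.exists_body {Ω : Set Plane} (h : IsPolygonalDomain Ω) {z : Plane}
    (hz : z ∈ Ω) : ∃ T, z ∈ body T ∧ body T ⊆ Ω := by
  obtain ⟨P, -, rfl⟩ := h
  simp only [Set.mem_iUnion, exists_prop] at hz
  obtain ⟨T, hT, hzT⟩ := hz
  exact ⟨T, hzT, Set.subset_biUnion_of_mem (u := fun T => body T) hT⟩

theorem IsPolygonalDomain.nonempty {Ω : Set Plane} (h : IsPolygonalDomain Ω) : Ω.Nonempty := by
  obtain ⟨P, ⟨T, hT⟩, rfl⟩ := h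
  exact ⟨T.points 0, Set.mem_biUnion hT (points_mem_body T 0)⟩

theorem IsPolygonalDomain.uniqueDiffOn {Ω : Set Plane} (h : IsPolygonalDomain Ω) :
    UniqueDiffOn ℝ Ω := by
  intro z hz
  obtain ⟨T, hzT, hT⟩ := h.exists_body hz
  exact (uniqueDiffOn_convex (convex_body T) (nonempty_interior_body T) z hzT).mono hT

theorem IsPolygonalDomain.subset_closure_interior {Ω : Set Plane} (h : IsPolygonalDomain Ω) :
    Ω ⊆ closure (interior Ω) := by
  intro z hz
  obtain ⟨T, hzT, hT⟩ := h.exists_body hz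
  rw [← closure_interior_body] at hzT
  exact closure_mono (interior_mono hT) hzT

theorem continuousOn_iteratedFDerivWithin_top {m : ℕ} {f : Plane → ℝ} {Ω : Set Plane}
    (h : IsPolygonalDomain Ω) (hf : ContDiffOn ℝ m f Ω) :
    ContinuousOn (iteratedFDerivWithin ℝ m f Ω) Ω :=
  hf.continuousOn_iteratedFDerivWithin le_rfl h.uniqueDiffOn

theorem exists_modulus {m : ℕ} {f : Plane → ℝ} {Ω : Set Plane} (h : IsPolygonalDomain Ω)
    (hf : ContDiffOn ℝ m f Ω) {η : ℝ} (hη : 0 < η) :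
    ∃ δ > 0, ∀ y ∈ Ω, ∀ z ∈ Ω, dist y z < δ →
      ‖iteratedFDerivWithin ℝ m f Ω y - iteratedFDerivWithin ℝ m f Ω z‖ ≤ η := by
  have hu := h.isCompact.uniformContinuousOn_of_continuous
    (continuousOn_iteratedFDerivWithin_top h hf)
  obtain ⟨δ, hδ, H⟩ := Metric.uniformContinuousOn_iff.1 hu η hη
  exact ⟨δ, hδ, fun y hy z hz hyz => by
    rw [← dist_eq_norm]; exact (H y hy z hz hyz).le⟩

theorem volume_body_le (T : Tri) {d : ℝ} (hd : Metric.diam (body T) ≤ d) :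
    volume (body T) ≤ ENNReal.ofReal (d ^ 2) * volume (Metric.ball (0 : Plane) 1) := by
  have hd0 : 0 ≤ d := Metric.diam_nonneg.trans hd
  have h1 : body T ⊆ Metric.closedBall (T.points 0) d := fun x hx =>
    (dist_le_diam hx (points_mem_body T 0)).trans hd
  refine (measure_mono h1).trans ?_
  rw [Measure.addHaar_closedBall _ _ hd0]
  simp

/-- The exponent `1/q = m/2 + 1/p`. -/
def rexp (m : ℕ) (p : ℝ≥0∞) : ℝ := (m : ℝ) / 2 + p.toReal⁻¹

theorem rexp_pos {m : ℕ} (hm : 2 ≤ m) (p : ℝ≥0∞) : 0 < rexp m p := by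
  have : (0 : ℝ) < m := by exact_mod_cast (by omega : 0 < m)
  have := ENNReal.toReal_nonneg (a := p)
  unfold rexp
  positivity

theorem shapeNorm_eq {m : ℕ} (hm : 2 ≤ m) {p : ℝ≥0∞} (hp : 1 ≤ p) (f : Plane → ℝ)
    (Ω : Set Plane) :
    shapeNorm m p f Ω =
      (∫⁻ z in Ω, shapeFun m p (derivForm m f Ω z) ^ (rexp m p)⁻¹) ^ rexp m p := by
  have hp0 : p ≠ 0 := (zero_lt_one.trans_le hp).ne'
  have h1 : (m : ℝ≥0∞) / 2 + 1 / p ≠ ∞ := by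
    simp [ENNReal.div_eq_top, hp0]
  have h2 : ((m : ℝ≥0∞) / 2 + 1 / p).toReal = rexp m p := by
    rw [ENNReal.toReal_add (by simp [ENNReal.div_eq_top]) (by simp [hp0])]
    simp [rexp]
  have h0 : (m : ℝ≥0∞) / 2 + 1 / p ≠ 0 := by
    intro h
    rw [h, ENNReal.toReal_zero] at h2
    exact (rexp_pos hm p).ne h2
  rw [shapeNorm, eLpNorm_eq_lintegral_rpow_enorm_toReal (ENNReal.inv_ne_zero.2 h1)
    (ENNReal.inv_ne_top.2 h0), ENNReal.toReal_inv, h2]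
  simp

/-! ### The lower bound -/

/-- With `r = rexp m p`, Hölder's inequality against the constant `1` with conjugate exponents `p r`
and `2 r / m` produces the factor `𝒯.card ^ (m / 2)`; Minkowski then separates the perturbation `s`.
For `p = ∞` each term is simply bounded by the maximum. -/
theorem sum_rpow_le_globalError {m : ℕ} (hm : 2 ≤ m) {p : ℝ≥0∞} (hp : 1 ≤ p) (𝒯 : Finset Tri)
    (f : Plane → ℝ) (s : ℝ≥0∞) :
    (∑ T ∈ 𝒯, (localError m p T f + s) ^ (rexp m p)⁻¹) ^ rexp m p ≤
      (𝒯.card : ℝ≥0∞) ^ ((m : ℝ) / 2) *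
        (globalError m p 𝒯 f + (𝒯.card : ℝ≥0∞) ^ p.toReal⁻¹ * s) := by
  have hr := rexp_pos hm p
  have hm0 : (0 : ℝ) < m := by exact_mod_cast (by omega : 0 < m)
  by_cases hpt : p = ∞
  · have hr2 : rexp m p = (m : ℝ) / 2 := by simp [rexp, hpt]
    have hg : globalError m p 𝒯 f = ⨆ T ∈ 𝒯, localError m p T f := by simp [globalError, hpt]
    calc (∑ T ∈ 𝒯, (localError m p T f + s) ^ (rexp m p)⁻¹) ^ rexp m p
        ≤ (∑ T ∈ 𝒯, (globalError m p 𝒯 f + s) ^ (rexp m p)⁻¹) ^ rexp m p := by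
          gcongr with T hT
          rw [hg]
          exact le_iSup₂ (f := fun T (_ : T ∈ 𝒯) => localError m p T f) T hT
      _ = _ := by
          rw [Finset.sum_const, nsmul_eq_mul, ENNReal.mul_rpow_of_nonneg _ _ hr.le,
            ← ENNReal.rpow_mul, inv_mul_cancel₀ hr.ne', hr2]
          simp [hpt]
  · have hp0 : 0 < p.toReal := ENNReal.toReal_pos (zero_lt_one.trans_le hp).ne' hpt
    have hp1 : 1 ≤ p.toReal := by
      have := ENNReal.toReal_mono hpt hp
      simpa using this
    have hg : globalError m p 𝒯 f = (∑ T ∈ 𝒯, localError m p T f ^ p.toReal) ^ (1 / p.toReal) := by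
      simp [globalError, hpt]
    have hconj : (p.toReal * rexp m p).HolderConjugate (2 * rexp m p / m) := by
      rw [Real.holderConjugate_iff]
      constructor
      · rw [rexp, mul_add, mul_inv_cancel₀ hp0.ne']
        have : 0 < p.toReal * ((m : ℝ) / 2) := by positivity
        linarith
      · have h1 : p.toReal * rexp m p = p.toReal * m / 2 + 1 := by
          rw [rexp, mul_add, mul_inv_cancel₀ hp0.ne']; ring
        have h2 : rexp m p = (p.toReal * m / 2 + 1) / p.toReal := by
          rw [← h1]; field_simp
        rw [h1, h2]
        field_simp
        ring
    have h1 := ENNReal.inner_le_Lp_mul_Lq 𝒯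
      (fun T => (localError m p T f + s) ^ (rexp m p)⁻¹) (fun _ => 1) hconj
    have h2 := ENNReal.Lp_add_le 𝒯 (fun T => localError m p T f) (fun _ => s) hp1
    simp only [mul_one, ENNReal.one_rpow, Finset.sum_const, nsmul_eq_mul, ← ENNReal.rpow_mul]
      at h1 h2
    have h3 : (rexp m p)⁻¹ * (p.toReal * rexp m p) = p.toReal := by field_simp
    rw [h3] at h1
    have h4 : 1 / (p.toReal * rexp m p) * rexp m p = 1 / p.toReal := by field_simp
    have h5 : 1 / (2 * rexp m p / m) * rexp m p = (m : ℝ) / 2 := by field_simp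
    calc (∑ T ∈ 𝒯, (localError m p T f + s) ^ (rexp m p)⁻¹) ^ rexp m p
        ≤ _ := ENNReal.rpow_le_rpow h1 hr.le
      _ = (∑ T ∈ 𝒯, (localError m p T f + s) ^ p.toReal) ^ (1 / p.toReal) *
            (𝒯.card : ℝ≥0∞) ^ ((m : ℝ) / 2) := by
          rw [ENNReal.mul_rpow_of_nonneg _ _ hr.le, ← ENNReal.rpow_mul, ← ENNReal.rpow_mul, h4, h5]
      _ ≤ _ := by
          rw [mul_comm]
          refine mul_le_mul_right (h2.trans (add_le_add hg.ge (le_of_eq ?_))) _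
          rw [ENNReal.mul_rpow_of_nonneg _ _ (by positivity), ← ENNReal.rpow_mul,
            mul_one_div_cancel hp0.ne', ENNReal.rpow_one, one_div]

/-- With `q = 1 / rexp m p`, the hypothesis raised to the power `q` bounds the integrand by `a ^ q /
|T|`, because `|T|` then appears to the power one. -/
theorem lintegral_shapeFun_le {m : ℕ} (hm : 2 ≤ m) {p : ℝ≥0∞} (T : Tri) {f : Plane → ℝ}
    {Ω : Set Plane} {a : ℝ≥0∞}
    (h : ∀ z ∈ body T, shapeFun m p (derivForm m f Ω z) * volume (body T) ^ rexp m p ≤ a) :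
    ∫⁻ z in body T, shapeFun m p (derivForm m f Ω z) ^ (rexp m p)⁻¹ ≤ a ^ (rexp m p)⁻¹ := by
  have hr := rexp_pos hm p
  have hv0 := (volume_body_pos T).ne'
  have hv1 := volume_body_ne_top T
  calc ∫⁻ z in body T, shapeFun m p (derivForm m f Ω z) ^ (rexp m p)⁻¹
      ≤ ∫⁻ _z in body T, a ^ (rexp m p)⁻¹ / volume (body T) := by
        refine setLIntegral_mono' (measurableSet_body T) fun z hz => ?_
        rw [ENNReal.le_div_iff_mul_le (Or.inl hv0) (Or.inl hv1)]
        have := ENNReal.rpow_le_rpow (h z hz) (inv_nonneg.2 hr.le)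
        rwa [ENNReal.mul_rpow_of_nonneg _ _ (inv_nonneg.2 hr.le), ← ENNReal.rpow_mul,
          mul_inv_cancel₀ hr.ne', ENNReal.rpow_one] at this
    _ = a ^ (rexp m p)⁻¹ := by
        rw [lintegral_const, Measure.restrict_apply_univ, ENNReal.div_mul_cancel hv0 hv1]

theorem shapeNorm_le_of_triangulation {m : ℕ} (hm : 2 ≤ m) {p : ℝ≥0∞} (hp : 1 ≤ p)
    {Ω : Set Plane} {f : Plane → ℝ} {𝒯 : Finset Tri} (h𝒯 : IsTriangulation 𝒯 Ω) {s : ℝ≥0∞}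
    (h : ∀ T ∈ 𝒯, ∀ z ∈ body T, shapeFun m p (derivForm m f Ω z) * volume (body T) ^ rexp m p ≤
      localError m p T f + s) :
    shapeNorm m p f Ω ≤ (𝒯.card : ℝ≥0∞) ^ ((m : ℝ) / 2) *
        (globalError m p 𝒯 f + (𝒯.card : ℝ≥0∞) ^ p.toReal⁻¹ * s) := by
  refine le_trans ?_ (sum_rpow_le_globalError hm hp 𝒯 f s)
  rw [shapeNorm_eq hm hp]
  refine ENNReal.rpow_le_rpow ?_ (rexp_pos hm p).le
  calc ∫⁻ z in Ω, shapeFun m p (derivForm m f Ω z) ^ (rexp m p)⁻¹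
      = ∫⁻ z in ⋃ T ∈ 𝒯, body T, shapeFun m p (derivForm m f Ω z) ^ (rexp m p)⁻¹ := by
        rw [h𝒯.cover]
    _ ≤ ∑ T ∈ 𝒯, ∫⁻ z in body T, shapeFun m p (derivForm m f Ω z) ^ (rexp m p)⁻¹ := by
        have : (⋃ T ∈ 𝒯, body T) = ⋃ T : 𝒯, body T.1 := by
          ext x; simp
        rw [this]
        refine (lintegral_iUnion_le _ _).trans ?_
        rw [tsum_fintype, Finset.sum_coe_sort 𝒯
          (fun T => ∫⁻ z in body T, shapeFun m p (derivForm m f Ω z) ^ (rexp m p)⁻¹)]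
    _ ≤ _ := Finset.sum_le_sum fun T hT => lintegral_shapeFun_le hm T (h T hT)

theorem shapeNorm_le_liminf {m : ℕ} (hm : 2 ≤ m) {p : ℝ≥0∞} (hp : 1 ≤ p) {Ω : Set Plane}
    (hΩ : IsPolygonalDomain Ω) {f : Plane → ℝ} (hf : ContDiffOn ℝ m f Ω) {N₀ : ℕ}
    {𝒯 : ℕ → Finset Tri} (h𝒯 : IsAdmissible Ω N₀ 𝒯) :
    shapeNorm m p f Ω ≤
      liminf (fun N : ℕ => (N : ℝ≥0∞) ^ ((m : ℝ) / 2) * globalError m p (𝒯 N) f) atTop := by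
  obtain ⟨C, hC, hdiam⟩ := h𝒯.diam_le
  set b := (volume (Metric.ball (0 : Plane) 1)).toReal with hb
  have hbT : volume (Metric.ball (0 : Plane) 1) ≠ ∞ := measure_ball_lt_top.ne
  have hb0 : 0 < b := ENNReal.toReal_pos (Metric.measure_ball_pos _ _ one_pos).ne' hbT
  have hbE : volume (Metric.ball (0 : Plane) 1) = ENNReal.ofReal b :=
    (ENNReal.ofReal_toReal hbT).symm
  have hst : 0 < stab m := zero_lt_one.trans_le (one_le_stab m)
  -- Constant of the Taylor remainder once multiplied by `N ^ (m / 2) N ^ (1 / p)`: the powers of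
  -- `N` cancel against the diameter bound `C N ^ (-1/2)`. A modulus of continuity `ε / κ` thus
  -- leaves exactly `ε`.
  set κ := stab m * C ^ m * (C ^ 2 * b) ^ p.toReal⁻¹ with hκ
  have hκ0 : 0 < κ := by positivity
  refine ENNReal.le_of_forall_pos_le_add fun ε hε _ => ?_
  obtain ⟨δ, hδ, hmod⟩ := exists_modulus hΩ hf (η := ε / κ) (by positivity)
  rw [← tsub_le_iff_right]
  refine le_liminf_of_le (by isBoundedDefault) ?_
  have hev : ∀ᶠ N : ℕ in atTop, C * (N : ℝ) ^ (-(1 / 2) : ℝ) < δ := by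
    have h1 : Tendsto (fun N : ℕ => C * (N : ℝ) ^ (-(1 / 2) : ℝ)) atTop (𝓝 (C * 0)) :=
      ((tendsto_rpow_neg_atTop (by norm_num : (0 : ℝ) < 1 / 2)).comp
        tendsto_natCast_atTop_atTop).const_mul C
    rw [mul_zero] at h1
    exact h1.eventually_lt_const hδ
  filter_upwards [hev, eventually_ge_atTop N₀, eventually_ge_atTop 1] with N hN hN0 hN1
  rw [tsub_le_iff_right]
  have hNr : (0 : ℝ) < N := by exact_mod_cast hN1
  set d := C * (N : ℝ) ^ (-(1 / 2) : ℝ) with hd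
  have hd0 : 0 < d := by positivity
  have htri := h𝒯.triangulation N hN0
  set s := ENNReal.ofReal (stab m * (ε / κ * d ^ m) * (d ^ 2 * b) ^ p.toReal⁻¹) with hs
  have key := shapeNorm_le_of_triangulation hm hp htri (f := f) (s := s) ?_
  · rw [h𝒯.card_eq N hN0, mul_add] at key
    refine key.trans (add_le_add le_rfl (le_of_eq ?_))
    have hN' : (N : ℝ≥0∞) = ENNReal.ofReal N := by simp
    rw [hs, hN', ENNReal.ofReal_rpow_of_pos hNr, ENNReal.ofReal_rpow_of_pos hNr,
      ← ENNReal.ofReal_mul (by positivity), ← ENNReal.ofReal_mul (by positivity),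
      ← ENNReal.ofReal_coe_nnreal]
    congr 1
    have hd2 : d ^ 2 = C ^ 2 * (N : ℝ)⁻¹ := by
      rw [hd, mul_pow, ← Real.rpow_natCast (_ ^ _), ← Real.rpow_mul hNr.le]
      norm_num
      exact Or.inl (Real.rpow_neg_one _)
    have hdm : d ^ m = C ^ m * ((N : ℝ) ^ ((m : ℝ) / 2))⁻¹ := by
      rw [hd, mul_pow, ← Real.rpow_natCast (_ ^ _), ← Real.rpow_mul hNr.le, ← Real.rpow_neg hNr.le]
      congr 2
      ring
    have e1 : (d ^ 2 * b) ^ p.toReal⁻¹ = (C ^ 2 * b) ^ p.toReal⁻¹ * ((N : ℝ) ^ p.toReal⁻¹)⁻¹ := by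
      rw [hd2, mul_right_comm, Real.mul_rpow (by positivity) (by positivity),
        Real.inv_rpow hNr.le]
    rw [e1, hdm, hκ]
    field_simp
  · intro T hT z hz
    have hTΩ : body T ⊆ Ω := by
      rw [← htri.cover]
      exact Set.subset_biUnion_of_mem (u := fun T => body T) hT
    have hTd := hdiam N hN0 T hT
    have h1 := localError_derivForm_le_localError hm hp hf hΩ.uniqueDiffOn
      hΩ.subset_closure_interior hTΩ (hTΩ hz) (w := ε / κ) fun y hy =>
        hmod y (hTΩ hy) z (hTΩ hz) ((dist_le_diam hy hz).trans_lt (hTd.trans_lt hN))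
    refine (shapeFun_mul_le hm p T (isHomogeneous_derivForm m f Ω z)).trans
      (h1.trans (add_le_add le_rfl ?_))
    rw [hs, ENNReal.ofReal_mul (p := stab m * (ε / κ * d ^ m)) (by positivity), ← ENNReal.ofReal_rpow_of_nonneg (by positivity)
      (by positivity)]
    gcongr
    rw [ENNReal.ofReal_mul (by positivity), ← hbE]
    exact volume_body_le T hTd

/-! ### Triangulations: general constructions -/

theorem IsTriangulation.subset {𝒯 : Finset Tri} {Ω : Set Plane} (h : IsTriangulation 𝒯 Ω)
    {T : Tri} (hT : T ∈ 𝒯) : body T ⊆ Ω := by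
  rw [← h.cover]
  exact Set.subset_biUnion_of_mem (u := fun T => body T) hT

theorem IsTriangulation.exists_mem {𝒯 : Finset Tri} {Ω : Set Plane} (h : IsTriangulation 𝒯 Ω)
    {x : Plane} (hx : x ∈ Ω) : ∃ T ∈ 𝒯, x ∈ body T := by
  rw [← h.cover] at hx
  simpa using hx

theorem IsTriangulation.nonempty {𝒯 : Finset Tri} {Ω : Set Plane} (h : IsTriangulation 𝒯 Ω)
    (hΩ : Ω.Nonempty) : 𝒯.Nonempty := by
  obtain ⟨x, hx⟩ := hΩ
  obtain ⟨T, hT, -⟩ := h.exists_mem hx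
  exact ⟨T, hT⟩

theorem isTriangulation_singleton (T : Tri) : IsTriangulation {T} (body T) where
  cover := by simp
  nonoverlap := by
    intro S hS S' hS' hne
    rw [Finset.mem_singleton] at hS hS'
    exact absurd (hS.trans hS'.symm) hne

theorem not_disjoint_interior_self (T : Tri) :
    ¬ Disjoint (interior (body T)) (interior (body T)) := by
  rw [Set.not_disjoint_iff_nonempty_inter, Set.inter_self]
  exact nonempty_interior_body T

/-- Triangulations of pairwise non-overlapping pieces form a triangulation of the union. -/
theorem IsTriangulation.biUnion {ι : Type*} [DecidableEq Tri] {I : Finset ι} {A : ι → Set Plane}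
    {𝒢 : ι → Finset Tri} {Ω : Set Plane} (hΩ : (⋃ i ∈ I, A i) = Ω)
    (hA : ∀ i ∈ I, ∀ j ∈ I, i ≠ j → Disjoint (interior (A i)) (interior (A j)))
    (h𝒢 : ∀ i ∈ I, IsTriangulation (𝒢 i) (A i)) : IsTriangulation (I.biUnion 𝒢) Ω where
  cover := by
    rw [← hΩ, Finset.set_biUnion_biUnion]
    exact Set.iUnion₂_congr fun i hi => (h𝒢 i hi).cover
  nonoverlap := by
    intro S hS T hT hne
    obtain ⟨i, hi, hSi⟩ := Finset.mem_biUnion.1 hS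
    obtain ⟨j, hj, hTj⟩ := Finset.mem_biUnion.1 hT
    by_cases hij : i = j
    · subst hij
      exact (h𝒢 i hi).nonoverlap S hSi T hTj hne
    · exact (hA i hi j hj hij).mono (interior_mono ((h𝒢 i hi).subset hSi))
        (interior_mono ((h𝒢 j hj).subset hTj))

/-- Refinement of a triangulation. -/
theorem IsTriangulation.refine {𝒯 : Finset Tri} [DecidableEq Tri] {𝒢 : Tri → Finset Tri}
    {Ω : Set Plane} (h : IsTriangulation 𝒯 Ω)
    (h𝒢 : ∀ T ∈ 𝒯, IsTriangulation (𝒢 T) (body T)) : IsTriangulation (𝒯.biUnion 𝒢) Ω :=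
  IsTriangulation.biUnion h.cover h.nonoverlap h𝒢

/-! ### Splitting a triangle -/

/-- The triangle obtained from `T` by moving the vertex `j` to `z`. -/
def repl (T : Tri) (j : Fin 3) (z : Plane) (hz : bco T j z ≠ 0) : Tri where
  points := Function.update T.points j z
  independent := by
    rw [affineIndependent_iff_of_fintype]
    intro w hw hw0 l
    rw [Finset.univ.weightedVSub_eq_linear_combination hw] at hw0
    -- The coordinates of `T` are applied to a linear relation among the new vertices: coordinate
    -- `j` sees only `z`, so `w j = 0`, and each other coordinate then sees only its own vertex.
    have h1 : ∀ l, ∑ i, w i * bco T l (Function.update T.points j z i) = 0 := by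
      intro l
      have h2 : ∀ x, bco T l x = (bco T l).linear x + bco T l 0 := by
        intro x
        have := (bco T l).map_vadd 0 x
        simpa using this
      simp_rw [h2 (Function.update T.points j z _), mul_add, Finset.sum_add_distrib,
        ← Finset.sum_mul, hw, zero_mul, add_zero]
      have h3 := congrArg (bco T l).linear hw0
      simpa [map_sum] using h3
    have h2 : ∀ l, ∑ i, w i * bco T l (Function.update T.points j z i) =
        w j * bco T l z + ∑ i ∈ Finset.univ.erase j, w i * (if l = i then 1 else 0) := by
      intro l
      rw [← Finset.add_sum_erase _ _ (Finset.mem_univ j), Function.update_self]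
      congr 1
      refine Finset.sum_congr rfl fun i hi => ?_
      rw [Function.update_of_ne (Finset.ne_of_mem_erase hi), bco_points]
    have hj : w j = 0 := by
      have := h1 j
      rw [h2, Finset.sum_eq_zero (fun i hi => by
        rw [if_neg (Finset.ne_of_mem_erase hi).symm, mul_zero]), add_zero] at this
      exact (mul_eq_zero.1 this).resolve_right hz
    by_cases hl : l = j
    · rw [hl, hj]
    · have := h1 l
      rw [h2, hj, zero_mul, zero_add, Finset.sum_eq_single l] at this
      · simpa using this
      · intro i _ hi
        rw [if_neg (Ne.symm hi), mul_zero]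
      · intro h
        exact absurd (Finset.mem_erase.2 ⟨hl, Finset.mem_univ l⟩) h

theorem repl_points (T : Tri) (j : Fin 3) (z : Plane) (hz : bco T j z ≠ 0) :
    (repl T j z hz).points = Function.update T.points j z := rfl

theorem repl_points_self (T : Tri) (j : Fin 3) (z : Plane) (hz : bco T j z ≠ 0) :
    (repl T j z hz).points j = z := by rw [repl_points, Function.update_self]

theorem repl_points_ne (T : Tri) {j l : Fin 3} (z : Plane) (hz : bco T j z ≠ 0) (h : l ≠ j) :
    (repl T j z hz).points l = T.points l := by rw [repl_points, Function.update_of_ne h]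

theorem bco_eq_sum_repl (T : Tri) (j : Fin 3) (z : Plane) (hz : bco T j z ≠ 0) (l : Fin 3)
    (x : Plane) : bco T l x = bco (repl T j z hz) j x * bco T l z +
      if l = j then 0 else bco (repl T j z hz) l x := by
  rw [affine_eq_sum (repl T j z hz) (bco T l) x, ← Finset.add_sum_erase _ _ (Finset.mem_univ j),
    repl_points_self]
  congr 1
  have : ∀ i ∈ Finset.univ.erase j, bco (repl T j z hz) i x *
      bco T l ((repl T j z hz).points i) = if l = i then bco (repl T j z hz) i x else 0 := by
    intro i hi
    rw [repl_points_ne T z hz (Finset.ne_of_mem_erase hi), bco_points, mul_ite, mul_one, mul_zero]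
  rw [Finset.sum_congr rfl this, Finset.sum_ite_eq]
  by_cases h : l = j <;> simp [h]

theorem bco_repl_self (T : Tri) (j : Fin 3) (z : Plane) (hz : bco T j z ≠ 0) (x : Plane) :
    bco (repl T j z hz) j x = bco T j x / bco T j z := by
  rw [bco_eq_sum_repl T j z hz j x, if_pos rfl, add_zero, mul_div_cancel_right₀ _ hz]

theorem bco_repl_ne (T : Tri) {j l : Fin 3} (z : Plane) (hz : bco T j z ≠ 0) (h : l ≠ j)
    (x : Plane) :
    bco (repl T j z hz) l x = bco T l x - bco T j x / bco T j z * bco T l z := by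
  rw [bco_eq_sum_repl T j z hz l x, if_neg h, bco_repl_self]
  ring

theorem body_repl_subset (T : Tri) (j : Fin 3) (z : Plane) (hz : bco T j z ≠ 0)
    (hzT : z ∈ body T) : body (repl T j z hz) ⊆ body T := by
  rw [body_subset_iff (convex_body T)]
  intro i
  by_cases h : i = j
  · subst h; rwa [repl_points_self]
  · rw [repl_points_ne T z hz h]; exact points_mem_body T i

/-- Splitting a triangle along the segment from a point `z` of an edge to the opposite vertex. -/
theorem isTriangulation_split [DecidableEq Tri] {T : Tri} {i j : Fin 3} (hij : i ≠ j) {z : Plane}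
    (hi : 0 < bco T i z) (hj : 0 < bco T j z) (h0 : ∀ l, l ≠ i → l ≠ j → bco T l z = 0) :
    IsTriangulation {repl T i z hi.ne', repl T j z hj.ne'} (body T) ∧
      Disjoint (interior (body (repl T i z hi.ne'))) (interior (body (repl T j z hj.ne'))) := by
  have hzT : z ∈ body T := mem_body_iff.2 fun l => by
    by_cases h1 : l = i
    · rw [h1]; exact hi.le
    by_cases h2 : l = j
    · rw [h2]; exact hj.le
    rw [h0 l h1 h2]
  -- The line through `z` and the opposite vertex is `bco T i x * bco T j z = bco T j x * bco T i
  -- z`; the direction of the inequality decides which half contains `x`.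
  have hmem : ∀ (i j : Fin 3) (_ : i ≠ j) (hi : 0 < bco T i z) (hj : 0 < bco T j z)
      (h0 : ∀ l, l ≠ i → l ≠ j → bco T l z = 0) (x : Plane), x ∈ body T →
      bco T i x * bco T j z ≤ bco T j x * bco T i z → x ∈ body (repl T i z hi.ne') := by
    intro i j hij hi hj h0 x hx hle
    rw [mem_body_iff] at hx ⊢
    intro l
    by_cases h1 : l = i
    · subst h1
      rw [bco_repl_self]
      exact div_nonneg (hx l) hi.le
    rw [bco_repl_ne T z hi.ne' h1]
    by_cases h2 : l = j
    · subst h2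
      rw [sub_nonneg, div_mul_eq_mul_div, div_le_iff₀ hi]
      exact hle
    · rw [h0 l h1 h2, mul_zero, sub_zero]
      exact hx l
  have hdisj : Disjoint (interior (body (repl T i z hi.ne')))
      (interior (body (repl T j z hj.ne'))) := by
    rw [Set.disjoint_left]
    intro x h1 h2
    rw [mem_interior_body_iff] at h1 h2
    have a1 := h1 j
    have a2 := h2 i
    rw [bco_repl_ne T z _ hij.symm, sub_pos, div_mul_eq_mul_div, div_lt_iff₀ hi] at a1
    rw [bco_repl_ne T z _ hij, sub_pos, div_mul_eq_mul_div, div_lt_iff₀ hj] at a2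
    exact lt_asymm a1 a2
  refine ⟨⟨?_, ?_⟩, hdisj⟩
  · simp only [Finset.mem_insert, Finset.mem_singleton, Set.iUnion_iUnion_eq_or_left,
      Set.iUnion_iUnion_eq_left]
    refine Set.Subset.antisymm (Set.union_subset (body_repl_subset T i z _ hzT)
      (body_repl_subset T j z _ hzT)) fun x hx => ?_
    rcases le_total (bco T i x * bco T j z) (bco T j x * bco T i z) with h | h
    · exact Or.inl (hmem i j hij hi hj h0 x hx h)
    · exact Or.inr (hmem j i hij.symm hj hi (fun l h1 h2 => h0 l h2 h1) x hx h)
  · intro S hS S' hS' hne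
    simp only [Finset.mem_insert, Finset.mem_singleton] at hS hS'
    rcases hS with rfl | rfl <;> rcases hS' with rfl | rfl
    · exact absurd rfl hne
    · exact hdisj
    · exact hdisj.symm
    · exact absurd rfl hne

/-- Any triangle is the union of two triangles. -/
theorem exists_bisection [DecidableEq Tri] (T : Tri) :
    ∃ 𝒢 : Finset Tri, IsTriangulation 𝒢 (body T) ∧ 𝒢.card = 2 := by
  set z := ∑ i, (![1 / 2, 1 / 2, 0] : Fin 3 → ℝ) i • T.points i with hz
  have hb : ∀ i, bco T i z = (![1 / 2, 1 / 2, 0] : Fin 3 → ℝ) i := fun i =>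
    bco_sum_smul T _ (by
      rw [Fin.sum_univ_three]
      show (1 / 2 + 1 / 2 + 0 : ℝ) = 1
      norm_num) i
  have h0 : 0 < bco T 0 z := by rw [hb]; norm_num
  have h1 : 0 < bco T 1 z := by rw [hb]; norm_num
  obtain ⟨h2, h3⟩ := isTriangulation_split (T := T) (i := 0) (j := 1) (by decide) h0 h1 (by
    intro l hl0 hl1
    rw [hb]
    fin_cases l
    · exact absurd rfl hl0
    · exact absurd rfl hl1
    · rfl)
  refine ⟨_, h2, Finset.card_pair fun h => ?_⟩
  rw [h] at h3
  exact not_disjoint_interior_self _ h3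

/-! ### Cutting along lines -/

theorem affine_nonneg_on_body {T : Tri} {l : Plane →ᵃ[ℝ] ℝ} (h : ∀ i, 0 ≤ l (T.points i))
    {x : Plane} (hx : x ∈ body T) : 0 ≤ l x := by
  rw [affine_eq_sum T l]
  exact Finset.sum_nonneg fun i _ => mul_nonneg (mem_body_iff.1 hx i) (h i)

theorem affine_nonpos_on_body {T : Tri} {l : Plane →ᵃ[ℝ] ℝ} (h : ∀ i, l (T.points i) ≤ 0)
    {x : Plane} (hx : x ∈ body T) : l x ≤ 0 := by
  rw [affine_eq_sum T l]
  exact Finset.sum_nonpos fun i _ => mul_nonpos_of_nonneg_of_nonpos (mem_body_iff.1 hx i) (h i)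

/-- `l` has a constant sign on `s`. -/
def SignOn (l : Plane →ᵃ[ℝ] ℝ) (s : Set Plane) : Prop := (∀ x ∈ s, 0 ≤ l x) ∨ ∀ x ∈ s, l x ≤ 0

theorem SignOn.mono {l : Plane →ᵃ[ℝ] ℝ} {s t : Set Plane} (h : SignOn l t) (hst : s ⊆ t) :
    SignOn l s := h.imp (fun h x hx => h x (hst hx)) (fun h x hx => h x (hst hx))

/-- Induction on the number of ordered pairs of vertices strictly on opposite sides of the line:
splitting at the zero of `l` on such an edge replaces one of its ends by a point where `l` vanishes,
so the number drops in both halves. The position of the new vertices is recorded to know later that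
cutting along the edges of a triangle creates none in its interior. -/
theorem exists_cut_aux (l : Plane →ᵃ[ℝ] ℝ) (n : ℕ) (T : Tri)
    (hn : (Finset.univ.filter fun q : Fin 3 × Fin 3 =>
      l (T.points q.1) < 0 ∧ 0 < l (T.points q.2)).card ≤ n) :
    ∃ 𝒢 : Finset Tri, IsTriangulation 𝒢 (body T) ∧ 𝒢.card ≤ 2 ^ n ∧ ∀ S ∈ 𝒢,
      SignOn l (body S) ∧ ∀ i, S.points i ∈ Set.range T.points ∨ l (S.points i) = 0 := by
  classical
  induction n generalizing T with
  | zero =>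
    refine ⟨{T}, isTriangulation_singleton T, by simp, fun S hS => ?_⟩
    rw [Finset.mem_singleton] at hS
    subst hS
    refine ⟨?_, fun i => Or.inl (Set.mem_range_self i)⟩
    by_cases h : ∃ i, l (S.points i) < 0
    · obtain ⟨i, hi⟩ := h
      refine Or.inr fun x hx => affine_nonpos_on_body (fun j => ?_) hx
      by_contra! hj
      have : ((i, j) : Fin 3 × Fin 3) ∈ Finset.univ.filter fun q : Fin 3 × Fin 3 =>
        l (S.points q.1) < 0 ∧ 0 < l (S.points q.2) := by simp [hi, hj]
      rw [Finset.card_eq_zero.1 (Nat.le_zero.1 hn)] at this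
      simp at this
    · push Not at h
      exact Or.inl fun x hx => affine_nonneg_on_body h hx
  | succ n ih =>
    by_cases hex : ∃ i j, l (T.points i) < 0 ∧ 0 < l (T.points j)
    swap
    · obtain ⟨𝒢, h1, h2, h3⟩ := ih T (by
        rw [Finset.card_eq_zero.2]
        · exact Nat.zero_le _
        · refine Finset.filter_eq_empty_iff.2 fun q _ hq => hex ⟨q.1, q.2, hq⟩)
      exact ⟨𝒢, h1, h2.trans (Nat.pow_le_pow_right (by norm_num) (Nat.le_succ n)), h3⟩
    obtain ⟨i, j, hi, hj⟩ := hex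
    have hij : i ≠ j := by rintro rfl; exact lt_asymm hi hj
    set a := l (T.points i)
    set b := l (T.points j)
    have hba : 0 < b - a := by linarith
    set z := AffineMap.lineMap (T.points i) (T.points j) (-a / (b - a)) with hz
    have hlz : ∀ g : Plane →ᵃ[ℝ] ℝ, g z = g (T.points i) +
        (-a / (b - a)) * (g (T.points j) - g (T.points i)) := by
      intro g
      rw [hz, AffineMap.apply_lineMap, AffineMap.lineMap_apply]
      simp
      ring
    have hlz0 : l z = 0 := by
      rw [hlz]
      show a + -a / (b - a) * (b - a) = 0
      rw [div_mul_cancel₀ _ hba.ne']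
      ring
    have hzi : 0 < bco T i z := by
      rw [hlz, bco_points, bco_points, if_pos rfl, if_neg hij]
      have : 1 + -a / (b - a) * (0 - 1) = b / (b - a) := by field_simp; ring
      rw [this]
      positivity
    have hzj : 0 < bco T j z := by
      rw [hlz, bco_points, bco_points, if_pos rfl, if_neg hij.symm]
      have : 0 + -a / (b - a) * (1 - 0) = -a / (b - a) := by ring
      rw [this]
      exact div_pos (by linarith) hba
    have hz0 : ∀ k, k ≠ i → k ≠ j → bco T k z = 0 := by
      intro k h1 h2
      rw [hlz, bco_points, bco_points, if_neg h1, if_neg h2]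
      ring
    obtain ⟨hsplit, -⟩ := isTriangulation_split hij hzi hzj hz0
    have hcard : ∀ (k : Fin 3) (hk : k = i ∨ k = j) (hk0 : bco T k z ≠ 0),
        (Finset.univ.filter fun q : Fin 3 × Fin 3 => l ((repl T k z hk0).points q.1) < 0 ∧
          0 < l ((repl T k z hk0).points q.2)).card ≤ n := by
      intro k hk hk0
      refine Nat.le_of_lt_succ (lt_of_lt_of_le (Finset.card_lt_card ?_) hn)
      rw [Finset.ssubset_iff_of_subset]
      · refine ⟨(i, j), by simp [a, b, hi, hj], ?_⟩
        rw [Finset.mem_filter]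
        rintro ⟨-, h1, h2⟩
        rcases hk with rfl | rfl
        · rw [repl_points_self, hlz0] at h1
          exact lt_irrefl _ h1
        · rw [repl_points_self, hlz0] at h2
          exact lt_irrefl _ h2
      · intro q hq
        rw [Finset.mem_filter] at hq ⊢
        have h1 : q.1 ≠ k := by
          intro h
          have := hq.2.1
          rw [h, repl_points_self, hlz0] at this
          exact lt_irrefl _ this
        have h2 : q.2 ≠ k := by
          intro h
          have := hq.2.2
          rw [h, repl_points_self, hlz0] at this
          exact lt_irrefl _ this
        rw [repl_points_ne T z hk0 h1, repl_points_ne T z hk0 h2] at hq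
        exact hq
    have hpts : ∀ (k : Fin 3) (hk0 : bco T k z ≠ 0) (i : Fin 3),
        (repl T k z hk0).points i ∈ Set.range T.points ∨ (repl T k z hk0).points i = z := by
      intro k hk0 i
      by_cases h : i = k
      · rw [h, repl_points_self]; exact Or.inr rfl
      · rw [repl_points_ne T z hk0 h]; exact Or.inl (Set.mem_range_self i)
    have hall : ∀ S ∈ ({repl T i z hzi.ne', repl T j z hzj.ne'} : Finset Tri),
        ∃ 𝒢 : Finset Tri, IsTriangulation 𝒢 (body S) ∧ 𝒢.card ≤ 2 ^ n ∧ ∀ S ∈ 𝒢,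
        SignOn l (body S) ∧ ∀ i, S.points i ∈ Set.range T.points ∨ l (S.points i) = 0 := by
      intro S hS
      have hS' : ∃ k, ∃ hk0 : bco T k z ≠ 0, (k = i ∨ k = j) ∧ S = repl T k z hk0 := by
        simp only [Finset.mem_insert, Finset.mem_singleton] at hS
        rcases hS with h | h
        · exact ⟨i, hzi.ne', Or.inl rfl, h⟩
        · exact ⟨j, hzj.ne', Or.inr rfl, h⟩
      obtain ⟨k, hk0, hk, rfl⟩ := hS'
      obtain ⟨𝒢, h1, h2, h3⟩ := ih _ (hcard k hk hk0)
      refine ⟨𝒢, h1, h2, fun S hS => ⟨(h3 S hS).1, fun i => ?_⟩⟩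
      rcases (h3 S hS).2 i with ⟨i', hi'⟩ | h
      · rcases hpts k hk0 i' with h | h
        · exact Or.inl (hi' ▸ h)
        · exact Or.inr (by rw [← hi', h, hlz0])
      · exact Or.inr h
    choose! 𝒢 h1 h2 h3 using hall
    refine ⟨_, hsplit.refine h1, ?_, fun S hS => ?_⟩
    · refine (Finset.card_biUnion_le_card_mul _ _ _ h2).trans ?_
      rw [pow_succ, mul_comm]
      exact Nat.mul_le_mul_left _ Finset.card_le_two
    · obtain ⟨T', hT', hS'⟩ := Finset.mem_biUnion.1 hS
      exact h3 T' hT' S hS'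

/-- Cutting a triangle along finitely many lines. -/
theorem exists_cut (L : List (Plane →ᵃ[ℝ] ℝ)) (T : Tri) :
    ∃ 𝒢 : Finset Tri, IsTriangulation 𝒢 (body T) ∧ 𝒢.card ≤ (2 ^ 9) ^ L.length ∧ ∀ S ∈ 𝒢,
      (∀ l ∈ L, SignOn l (body S)) ∧
      ∀ i, S.points i ∈ Set.range T.points ∨ ∃ l ∈ L, l (S.points i) = 0 := by
  classical
  induction L generalizing T with
  | nil =>
    refine ⟨{T}, isTriangulation_singleton T, by simp, fun S hS => ?_⟩
    rw [Finset.mem_singleton] at hS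
    subst hS
    exact ⟨by simp, fun i => Or.inl (Set.mem_range_self i)⟩
  | cons l L ih =>
    obtain ⟨𝒬, hq1, hq2, hq3⟩ := exists_cut_aux l 9 T
      ((Finset.card_le_univ _).trans (by simp))
    choose 𝒢 h1 h2 h3 using ih
    refine ⟨_, hq1.refine fun S _ => h1 S, ?_, fun S hS => ?_⟩
    · refine (Finset.card_biUnion_le_card_mul _ _ _ fun S _ => h2 S).trans ?_
      rw [List.length_cons, pow_succ, mul_comm]
      exact Nat.mul_le_mul_left _ hq2
    · obtain ⟨S', hS', hSS'⟩ := Finset.mem_biUnion.1 hS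
      have hsub := (h1 S').subset hSS'
      refine ⟨fun l' hl' => ?_, fun i => ?_⟩
      · rcases List.mem_cons.1 hl' with rfl | h
        · exact (hq3 S' hS').1.mono hsub
        · exact (h3 S' S hSS').1 l' h
      · rcases (h3 S' S hSS').2 i with ⟨i', hi'⟩ | ⟨l', hl', h⟩
        · rcases (hq3 S' hS').2 i' with h | h
          · exact Or.inl (hi' ▸ h)
          · exact Or.inr ⟨l, by simp, hi' ▸ h⟩
        · exact Or.inr ⟨l', by simp [hl'], h⟩

theorem norm_sub_le_of_bco {T : Tri} {x y : Plane} {c : ℝ}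
    (h : ∀ i, |bco T i x - bco T i y| ≤ c) : dist x y ≤ 3 * c * Metric.diam (body T) := by
  have h1 : x - y = ∑ i, (bco T i x - bco T i y) • (T.points i - T.points 0) := by
    simp only [smul_sub, Finset.sum_sub_distrib, ← Finset.sum_smul, sub_smul, sum_bco,
      sum_bco_smul]
    simp
  rw [dist_eq_norm, h1]
  refine (norm_sum_le _ _).trans ?_
  have h2 : ∀ i ∈ Finset.univ, ‖(bco T i x - bco T i y) • (T.points i - T.points 0)‖ ≤
      c * Metric.diam (body T) := by
    intro i _
    rw [norm_smul, Real.norm_eq_abs]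
    refine mul_le_mul (h i) ?_ (norm_nonneg _) ((abs_nonneg _).trans (h i))
    rw [← dist_eq_norm]
    exact dist_le_diam (points_mem_body T i) (points_mem_body T 0)
  refine (Finset.sum_le_card_nsmul _ _ _ h2).trans ?_
  simp [mul_assoc]

/-- Subdivision of a triangle into a bounded number of small triangles. -/
theorem exists_fine_subdivision (k : ℕ) (hk : 0 < k) :
    ∃ M : ℕ, ∀ T : Tri, ∃ 𝒢 : Finset Tri, IsTriangulation 𝒢 (body T) ∧ 𝒢.card ≤ M ∧
      ∀ S ∈ 𝒢, Metric.diam (body S) ≤ 3 / k * Metric.diam (body T) := by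
  refine ⟨(2 ^ 9) ^ (3 * k), fun T => ?_⟩
  have hk' : (0 : ℝ) < k := by exact_mod_cast hk
  -- The lines on which a barycentric coordinate equals `a / k`. On a piece of constant sign for all
  -- of them, each coordinate varies by at most `1 / k`.
  set L : List (Plane →ᵃ[ℝ] ℝ) := List.ofFn (n := 3 * k) (fun a =>
    bco T (finProdFinEquiv.symm a).1 -
      AffineMap.const ℝ Plane (((finProdFinEquiv.symm a).2 : ℕ) / k : ℝ)) with hL
  obtain ⟨𝒢, h1, h2, h3⟩ := exists_cut L T
  refine ⟨𝒢, h1, by simpa [hL] using h2, fun S hS => ?_⟩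
  refine Metric.diam_le_of_forall_dist_le (by positivity) fun x hx y hy => ?_
  have hST := h1.subset hS
  have key : ∀ x ∈ body S, ∀ y ∈ body S, ∀ i, bco T i y - bco T i x ≤ 1 / k := by
    intro x hx y hy i
    by_contra! hlt
    have hx0 : 0 ≤ bco T i x := mem_body_iff.1 (hST hx) i
    have hy1 : bco T i y ≤ 1 := bco_le_one (hST hy) i
    -- The first grid value strictly above the coordinate of `x` would separate `x` from `y`.
    set a := ⌊k * bco T i x⌋₊ + 1 with ha
    have ha1 : k * bco T i x < a := by
      rw [ha]; push_cast; exact Nat.lt_floor_add_one _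
    have ha2 : (a : ℝ) < k * bco T i y := by
      have h4 : (⌊k * bco T i x⌋₊ : ℝ) ≤ k * bco T i x := Nat.floor_le (by positivity)
      rw [lt_sub_iff_add_lt, div_add' _ _ _ hk'.ne', div_lt_iff₀ hk'] at hlt
      rw [ha]; push_cast
      linarith
    have hak : a < k := by
      have : (a : ℝ) < k := ha2.trans_le (mul_le_of_le_one_right hk'.le hy1)
      exact_mod_cast this
    have hmem : bco T i - AffineMap.const ℝ Plane (a / k : ℝ) ∈ L := by
      rw [hL, List.mem_ofFn]
      exact ⟨finProdFinEquiv (i, ⟨a, hak⟩), by simp⟩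
    have e1 : bco T i x < a / k := by rw [lt_div_iff₀ hk', mul_comm]; exact ha1
    have e2 : a / k < bco T i y := by rw [div_lt_iff₀ hk', mul_comm]; exact ha2
    rcases (h3 S hS).1 _ hmem with h | h
    · have := h x hx
      simp at this
      linarith
    · have := h y hy
      simp at this
      linarith
  have := norm_sub_le_of_bco (T := T) (x := x) (y := y) (c := 1 / k) fun i => by
    rw [abs_le]
    have h4 := key x hx y hy i
    have h5 := key y hy x hx i
    constructor <;> linarith
  refine this.trans (le_of_eq ?_)
  ring

/-! ### Fine triangulations of a polygonal domain -/

theorem exists_tri_superset (T : Tri) {s : Set Plane} (hs : Bornology.IsBounded s) :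
    ∃ U : Tri, s ⊆ body U := by
  obtain ⟨z, hz⟩ := nonempty_interior_body T
  obtain ⟨r, hr, hball⟩ := Metric.isOpen_iff.1 isOpen_interior z hz
  obtain ⟨R, hR⟩ := hs.subset_ball z
  set σ := (|R| + 1) / r with hσ
  have hσ0 : 0 < σ := by positivity
  refine ⟨homTri σ hσ0.ne' (z - σ • z) T, fun y hy => ?_⟩
  rw [body_homTri]
  refine ⟨σ⁻¹ • (y - z) + z, interior_subset (hball ?_), ?_⟩
  · rw [Metric.mem_ball, dist_eq_norm, add_sub_cancel_right, norm_smul, norm_inv,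
      Real.norm_eq_abs, abs_of_pos hσ0]
    have h1 : ‖y - z‖ < |R| + 1 := by
      have := hR hy
      rw [Metric.mem_ball, dist_eq_norm] at this
      exact (this.trans_le (le_abs_self R)).trans (lt_add_one _)
    rw [inv_mul_lt_iff₀ hσ0, hσ, div_mul_cancel₀ _ hr.ne']
    exact h1
  · simp only [hom, smul_add, smul_smul, mul_inv_cancel₀ hσ0.ne', one_smul]
    abel

/-- All coordinates of `T` are positive at `x`, which excludes the nonpositive alternative on `S`.
So after a cut along the edge lines of `T`, every piece meeting the interior of `T` lies in `T`. -/
theorem subset_body_of_signOn {S T : Tri} (h : ∀ i, SignOn (bco T i) (body S)) {x : Plane}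
    (hxS : x ∈ body S) (hxT : x ∈ interior (body T)) : body S ⊆ body T := by
  intro y hy
  rw [mem_body_iff]
  intro i
  rcases h i with h' | h'
  · exact h' y hy
  · exact absurd (h' x hxS) (not_le.2 (mem_interior_body_iff.1 hxT i))

theorem body_subset_of_interior_subset {T : Tri} {A : Set Plane} (hA : IsClosed A)
    (h : interior (body T) ⊆ A) : body T ⊆ A := by
  rw [← closure_interior_body]
  exact closure_minimal h hA

/-- The triangles defining `Ω` may overlap. A large triangle is cut along all their edge lines and
the pieces contained in `Ω` are kept; these cover the interior of each given triangle, hence its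
closure. A fine subdivision then reduces the diameters. -/
theorem IsPolygonalDomain.exists_triangulation {Ω : Set Plane} (h : IsPolygonalDomain Ω) {ε : ℝ}
    (hε : 0 < ε) : ∃ 𝒯, IsTriangulation 𝒯 Ω ∧ ∀ T ∈ 𝒯, Metric.diam (body T) ≤ ε := by
  classical
  have hbdd := h.isCompact.isBounded
  obtain ⟨P, ⟨T₀, hT₀⟩, hP⟩ := h
  obtain ⟨U, hU⟩ := exists_tri_superset T₀ hbdd
  obtain ⟨𝒢, h1, -, h3⟩ := exists_cut (P.toList.flatMap fun T => List.ofFn fun i => bco T i) U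
  have hsign : ∀ S ∈ 𝒢, ∀ T ∈ P, ∀ i, SignOn (bco T i) (body S) := by
    intro S hS T hT i
    refine (h3 S hS).1 _ ?_
    rw [List.mem_flatMap]
    exact ⟨T, by simpa using hT, by rw [List.mem_ofFn]; exact ⟨i, rfl⟩⟩
  have hcoarse : IsTriangulation (𝒢.filter fun S => body S ⊆ Ω) Ω := by
    refine ⟨Set.Subset.antisymm ?_ ?_, fun S hS T hT hne => h1.nonoverlap S
      (Finset.mem_filter.1 hS).1 T (Finset.mem_filter.1 hT).1 hne⟩
    · exact Set.iUnion₂_subset fun S hS => (Finset.mem_filter.1 hS).2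
    · conv_lhs => rw [hP]
      refine Set.iUnion₂_subset fun T hT => body_subset_of_interior_subset ?_ fun x hx => ?_
      · exact Set.Finite.isClosed_biUnion (Finset.finite_toSet _) fun S _ => isClosed_body S
      · have hTΩ : body T ⊆ Ω := by
          rw [hP]
          exact Set.subset_biUnion_of_mem (u := fun T => body T) hT
        obtain ⟨S, hS, hxS⟩ := h1.exists_mem (hU (hTΩ (interior_subset hx)))
        have := (subset_body_of_signOn (hsign S hS T hT) hxS hx).trans hTΩ
        exact Set.mem_biUnion (Finset.mem_filter.2 ⟨hS, this⟩) hxS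
  obtain ⟨k, hk⟩ := exists_nat_gt (3 * Metric.diam Ω / ε)
  have hk0 : (0 : ℝ) < k := lt_of_le_of_lt (by positivity) hk
  obtain ⟨M, hM⟩ := exists_fine_subdivision k (by exact_mod_cast hk0)
  choose 𝒫' hp1 _ hp3 using hM
  refine ⟨_, hcoarse.refine fun T _ => hp1 T, fun S hS => ?_⟩
  obtain ⟨T, hT, hST⟩ := Finset.mem_biUnion.1 hS
  refine (hp3 T S hST).trans ?_
  have h5 : Metric.diam (body T) ≤ Metric.diam Ω := Metric.diam_mono (hcoarse.subset hT) hbdd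
  rw [div_lt_iff₀ hε] at hk
  calc 3 / (k : ℝ) * Metric.diam (body T) ≤ 3 / k * Metric.diam Ω := by gcongr
    _ = 3 * Metric.diam Ω / k := by ring
    _ ≤ ε := by rw [div_le_iff₀ hk0]; linarith

/-! ### Two non-overlapping triangles near a common boundary point -/

theorem eventually_pos_lineMap (l : Plane →ᵃ[ℝ] ℝ) {z x : Plane}
    (h : 0 < l z ∨ l z = 0 ∧ 0 < l x) :
    ∀ᶠ t : ℝ in 𝓝[>] 0, 0 < l (AffineMap.lineMap z x t) := by
  have h1 : ∀ t : ℝ, l (AffineMap.lineMap z x t) = l z + t * (l x - l z) := by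
    intro t
    rw [AffineMap.apply_lineMap, AffineMap.lineMap_apply]
    simp
    ring
  simp_rw [h1]
  rcases h with h | ⟨h, h'⟩
  · have hc : Tendsto (fun t : ℝ => l z + t * (l x - l z)) (𝓝[>] 0) (𝓝 (l z + 0 * (l x - l z))) := by
      refine Tendsto.mono_left ?_ nhdsWithin_le_nhds
      exact Continuous.tendsto (by fun_prop) 0
    rw [zero_mul, add_zero] at hc
    exact hc.eventually_const_lt h
  · filter_upwards [self_mem_nhdsWithin] with t ht
    rw [h, zero_add, sub_zero]
    exact mul_pos ht h'

theorem bco_pos_of_not_vertex {T : Tri} {z : Plane} (hz : z ∈ body T)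
    (hv : z ∉ Set.range T.points) {i : Fin 3} (hi : bco T i z = 0) : ∀ j, j ≠ i → 0 < bco T j z := by
  intro j hj
  refine lt_of_le_of_ne (mem_body_iff.1 hz j) fun h0 => hv ?_
  have h3 : ∀ i j : Fin 3, j ≠ i → ∃ k : Fin 3, ∀ l, l ≠ k → l = i ∨ l = j := by decide
  obtain ⟨k, hk⟩ := h3 i j hj
  refine ⟨k, ext_bco T fun l => ?_⟩
  have hz0 : ∀ l, l ≠ k → bco T l z = 0 := by
    intro l hl
    rcases hk l hl with rfl | rfl
    · exact hi
    · exact h0.symm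
  rw [bco_points]
  split_ifs with h
  · subst h
    rw [← sum_bco T z, Finset.sum_eq_single l (fun b _ hb => hz0 b hb)
      (fun h => absurd (Finset.mem_univ _) h)]
  · exact (hz0 l h).symm

theorem notMem_interior_of_disjoint {S T : Tri}
    (h : Disjoint (interior (body S)) (interior (body T))) {z : Plane} (hz : z ∈ body S) :
    z ∉ interior (body T) := by
  intro hzT
  rw [← closure_interior_body] at hz
  obtain ⟨y, h1, h2⟩ := mem_closure_iff.1 hz _ isOpen_interior hzT
  exact Set.disjoint_left.1 h h2 h1

/-- At a common point, not a vertex, of two non-overlapping triangles, each triangle is locally a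
half-plane, and the open half-planes are disjoint. -/
theorem exists_half_planes {S T : Tri} (h : Disjoint (interior (body S)) (interior (body T)))
    {z : Plane} (hzS : z ∈ body S) (hzT : z ∈ body T) (hvS : z ∉ Set.range S.points)
    (hvT : z ∉ Set.range T.points) :
    ∃ i j, bco S i z = 0 ∧ bco T j z = 0 ∧ (∀ k, k ≠ i → 0 < bco S k z) ∧
      (∀ k, k ≠ j → 0 < bco T k z) ∧ ∀ x, 0 < bco S i x → bco T j x ≤ 0 := by
  have hS : ∃ i, bco S i z = 0 := by
    by_contra! hne
    exact notMem_interior_of_disjoint h.symm hzT (mem_interior_body_iff.2 fun i =>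
      lt_of_le_of_ne (mem_body_iff.1 hzS i) (hne i).symm)
  have hT : ∃ i, bco T i z = 0 := by
    by_contra! hne
    exact notMem_interior_of_disjoint h hzS (mem_interior_body_iff.2 fun i =>
      lt_of_le_of_ne (mem_body_iff.1 hzT i) (hne i).symm)
  obtain ⟨i, hi⟩ := hS
  obtain ⟨j, hj⟩ := hT
  have hSp := bco_pos_of_not_vertex hzS hvS hi
  have hTp := bco_pos_of_not_vertex hzT hvT hj
  refine ⟨i, j, hi, hj, hSp, hTp, fun x hx => ?_⟩
  by_contra! hx'
  -- A point with both coordinates positive is impossible: a short move from `z` towards it would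
  -- enter both interiors.
  have e1 : ∀ᶠ t : ℝ in 𝓝[>] 0, ∀ k, 0 < bco S k (AffineMap.lineMap z x t) := by
    rw [eventually_all]
    intro k
    refine eventually_pos_lineMap _ ?_
    by_cases hk : k = i
    · subst hk; exact Or.inr ⟨hi, hx⟩
    · exact Or.inl (hSp k hk)
  have e2 : ∀ᶠ t : ℝ in 𝓝[>] 0, ∀ k, 0 < bco T k (AffineMap.lineMap z x t) := by
    rw [eventually_all]
    intro k
    refine eventually_pos_lineMap _ ?_
    by_cases hk : k = j
    · subst hk; exact Or.inr ⟨hj, hx'⟩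
    · exact Or.inl (hTp k hk)
  obtain ⟨t, h1, h2⟩ := (e1.and e2).exists
  exact Set.disjoint_left.1 h (mem_interior_body_iff.2 h1) (mem_interior_body_iff.2 h2)

theorem eventually_pos_of_ne {T : Tri} {z : Plane} {i : Fin 3}
    (h : ∀ k, k ≠ i → 0 < bco T k z) : ∀ᶠ x in 𝓝 z, ∀ k, k ≠ i → 0 < bco T k x := by
  rw [eventually_all]
  intro k
  by_cases hk : k = i
  · exact Eventually.of_forall fun x h => absurd hk h
  · filter_upwards [(continuous_bco T k).continuousAt.eventually (lt_mem_nhds (h k hk))] with x hx _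
    exact hx

theorem mem_body_of_bco {T : Tri} {x : Plane} {i : Fin 3} (h : ∀ k, k ≠ i → 0 < bco T k x)
    (hi : 0 ≤ bco T i x) : x ∈ body T := by
  rw [mem_body_iff]
  intro k
  by_cases hk : k = i
  · subst hk; exact hi
  · exact (h k hk).le

theorem affine_reflect (l : Plane →ᵃ[ℝ] ℝ) {z : Plane} (hz : l z = 0) (x : Plane) :
    l (AffineMap.lineMap x z (2 : ℝ)) = -l x := by
  rw [AffineMap.apply_lineMap, AffineMap.lineMap_apply, hz]
  simp
  ring

/-- Near `z` each triangle coincides with a half-plane. A nearby point outside both would have its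
reflection in `z` inside both open half-planes, which are disjoint. -/
theorem union_body_mem_nhds {S T : Tri} (h : Disjoint (interior (body S)) (interior (body T)))
    {z : Plane} (hzS : z ∈ body S) (hzT : z ∈ body T) (hvS : z ∉ Set.range S.points)
    (hvT : z ∉ Set.range T.points) : body S ∪ body T ∈ 𝓝 z := by
  obtain ⟨i, j, hi, hj, hSp, hTp, H⟩ := exists_half_planes h hzS hzT hvS hvT
  filter_upwards [eventually_pos_of_ne hSp, eventually_pos_of_ne hTp] with x hx1 hx2
  by_cases h1 : 0 ≤ bco S i x
  · exact Or.inl (mem_body_of_bco hx1 h1)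
  by_cases h2 : 0 ≤ bco T j x
  · exact Or.inr (mem_body_of_bco hx2 h2)
  exfalso
  push Not at h1 h2
  have := H (AffineMap.lineMap x z (2 : ℝ)) (by rw [affine_reflect _ hi]; linarith)
  rw [affine_reflect _ hj] at this
  linarith

/-- Near `z` the intersection is the common boundary line of two opposite half-planes, so `z` is the
midpoint of a segment contained in it. -/
theorem notMem_extremePoints_inter {S T : Tri}
    (h : Disjoint (interior (body S)) (interior (body T)))
    {z : Plane} (hvS : z ∉ Set.range S.points) (hvT : z ∉ Set.range T.points) :
    z ∉ (body S ∩ body T).extremePoints ℝ := by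
  rintro ⟨⟨hzS, hzT⟩, hext⟩
  obtain ⟨i, j, hi, hj, hSp, hTp, H⟩ := exists_half_planes h hzS hzT hvS hvT
  obtain ⟨a, b, hab, hai, hbi⟩ : ∃ a b : Fin 3, a ≠ b ∧ a ≠ i ∧ b ≠ i := by
    clear hi hSp H
    revert i
    decide
  set d : Plane := S.points a - S.points b with hd
  have hd0 : d ≠ 0 := sub_ne_zero.2 (S.independent.injective.ne hab)
  have hl : ∀ (l : Plane →ᵃ[ℝ] ℝ) (t : ℝ),
      l (z + t • d) = l z + t * (l (S.points a) - l (S.points b)) := by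
    intro l t
    have h1 : l (z + t • d) = l.linear (t • d) + l z := by
      have := l.map_vadd z (t • d)
      simpa [add_comm] using this
    have h2 : l (S.points a) - l (S.points b) = l.linear d := by
      have := (l.linearMap_vsub (S.points a) (S.points b))
      simpa [hd] using this.symm
    rw [h1, h2, map_smul, smul_eq_mul, add_comm]
  have hSd : ∀ t : ℝ, bco S i (z + t • d) = 0 := by
    intro t
    rw [hl, hi, bco_points, bco_points, if_neg hai.symm, if_neg hbi.symm]
    simp
  -- The edge line of `S` through `z` is a limit of points of the open half-plane of `S`, where `bco
  -- T j` is nonpositive. Being affine along the line and zero at `z`, `bco T j` vanishes on all of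
  -- it.
  have hTle : ∀ t : ℝ, bco T j (z + t • d) ≤ 0 := by
    intro t
    by_contra! hpos
    have e1 := eventually_pos_lineMap (bco S i) (z := z + t • d) (x := S.points i)
      (Or.inr ⟨hSd t, by rw [bco_points, if_pos rfl]; exact one_pos⟩)
    have e2 := eventually_pos_lineMap (bco T j) (z := z + t • d) (x := S.points i) (Or.inl hpos)
    obtain ⟨s, h1, h2⟩ := (e1.and e2).exists
    exact absurd (H _ h1) (not_le.2 h2)
  have hTd : ∀ t : ℝ, bco T j (z + t • d) = 0 := by
    intro t
    have h1 := hTle t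
    have h2 := hTle (-t)
    rw [hl, hj] at h1 h2 ⊢
    linarith
  have hev : ∀ᶠ t : ℝ in 𝓝 0, z + t • d ∈ body S ∩ body T := by
    have hc : Tendsto (fun t : ℝ => z + t • d) (𝓝 0) (𝓝 z) := by
      have : Continuous fun t : ℝ => z + t • d := by fun_prop
      simpa using this.tendsto 0
    filter_upwards [hc.eventually (eventually_pos_of_ne hSp),
      hc.eventually (eventually_pos_of_ne hTp)] with t h1 h2
    exact ⟨mem_body_of_bco h1 (hSd t).ge, mem_body_of_bco h2 (hTd t).ge⟩
  obtain ⟨ε, hε, hball⟩ := Metric.eventually_nhds_iff.1 hev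
  have h1 : z + (ε / 2) • d ∈ body S ∩ body T := hball (by
    rw [dist_zero_right, Real.norm_eq_abs, abs_of_pos (by positivity)]; linarith)
  have h2 : z + (-(ε / 2)) • d ∈ body S ∩ body T := hball (by
    rw [dist_zero_right, Real.norm_eq_abs, abs_neg, abs_of_pos (by positivity)]; linarith)
  have h3 := hext h1 h2 ⟨1 / 2, 1 / 2, by norm_num, by norm_num, by norm_num, by
    rw [← smul_add, add_add_add_comm, ← add_smul, add_neg_cancel, zero_smul, add_zero,
      ← two_smul ℝ z, smul_smul]
    norm_num⟩
  rw [add_eq_left, smul_eq_zero] at h3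
  rcases h3 with h3 | h3
  · linarith
  · exact hd0 h3

/-- No vertex of a triangle lies on another triangle unless it is a vertex of it. -/
def NoHanging (𝒯 : Finset Tri) : Prop :=
  ∀ S ∈ 𝒯, ∀ T ∈ 𝒯, ∀ i, S.points i ∈ body T → S.points i ∈ Set.range T.points

/-- By Krein–Milman the intersection of two triangles is the closed convex hull of its extreme
points. Each of these is a vertex of at least one triangle by `notMem_extremePoints_inter`, hence of
both when there are no hanging nodes. -/
theorem isConforming_of_noHanging {𝒯 : Finset Tri} {Ω : Set Plane} (h𝒯 : IsTriangulation 𝒯 Ω)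
    (h : NoHanging 𝒯) : IsConforming 𝒯 := by
  intro S hS T hT
  by_cases hST : S = T
  · subst hST
    rw [Set.inter_self, Set.inter_self]
    rfl
  refine Set.Subset.antisymm ?_ ?_
  · have hcomp : IsCompact (body S ∩ body T) := (isCompact_body S).inter (isCompact_body T)
    have hconv : Convex ℝ (body S ∩ body T) := (convex_body S).inter (convex_body T)
    rw [← closure_convexHull_extremePoints hcomp hconv]
    refine closure_minimal (convexHull_mono fun z hz => ?_) ?_
    · by_contra hne
      have hzS := hz.1.1
      have hzT := hz.1.2
      refine notMem_extremePoints_inter (h𝒯.nonoverlap S hS T hT hST) ?_ ?_ hz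
      · rintro ⟨i, rfl⟩
        exact hne ⟨⟨i, rfl⟩, h S hS T hT i hzT⟩
      · rintro ⟨i, rfl⟩
        exact hne ⟨h T hT S hS i hzS, ⟨i, rfl⟩⟩
    · exact (((Set.finite_range _).inter_of_left _).isCompact_convexHull ℝ).isClosed
  · exact Set.subset_inter (convexHull_mono Set.inter_subset_left)
      (convexHull_mono Set.inter_subset_right)

/-! ### Removing hanging nodes -/

theorem ne_of_points_mem_repl {T : Tri} {i j : Fin 3} (hij : j ≠ i) {z : Plane}
    (hi : 0 < bco T i z) (hj : 0 < bco T j z) {l : Fin 3}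
    (h : T.points l ∈ body (repl T i z hi.ne')) : l ≠ i := by
  rintro rfl
  have := mem_body_iff.1 h j
  rw [bco_repl_ne T z _ hij, bco_points, bco_points, if_pos rfl, if_neg hij] at this
  have : 0 < 1 / bco T l z * bco T j z := by positivity
  linarith

theorem points_mem_range_repl {T : Tri} {i j : Fin 3} (hij : j ≠ i) {z : Plane}
    (hi : 0 < bco T i z) (hj : 0 < bco T j z) {u : Plane} (hu : u ∈ Set.range T.points)
    (h : u ∈ body (repl T i z hi.ne')) : u ∈ Set.range (repl T i z hi.ne').points := by
  obtain ⟨l, rfl⟩ := hu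
  exact ⟨l, repl_points_ne T z _ (ne_of_points_mem_repl hij hi hj h)⟩

theorem points_repl_mem (T : Tri) (k : Fin 3) (z : Plane) (hz : bco T k z ≠ 0) (i : Fin 3) :
    (repl T k z hz).points i ∈ Set.range T.points ∨ (repl T k z hz).points i = z := by
  by_cases h : i = k
  · rw [h, repl_points_self]; exact Or.inr rfl
  · rw [repl_points_ne T z hz h]; exact Or.inl (Set.mem_range_self i)

/-- A boundary point of a triangle which is not a vertex lies inside an edge. -/
theorem exists_edge {T : Tri} {z : Plane} (hz : z ∈ body T) (hzi : z ∉ interior (body T))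
    (hv : z ∉ Set.range T.points) : ∃ i j, i ≠ j ∧ 0 < bco T i z ∧ 0 < bco T j z ∧
      ∀ l, l ≠ i → l ≠ j → bco T l z = 0 := by
  have hS : ∃ k, bco T k z = 0 := by
    by_contra! hne
    exact hzi (mem_interior_body_iff.2 fun i =>
      lt_of_le_of_ne (mem_body_iff.1 hz i) (hne i).symm)
  obtain ⟨k, hk⟩ := hS
  have hp := bco_pos_of_not_vertex hz hv hk
  have h3 : ∀ k : Fin 3, ∃ i j : Fin 3, i ≠ j ∧ i ≠ k ∧ j ≠ k ∧ ∀ l, l ≠ i → l ≠ j → l = k := by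
    decide
  obtain ⟨i, j, hij, hi, hj, hl⟩ := h3 k
  exact ⟨i, j, hij, hp i hi, hp j hj, fun l h1 h2 => by rw [hl l h1 h2, hk]⟩

/-- A triangle can be subdivided so that given points of its boundary become vertices. -/
theorem exists_split_nodes (V : Finset Plane) (n : ℕ) (T : Tri)
    (hV : ∀ v ∈ V, v ∉ interior (body T))
    (hn : {v | v ∈ V ∧ v ∈ body T ∧ v ∉ Set.range T.points}.ncard ≤ n) :
    ∃ 𝒢 : Finset Tri, IsTriangulation 𝒢 (body T) ∧ 𝒢.card ≤ 2 ^ n ∧ ∀ S ∈ 𝒢,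
      (∀ i, S.points i ∈ Set.range T.points ∨ S.points i ∈ V) ∧
      ∀ v ∈ V, v ∈ body S → v ∈ Set.range S.points := by
  classical
  have hfin : ∀ T : Tri, {v | v ∈ V ∧ v ∈ body T ∧ v ∉ Set.range T.points}.Finite := fun T =>
    V.finite_toSet.subset fun v hv => hv.1
  by_cases hex : ∃ v, v ∈ V ∧ v ∈ body T ∧ v ∉ Set.range T.points
  swap
  · refine ⟨{T}, isTriangulation_singleton T, by simp [Nat.one_le_two_pow], fun S hS => ?_⟩
    rw [Finset.mem_singleton] at hS
    subst hS
    refine ⟨fun i => Or.inl (Set.mem_range_self i), fun v hv hvS => ?_⟩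
    by_contra hne
    exact hex ⟨v, hv, hvS, hne⟩
  obtain ⟨z, hzV, hzT, hzv⟩ := hex
  induction n generalizing T z with
  | zero =>
    rw [Nat.le_zero, Set.ncard_eq_zero (hfin T)] at hn
    exact absurd (show z ∈ (∅ : Set Plane) from hn ▸ ⟨hzV, hzT, hzv⟩) (Set.notMem_empty z)
  | succ n ih =>
    obtain ⟨i, j, hij, hi, hj, h0⟩ := exists_edge hzT (hV z hzV) hzv
    obtain ⟨hsplit, -⟩ := isTriangulation_split hij hi hj h0
    have hall : ∀ S ∈ ({repl T i z hi.ne', repl T j z hj.ne'} : Finset Tri),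
        ∃ 𝒢 : Finset Tri, IsTriangulation 𝒢 (body S) ∧ 𝒢.card ≤ 2 ^ n ∧ ∀ S ∈ 𝒢,
        (∀ i, S.points i ∈ Set.range T.points ∨ S.points i ∈ V) ∧
          ∀ v ∈ V, v ∈ body S → v ∈ Set.range S.points := by
      intro S hS
      have hS' : ∃ k k', ∃ hk0 : 0 < bco T k z, 0 < bco T k' z ∧ k' ≠ k ∧
          S = repl T k z hk0.ne' := by
        simp only [Finset.mem_insert, Finset.mem_singleton] at hS
        rcases hS with h | h
        · exact ⟨i, j, hi, hj, hij.symm, h⟩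
        · exact ⟨j, i, hj, hi, hij, h⟩
      obtain ⟨k, k', hk, hk', hkk, rfl⟩ := hS'
      have hsub := body_repl_subset T k z hk.ne' hzT
      have hV' : ∀ v ∈ V, v ∉ interior (body (repl T k z hk.ne')) := fun v hv h =>
        hV v hv (interior_mono hsub h)
      -- The split makes `z` a vertex and creates no new missing node: an old vertex contained in a
      -- half is still a vertex of that half.
      have hcard : {v | v ∈ V ∧ v ∈ body (repl T k z hk.ne') ∧
          v ∉ Set.range (repl T k z hk.ne').points}.ncard ≤ n := by
        refine Nat.le_of_lt_succ (lt_of_lt_of_le (Set.ncard_lt_ncard ?_ (hfin T)) hn)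
        rw [Set.ssubset_iff_of_subset]
        · exact ⟨z, ⟨hzV, hzT, hzv⟩, fun h => h.2.2 ⟨k, repl_points_self T k z hk.ne'⟩⟩
        · rintro v ⟨h1, h2, h3⟩
          exact ⟨h1, hsub h2, fun h => h3 (points_mem_range_repl hkk hk hk' h h2)⟩
      have hlift : ∀ u, u ∈ Set.range (repl T k z hk.ne').points ∨ u ∈ V →
          u ∈ Set.range T.points ∨ u ∈ V := by
        rintro u (⟨a, rfl⟩ | h)
        · rcases points_repl_mem T k z hk.ne' a with h | h
          · exact Or.inl h
          · rw [h]; exact Or.inr hzV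
        · exact Or.inr h
      by_cases hex' : ∃ v, v ∈ V ∧ v ∈ body (repl T k z hk.ne') ∧
          v ∉ Set.range (repl T k z hk.ne').points
      · obtain ⟨v, hv1, hv2, hv3⟩ := hex'
        obtain ⟨𝒢, h1, h2, h3⟩ := ih _ hV' hcard v hv1 hv2 hv3
        exact ⟨𝒢, h1, h2, fun S hS => ⟨fun a => hlift _ ((h3 S hS).1 a), (h3 S hS).2⟩⟩
      · refine ⟨_, isTriangulation_singleton _, by simp [Nat.one_le_two_pow], fun S hS => ?_⟩
        rw [Finset.mem_singleton] at hS
        subst hS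
        refine ⟨fun a => hlift _ (Or.inl (Set.mem_range_self a)), fun v hv hvS => ?_⟩
        by_contra hne
        exact hex' ⟨v, hv, hvS, hne⟩
    choose! 𝒢 h1 h2 h3 using hall
    refine ⟨_, hsplit.refine h1, ?_, fun S hS => ?_⟩
    · refine (Finset.card_biUnion_le_card_mul _ _ _ h2).trans ?_
      rw [pow_succ, mul_comm]
      exact Nat.mul_le_mul_left _ Finset.card_le_two
    · obtain ⟨T', hT', hS'⟩ := Finset.mem_biUnion.1 hS
      exact h3 T' hT' S hS'

/-! ### Adjusting the number of triangles -/

theorem IsTriangulation.notMem_erase_of_subset {𝒯 : Finset Tri} [DecidableEq Tri] {Ω : Set Plane}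
    (h : IsTriangulation 𝒯 Ω) {T S : Tri} (hT : T ∈ 𝒯) (hS : body S ⊆ body T) :
    S ∉ 𝒯.erase T := by
  intro hmem
  rw [Finset.mem_erase] at hmem
  have := (h.nonoverlap S hmem.2 T hT hmem.1).mono_right (interior_mono hS)
  exact not_disjoint_interior_self S this

theorem IsTriangulation.replace {𝒯 𝒢 : Finset Tri} [DecidableEq Tri] {Ω : Set Plane} {T : Tri}
    (h : IsTriangulation 𝒯 Ω) (hT : T ∈ 𝒯) (h𝒢 : IsTriangulation 𝒢 (body T)) :
    IsTriangulation (𝒯.erase T ∪ 𝒢) Ω ∧ (𝒯.erase T ∪ 𝒢).card + 1 = 𝒯.card + 𝒢.card := by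
  constructor
  · have h1 := h.refine (𝒢 := fun S => if S = T then 𝒢 else {S}) fun S _ => by
      by_cases hS : S = T
      · subst hS; simpa using h𝒢
      · simpa [hS] using isTriangulation_singleton S
    refine cast ?_ h1
    congr 1
    ext S
    rw [Finset.mem_biUnion, Finset.mem_union, Finset.mem_erase]
    constructor
    · rintro ⟨R, hR, hSR⟩
      by_cases hRT : R = T
      · rw [if_pos hRT] at hSR
        exact Or.inr hSR
      · rw [if_neg hRT, Finset.mem_singleton] at hSR
        subst hSR
        exact Or.inl ⟨hRT, hR⟩
    · rintro (⟨h1, h2⟩ | h1)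
      · exact ⟨S, h2, by rw [if_neg h1]; exact Finset.mem_singleton_self S⟩
      · exact ⟨T, hT, by rw [if_pos rfl]; exact h1⟩
  · rw [Finset.card_union_of_disjoint, add_right_comm, Finset.card_erase_add_one hT]
    rw [Finset.disjoint_right]
    exact fun S hS => h.notMem_erase_of_subset hT (h𝒢.subset hS)

theorem exists_subdivision_card (T : Tri) (n : ℕ) :
    ∃ 𝒢 : Finset Tri, IsTriangulation 𝒢 (body T) ∧ 𝒢.card = n + 1 := by
  classical
  induction n with
  | zero => exact ⟨{T}, isTriangulation_singleton T, by simp⟩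
  | succ n ih =>
    obtain ⟨𝒢, h1, h2⟩ := ih
    obtain ⟨S, hS⟩ := h1.nonempty (nonempty_body T)
    obtain ⟨ℋ, h3, h4⟩ := exists_bisection S
    obtain ⟨h5, h6⟩ := h1.replace hS h3
    exact ⟨_, h5, by omega⟩

theorem exists_mem_frontier {s t : Set Plane} (hs : IsPreconnected s) (h1 : (s ∩ t).Nonempty)
    (h2 : (s ∩ tᶜ).Nonempty) : (s ∩ frontier t).Nonempty := by
  by_contra hne
  rw [Set.not_nonempty_iff_eq_empty] at hne
  have hcov : ∀ x ∈ s, x ∈ interior t ∨ x ∈ (closure t)ᶜ := by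
    intro x hx
    by_cases hc : x ∈ closure t
    · left
      by_contra hi
      exact Set.eq_empty_iff_forall_notMem.1 hne x ⟨hx, hc, hi⟩
    · exact Or.inr hc
  obtain ⟨x, hxs, hxt⟩ := h1
  obtain ⟨y, hys, hyt⟩ := h2
  obtain ⟨w, -, hw1, hw2⟩ := hs (interior t) (closure t)ᶜ isOpen_interior
    isClosed_closure.isOpen_compl hcov
    ⟨x, hxs, (hcov x hxs).resolve_right fun h => h (subset_closure hxt)⟩
    ⟨y, hys, (hcov y hys).resolve_left fun h => hyt (interior_subset h)⟩
  exact hw2 (subset_closure (interior_subset hw1))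

/-- The plane minus a countable set is connected, so the complement of a finite frontier could not
be separated into interior and exterior. Infinitely many boundary points make it possible to split
repeatedly away from existing vertices. -/
theorem infinite_frontier {Ω : Set Plane} (hΩ : IsCompact Ω) (hi : (interior Ω).Nonempty) :
    (frontier Ω).Infinite := by
  intro hfin
  have hconn : IsConnected (frontier Ω)ᶜ := by
    refine (hfin.countable.isPathConnected_compl_of_one_lt_rank ?_).isConnected
    rw [← Module.finrank_eq_rank]
    simp
  obtain ⟨x, hx⟩ := hi
  obtain ⟨y, hy⟩ := (Set.ne_univ_iff_exists_notMem Ω).1 hΩ.ne_univ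
  have h1 : ((frontier Ω)ᶜ ∩ Ω).Nonempty := ⟨x, fun h => h.2 hx, interior_subset hx⟩
  have h2 : ((frontier Ω)ᶜ ∩ Ωᶜ).Nonempty := ⟨y, fun h => hy (hΩ.isClosed.frontier_subset h), hy⟩
  obtain ⟨w, hw1, hw2⟩ := exists_mem_frontier hconn.isPreconnected h1 h2
  exact hw1 hw2

/-- The split is made at a point `z` of the boundary of `Ω` that is not a vertex. A second triangle
containing `z` would, by `union_body_mem_nhds`, make `z` interior to `Ω`; so no hanging node arises.
One half keeps infinitely many boundary points, which allows iteration. -/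
theorem exists_boundary_split [DecidableEq Tri] {𝒯 : Finset Tri} {Ω : Set Plane}
    (h : IsTriangulation 𝒯 Ω) (hh : NoHanging 𝒯) {T : Tri} (hT : T ∈ 𝒯)
    (hinf : (frontier Ω ∩ body T).Infinite) :
    ∃ 𝒢 : Finset Tri, IsTriangulation 𝒢 (body T) ∧ 𝒢.card = 2 ∧ NoHanging (𝒯.erase T ∪ 𝒢) ∧
      ∃ S ∈ 𝒢, (frontier Ω ∩ body S).Infinite := by
  have hVfin : (⋃ S ∈ 𝒯, Set.range S.points).Finite :=
    𝒯.finite_toSet.biUnion fun S _ => Set.finite_range _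
  obtain ⟨z, ⟨hzΩ, hzT⟩, hzV⟩ := hinf.exists_notMem_finite hVfin
  have hzv : ∀ S ∈ 𝒯, z ∉ Set.range S.points := fun S hS hz => hzV (Set.mem_biUnion hS hz)
  have hzi : z ∉ interior (body T) := fun h' => hzΩ.2 (interior_mono (h.subset hT) h')
  obtain ⟨i, j, hij, hi, hj, h0⟩ := exists_edge hzT hzi (hzv T hT)
  obtain ⟨hsplit, hdis⟩ := isTriangulation_split hij hi hj h0
  have hmem : ∀ S ∈ ({repl T i z hi.ne', repl T j z hj.ne'} : Finset Tri),
      ∃ k k', ∃ hk0 : 0 < bco T k z, 0 < bco T k' z ∧ k' ≠ k ∧ S = repl T k z hk0.ne' := by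
    intro S hS
    simp only [Finset.mem_insert, Finset.mem_singleton] at hS
    rcases hS with h | h
    · exact ⟨i, j, hi, hj, hij.symm, h⟩
    · exact ⟨j, i, hj, hi, hij, h⟩
  refine ⟨_, hsplit, Finset.card_pair fun h => ?_, ?_, ?_⟩
  · rw [h] at hdis
    exact not_disjoint_interior_self _ hdis
  · have hvert : ∀ S ∈ 𝒯.erase T ∪ {repl T i z hi.ne', repl T j z hj.ne'}, ∀ a,
        S.points a = z ∨ ∃ S' ∈ 𝒯, S.points a ∈ Set.range S'.points := by
      intro S hS a
      rcases Finset.mem_union.1 hS with hS | hS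
      · exact Or.inr ⟨S, Finset.mem_of_mem_erase hS, Set.mem_range_self a⟩
      · obtain ⟨k, k', hk, hk', hkk, rfl⟩ := hmem S hS
        rcases points_repl_mem T k z hk.ne' a with h | h
        · exact Or.inr ⟨T, hT, h⟩
        · exact Or.inl h
    intro S hS S' hS' a ha
    rcases Finset.mem_union.1 hS' with hS' | hS'
    · rw [Finset.mem_erase] at hS'
      rcases hvert S hS a with hz | ⟨R, hR, b, hb⟩
      · exfalso
        rw [hz] at ha
        have h1 := union_body_mem_nhds (h.nonoverlap S' hS'.2 T hT hS'.1) ha hzT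
          (hzv S' hS'.2) (hzv T hT)
        exact hzΩ.2 (mem_interior_iff_mem_nhds.2 (mem_of_superset h1
          (Set.union_subset (h.subset hS'.2) (h.subset hT))))
      · rw [← hb] at ha ⊢
        exact hh R hR S' hS'.2 b ha
    · obtain ⟨k, k', hk, hk', hkk, rfl⟩ := hmem S' hS'
      rcases hvert S hS a with hz | ⟨R, hR, b, hb⟩
      · rw [hz]
        exact ⟨k, repl_points_self T k z hk.ne'⟩
      · rw [← hb] at ha ⊢
        exact points_mem_range_repl hkk hk hk'
          (hh R hR T hT b (body_repl_subset T k z hk.ne' hzT ha)) ha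
  · by_contra! hfin
    refine hinf ?_
    rw [← hsplit.cover, Set.inter_iUnion₂]
    exact (Finset.finite_toSet _).biUnion fun S hS => hfin S hS

/-- In a conforming triangulation any number of triangles can be added by subdividing a single
triangle which has infinitely many points in common with the boundary of the domain. -/
theorem exists_fill [DecidableEq Tri] {Ω : Set Plane} (n : ℕ) {𝒯 : Finset Tri}
    (h : IsTriangulation 𝒯 Ω) (hh : NoHanging 𝒯) {T : Tri} (hT : T ∈ 𝒯)
    (hinf : (frontier Ω ∩ body T).Infinite) :
    ∃ 𝒢 : Finset Tri, IsTriangulation 𝒢 (body T) ∧ 𝒢.card = n + 1 ∧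
      NoHanging (𝒯.erase T ∪ 𝒢) := by
  induction n generalizing 𝒯 T with
  | zero =>
    refine ⟨{T}, isTriangulation_singleton T, by simp, ?_⟩
    rwa [Finset.union_comm, ← Finset.insert_eq, Finset.insert_erase hT]
  | succ n ih =>
    obtain ⟨𝒢, h1, h2, h3, S, hS, hSinf⟩ := exists_boundary_split h hh hT hinf
    obtain ⟨h4, -⟩ := h.replace hT h1
    obtain ⟨ℋ, h5, h6, h7⟩ := ih h4 h3 (Finset.mem_union_right _ hS) hSinf
    obtain ⟨h8, h9⟩ := h1.replace hS h5
    refine ⟨_, h8, by omega, ?_⟩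
    have : (𝒯.erase T ∪ 𝒢).erase S ∪ ℋ = 𝒯.erase T ∪ (𝒢.erase S ∪ ℋ) := by
      rw [Finset.erase_union_distrib, Finset.erase_eq_of_notMem
        (h.notMem_erase_of_subset hT (h1.subset hS)), Finset.union_assoc]
    rwa [this] at h7

/-! ### Packing -/

theorem volume_interior_body (T : Tri) : volume (interior (body T)) = volume (body T) := by
  refine le_antisymm (measure_mono interior_subset) ?_
  calc volume (body T) ≤ volume (interior (body T) ∪ frontier (body T)) := by
        refine measure_mono fun x hx => ?_
        rw [← closure_eq_interior_union_frontier]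
        exact subset_closure hx
    _ ≤ volume (interior (body T)) + volume (frontier (body T)) := measure_union_le _ _
    _ = _ := by rw [volume_frontier_body, add_zero]

theorem sum_volume_le {ι : Type*} (F : Finset ι) (τ : ι → Tri) {B : Set Plane}
    (hdis : ∀ i ∈ F, ∀ j ∈ F, i ≠ j → Disjoint (interior (body (τ i))) (interior (body (τ j))))
    (hB : ∀ i ∈ F, body (τ i) ⊆ B) : ∑ i ∈ F, volume (body (τ i)) ≤ volume B := by
  have h1 : volume (⋃ i ∈ F, interior (body (τ i))) = ∑ i ∈ F, volume (interior (body (τ i))) :=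
    measure_biUnion_finset (fun i hi j hj hij => hdis i hi j hj hij)
      fun i _ => isOpen_interior.measurableSet
  simp_rw [volume_interior_body] at h1
  rw [← h1]
  exact measure_mono (Set.iUnion₂_subset fun i hi => interior_subset.trans (hB i hi))

theorem diam_homTri_le (σ : ℝ) (hσ : σ ≠ 0) (c : Plane) (T : Tri) :
    Metric.diam (body (homTri σ hσ c T)) ≤ |σ| * Metric.diam (body T) := by
  have := Metric.diam_nonneg (s := body T)
  rw [body_homTri]
  refine Metric.diam_le_of_forall_dist_le (by positivity) ?_
  rintro _ ⟨x, hx, rfl⟩ _ ⟨y, hy, rfl⟩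
  rw [hom, hom, dist_add_right, dist_smul₀, Real.norm_eq_abs]
  exact mul_le_mul_of_nonneg_left (dist_le_diam hx hy) (abs_nonneg _)

/-! ### The tiling of the plane by copies of a triangle -/

theorem bco_add_smul_sub (T : Tri) (k a b : Fin 3) (w : Plane) (r : ℝ) :
    bco T k (w + r • (T.points a - T.points b)) =
      bco T k w + r * ((if k = a then 1 else 0) - (if k = b then 1 else 0)) := by
  have h1 : bco T k (w + r • (T.points a - T.points b)) =
      (bco T k).linear (r • (T.points a - T.points b)) + bco T k w := by
    have := (bco T k).map_vadd w (r • (T.points a - T.points b))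
    simpa [add_comm] using this
  have h2 : (if k = a then (1 : ℝ) else 0) - (if k = b then 1 else 0) =
      (bco T k).linear (T.points a - T.points b) := by
    have := (bco T k).linearMap_vsub (T.points a) (T.points b)
    rw [← bco_points, ← bco_points]
    simpa using this.symm
  rw [h1, h2, map_smul, smul_eq_mul, add_comm]

theorem bco_reflect (T : Tri) (k a : Fin 3) (w : Plane) :
    bco T k ((2 : ℝ) • T.points a - w) = 2 * (if k = a then 1 else 0) - bco T k w := by
  have h1 : ∀ x, bco T k x = (bco T k).linear x + bco T k 0 := by
    intro x
    have := (bco T k).map_vadd 0 x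
    simpa using this
  rw [← bco_points, h1 (_ - w), h1 w, h1 (T.points a), map_sub, map_smul, smul_eq_mul]
  ring

/-- The tiles of the plane by translates of `h T` and of `-h T`. -/
def tile (T : Tri) (h : ℝ) (hh : h ≠ 0) (a : ℤ × ℤ × Bool) : Tri :=
  if a.2.2 then
    homTri h hh (h • ((a.1 : ℝ) • (T.points 1 - T.points 0) +
      (a.2.1 : ℝ) • (T.points 2 - T.points 0))) T
  else homTri (-h) (neg_ne_zero.2 hh) (h • ((2 : ℝ) • T.points 0 +
    ((a.1 + 1 : ℝ) • (T.points 1 - T.points 0) + (a.2.1 + 1 : ℝ) • (T.points 2 - T.points 0)))) T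

theorem exists_tile_eq (T : Tri) (h : ℝ) (hh : h ≠ 0) (a : ℤ × ℤ × Bool) :
    ∃ σ hσ c, |σ| = |h| ∧ tile T h hh a = homTri σ hσ c T := by
  unfold tile
  split_ifs
  · exact ⟨h, hh, _, rfl, rfl⟩
  · exact ⟨-h, neg_ne_zero.2 hh, _, abs_neg h, rfl⟩

theorem diam_tile_le (T : Tri) (h : ℝ) (hh : h ≠ 0) (a : ℤ × ℤ × Bool) :
    Metric.diam (body (tile T h hh a)) ≤ |h| * Metric.diam (body T) := by
  obtain ⟨σ, hσ, c, h1, h2⟩ := exists_tile_eq T h hh a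
  rw [h2, ← h1]
  exact diam_homTri_le σ hσ c T

theorem volume_tile (T : Tri) (h : ℝ) (hh : h ≠ 0) (a : ℤ × ℤ × Bool) :
    volume (body (tile T h hh a)) = ENNReal.ofReal (h ^ 2) * volume (body T) := by
  obtain ⟨σ, hσ, c, h1, h2⟩ := exists_tile_eq T h hh a
  rw [h2, volume_homTri, ← sq_abs, h1, sq_abs]

/-- In the coordinates `bco T 1` and `bco T 2` of `h⁻¹ • x`, the tiles are the unit squares with
integer corners, each cut along its antidiagonal. This formula and the next reduce the study of the
tiling to floors. -/
theorem bco_tile_true (T : Tri) (h : ℝ) (hh : h ≠ 0) (i j : ℤ) (x : Plane) :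
    bco (tile T h hh (i, j, true)) 0 x = bco T 0 (h⁻¹ • x) + i + j ∧
    bco (tile T h hh (i, j, true)) 1 x = bco T 1 (h⁻¹ • x) - i ∧
    bco (tile T h hh (i, j, true)) 2 x = bco T 2 (h⁻¹ • x) - j := by
  have hx : x = hom h (h • ((i : ℝ) • (T.points 1 - T.points 0) +
      (j : ℝ) • (T.points 2 - T.points 0))) (h⁻¹ • x + (-i : ℝ) • (T.points 1 - T.points 0) +
        (-j : ℝ) • (T.points 2 - T.points 0)) := by
    have : h⁻¹ • x + (-i : ℝ) • (T.points 1 - T.points 0) +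
        (-j : ℝ) • (T.points 2 - T.points 0) + ((i : ℝ) • (T.points 1 - T.points 0) +
          (j : ℝ) • (T.points 2 - T.points 0)) = h⁻¹ • x := by
      rw [neg_smul, neg_smul]
      abel
    rw [hom, ← smul_add, this, smul_smul, mul_inv_cancel₀ hh, one_smul]
  have h1 : ∀ k, bco (tile T h hh (i, j, true)) k x =
      bco T k (h⁻¹ • x + (-i : ℝ) • (T.points 1 - T.points 0) +
        (-j : ℝ) • (T.points 2 - T.points 0)) := by
    intro k
    conv_lhs => rw [hx]
    exact bco_homTri h hh _ _ _ _
  simp only [h1, bco_add_smul_sub]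
  refine ⟨?_, ?_, ?_⟩ <;> simp <;> ring

theorem bco_tile_false (T : Tri) (h : ℝ) (hh : h ≠ 0) (i j : ℤ) (x : Plane) :
    bco (tile T h hh (i, j, false)) 0 x = -bco T 0 (h⁻¹ • x) - i - j ∧
    bco (tile T h hh (i, j, false)) 1 x = i + 1 - bco T 1 (h⁻¹ • x) ∧
    bco (tile T h hh (i, j, false)) 2 x = j + 1 - bco T 2 (h⁻¹ • x) := by
  have hx : x = hom (-h) (h • ((2 : ℝ) • T.points 0 +
      ((i + 1 : ℝ) • (T.points 1 - T.points 0) + (j + 1 : ℝ) • (T.points 2 - T.points 0))))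
        (((2 : ℝ) • T.points 0 - h⁻¹ • x) + (i + 1 : ℝ) • (T.points 1 - T.points 0) +
        (j + 1 : ℝ) • (T.points 2 - T.points 0)) := by
    rw [hom, neg_smul, ← smul_neg, ← smul_add]
    have : -((2 : ℝ) • T.points 0 - h⁻¹ • x + (i + 1 : ℝ) • (T.points 1 - T.points 0) +
        (j + 1 : ℝ) • (T.points 2 - T.points 0)) + ((2 : ℝ) • T.points 0 +
        ((i + 1 : ℝ) • (T.points 1 - T.points 0) + (j + 1 : ℝ) • (T.points 2 - T.points 0))) =
        h⁻¹ • x := by abel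
    rw [this, smul_smul, mul_inv_cancel₀ hh, one_smul]
  have h1 : ∀ k, bco (tile T h hh (i, j, false)) k x =
      bco T k (((2 : ℝ) • T.points 0 - h⁻¹ • x) + (i + 1 : ℝ) • (T.points 1 - T.points 0) +
        (j + 1 : ℝ) • (T.points 2 - T.points 0)) := by
    intro k
    conv_lhs => rw [hx]
    exact bco_homTri (-h) (neg_ne_zero.2 hh) _ _ _ _
  simp only [h1, bco_add_smul_sub, bco_reflect]
  refine ⟨?_, ?_, ?_⟩ <;> simp <;> ring

theorem bco_zero_eq (T : Tri) (x : Plane) : bco T 0 x = 1 - bco T 1 x - bco T 2 x := by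
  have := sum_bco T x
  rw [Fin.sum_univ_three] at this
  linarith

theorem exists_mem_tile (T : Tri) (h : ℝ) (hh : h ≠ 0) (x : Plane) :
    ∃ a, x ∈ body (tile T h hh a) := by
  have h0 := bco_zero_eq T (h⁻¹ • x)
  have i1 := Int.floor_le (bco T 1 (h⁻¹ • x))
  have i2 := (Int.lt_floor_add_one (bco T 1 (h⁻¹ • x))).le
  have j1 := Int.floor_le (bco T 2 (h⁻¹ • x))
  have j2 := (Int.lt_floor_add_one (bco T 2 (h⁻¹ • x))).le
  set i := ⌊bco T 1 (h⁻¹ • x)⌋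
  set j := ⌊bco T 2 (h⁻¹ • x)⌋
  by_cases hle : bco T 1 (h⁻¹ • x) + bco T 2 (h⁻¹ • x) ≤ i + j + 1
  · obtain ⟨e0, e1, e2⟩ := bco_tile_true T h hh i j x
    refine ⟨(i, j, true), mem_body_iff.2 (Fin.forall_fin_succ.2 ⟨?_, Fin.forall_fin_two.2 ⟨?_, ?_⟩⟩)⟩
    · rw [e0]; linarith
    · change 0 ≤ bco _ 1 x; rw [e1]; linarith
    · change 0 ≤ bco _ 2 x; rw [e2]; linarith
  · obtain ⟨e0, e1, e2⟩ := bco_tile_false T h hh i j x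
    push Not at hle
    refine ⟨(i, j, false), mem_body_iff.2 (Fin.forall_fin_succ.2 ⟨?_, Fin.forall_fin_two.2 ⟨?_, ?_⟩⟩)⟩
    · rw [e0]; linarith
    · change 0 ≤ bco _ 1 x; rw [e1]; linarith
    · change 0 ≤ bco _ 2 x; rw [e2]; linarith

theorem tile_index_unique (T : Tri) (h : ℝ) (hh : h ≠ 0) {x : Plane} {a : ℤ × ℤ × Bool}
    (hx : x ∈ interior (body (tile T h hh a))) :
    a.1 = ⌊bco T 1 (h⁻¹ • x)⌋ ∧ a.2.1 = ⌊bco T 2 (h⁻¹ • x)⌋ ∧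
      (a.2.2 = true ↔ bco T 1 (h⁻¹ • x) + bco T 2 (h⁻¹ • x) <
        ⌊bco T 1 (h⁻¹ • x)⌋ + ⌊bco T 2 (h⁻¹ • x)⌋ + 1) := by
  obtain ⟨i, j, b⟩ := a
  have h0 := bco_zero_eq T (h⁻¹ • x)
  rw [mem_interior_body_iff] at hx
  have hx0 := hx 0
  have hx1 := hx 1
  have hx2 := hx 2
  cases b
  · obtain ⟨e0, e1, e2⟩ := bco_tile_false T h hh i j x
    rw [e0] at hx0
    rw [e1] at hx1
    rw [e2] at hx2
    have hi : ⌊bco T 1 (h⁻¹ • x)⌋ = i := Int.floor_eq_iff.2 ⟨by linarith, by linarith⟩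
    have hj : ⌊bco T 2 (h⁻¹ • x)⌋ = j := Int.floor_eq_iff.2 ⟨by linarith, by linarith⟩
    rw [hi, hj]
    refine ⟨rfl, rfl, by simp, fun h => ?_⟩
    exfalso
    linarith
  · obtain ⟨e0, e1, e2⟩ := bco_tile_true T h hh i j x
    rw [e0] at hx0
    rw [e1] at hx1
    rw [e2] at hx2
    have hi : ⌊bco T 1 (h⁻¹ • x)⌋ = i := Int.floor_eq_iff.2 ⟨by linarith, by linarith⟩
    have hj : ⌊bco T 2 (h⁻¹ • x)⌋ = j := Int.floor_eq_iff.2 ⟨by linarith, by linarith⟩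
    rw [hi, hj]
    exact ⟨rfl, rfl, fun _ => by linarith, fun _ => rfl⟩

theorem disjoint_interior_tile (T : Tri) (h : ℝ) (hh : h ≠ 0) {a b : ℤ × ℤ × Bool} (hab : a ≠ b) :
    Disjoint (interior (body (tile T h hh a))) (interior (body (tile T h hh b))) := by
  rw [Set.disjoint_left]
  intro x hx hx'
  obtain ⟨h1, h2, h3⟩ := tile_index_unique T h hh hx
  obtain ⟨h4, h5, h6⟩ := tile_index_unique T h hh hx'
  refine hab (Prod.ext (h1.trans h4.symm) (Prod.ext (h2.trans h5.symm) ?_))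
  exact Bool.eq_iff_iff.2 (h3.trans h6.symm)

/-- Tile vertices are lattice points, which have integer coordinates relative to every tile. With
`mem_range_points_of_int`, the tiling has no hanging nodes. -/
theorem bco_vertex_tile (T : Tri) (h : ℝ) (hh : h ≠ 0) (a b : ℤ × ℤ × Bool) (i k : Fin 3) :
    ∃ n : ℤ, bco (tile T h hh b) k ((tile T h hh a).points i) = n := by
  set x := (tile T h hh a).points i with hx
  have key : (∃ n : ℤ, bco T 1 (h⁻¹ • x) = n) ∧ ∃ n : ℤ, bco T 2 (h⁻¹ • x) = n := by
    obtain ⟨c, d, s⟩ := a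
    have hk : ∀ k, ∃ n : ℤ, bco (tile T h hh (c, d, s)) k x = n := fun k => by
      rw [hx, bco_points]
      split_ifs
      · exact ⟨1, by simp⟩
      · exact ⟨0, by simp⟩
    obtain ⟨n1, hn1⟩ := hk 1
    obtain ⟨n2, hn2⟩ := hk 2
    cases s
    · obtain ⟨-, e1, e2⟩ := bco_tile_false T h hh c d x
      exact ⟨⟨c + 1 - n1, by push_cast; linarith⟩, ⟨d + 1 - n2, by push_cast; linarith⟩⟩
    · obtain ⟨-, e1, e2⟩ := bco_tile_true T h hh c d x
      exact ⟨⟨c + n1, by push_cast; linarith⟩, ⟨d + n2, by push_cast; linarith⟩⟩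
  obtain ⟨⟨n1, hn1⟩, n2, hn2⟩ := key
  have h0 := bco_zero_eq T (h⁻¹ • x)
  obtain ⟨c, d, s⟩ := b
  revert k
  cases s
  · obtain ⟨e0, e1, e2⟩ := bco_tile_false T h hh c d x
    refine Fin.forall_fin_succ.2 ⟨?_, Fin.forall_fin_two.2 ⟨?_, ?_⟩⟩
    · exact ⟨-(1 - n1 - n2) - c - d, by rw [e0]; push_cast; linarith⟩
    · exact ⟨c + 1 - n1, by change bco _ 1 x = _; rw [e1]; push_cast; linarith⟩
    · exact ⟨d + 1 - n2, by change bco _ 2 x = _; rw [e2]; push_cast; linarith⟩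
  · obtain ⟨e0, e1, e2⟩ := bco_tile_true T h hh c d x
    refine Fin.forall_fin_succ.2 ⟨?_, Fin.forall_fin_two.2 ⟨?_, ?_⟩⟩
    · exact ⟨(1 - n1 - n2) + c + d, by rw [e0]; push_cast; linarith⟩
    · exact ⟨n1 - c, by change bco _ 1 x = _; rw [e1]; push_cast; linarith⟩
    · exact ⟨n2 - d, by change bco _ 2 x = _; rw [e2]; push_cast; linarith⟩

theorem mem_range_points_of_int {S : Tri} {x : Plane} (hx : x ∈ body S)
    (h : ∀ k, ∃ n : ℤ, bco S k x = n) : x ∈ Set.range S.points := by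
  have h01 : ∀ k, bco S k x = 0 ∨ bco S k x = 1 := by
    intro k
    obtain ⟨n, hn⟩ := h k
    have h0 := mem_body_iff.1 hx k
    have h1 := bco_le_one hx k
    rw [hn] at h0 h1 ⊢
    have h0' : 0 ≤ n := by exact_mod_cast h0
    have h1' : n ≤ 1 := by exact_mod_cast h1
    have : n = 0 ∨ n = 1 := by omega
    exact_mod_cast this
  by_contra hv
  have hex : ∃ k, bco S k x = 1 := by
    by_contra! hne
    have := sum_bco S x
    rw [Finset.sum_eq_zero fun k _ => (h01 k).resolve_right (hne k)] at this
    exact zero_ne_one this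
  obtain ⟨k, hk⟩ := hex
  refine hv ⟨k, ext_bco S fun l => ?_⟩
  rw [bco_points]
  split_ifs with hl
  · rw [hl, hk]
  · rcases h01 l with h | h
    · exact h.symm
    · exfalso
      have h2 : bco S l x + bco S k x ≤ 1 := by
        rw [← sum_bco S x, ← Finset.sum_pair (f := fun i => bco S i x) hl]
        exact Finset.sum_le_sum_of_subset_of_nonneg (Finset.subset_univ _)
          fun i _ _ => mem_body_iff.1 hx i
      linarith

theorem card_tiles_le (T : Tri) (h : ℝ) (hh : h ≠ 0) (F : Finset (ℤ × ℤ × Bool)) {B : Set Plane}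
    (hB : ∀ a ∈ F, body (tile T h hh a) ⊆ B) :
    (F.card : ℝ≥0∞) * (ENNReal.ofReal (h ^ 2) * volume (body T)) ≤ volume B := by
  have := sum_volume_le F (tile T h hh) (fun i _ j _ hij => disjoint_interior_tile T h hh hij) hB
  simp_rw [volume_tile] at this
  rwa [Finset.sum_const, nsmul_eq_mul] at this

theorem finite_tiles (T : Tri) (h : ℝ) (hh : h ≠ 0) {B : Set Plane} (hB : volume B ≠ ∞) :
    {a | body (tile T h hh a) ⊆ B}.Finite := by
  by_contra hinf
  set c := ENNReal.ofReal (h ^ 2) * volume (body T) with hc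
  have hc0 : c ≠ 0 := by
    refine mul_ne_zero ?_ (volume_body_pos T).ne'
    simp only [ne_eq, ENNReal.ofReal_eq_zero, not_le]
    positivity
  obtain ⟨n, hn⟩ := ENNReal.exists_nat_gt (ENNReal.div_ne_top hB hc0)
  obtain ⟨F, hF, hFn⟩ := Set.Infinite.exists_subset_card_eq hinf n
  have := card_tiles_le T h hh F (B := B) fun a ha => hF ha
  rw [hFn, ← hc] at this
  have hct : c ≠ ∞ := ENNReal.mul_ne_top ENNReal.ofReal_ne_top (volume_body_ne_top T)
  rw [ENNReal.div_lt_iff (Or.inl hc0) (Or.inl hct)] at hn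
  exact absurd this (not_le.2 hn)

/-! ### Meshes of a triangle by small copies of another triangle -/

theorem notMem_interior_of_bco_eq_zero {R : Tri} {x : Plane} {k : Fin 3} (h : bco R k x = 0) :
    x ∉ interior (body R) := fun hx => (mem_interior_body_iff.1 hx k).ne' h

/-- The set of vertices of a family of triangles. -/
def vertexSet (𝒯 : Finset Tri) : Set Plane := ⋃ S ∈ 𝒯, Set.range S.points

theorem finite_vertexSet (𝒯 : Finset Tri) : (vertexSet 𝒯).Finite :=
  𝒯.finite_toSet.biUnion fun _ _ => Set.finite_range _

theorem mem_vertexSet {𝒯 : Finset Tri} {u : Plane} :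
    u ∈ vertexSet 𝒯 ↔ ∃ S ∈ 𝒯, u ∈ Set.range S.points := by simp [vertexSet]

/-- The pieces of the tile `a` inside the triangle `R`, given the subdivisions `cut`. -/
theorem exists_tile_pieces [DecidableEq Tri] (R : Tri) :
    ∃ M : ℕ, 0 < M ∧ ∀ U : Tri, ∃ 𝒢 : Finset Tri, 𝒢.card ≤ M ∧
      (∀ S ∈ 𝒢, body S ⊆ body R ∧ body S ⊆ body U) ∧
      (∀ S ∈ 𝒢, ∀ S' ∈ 𝒢, S ≠ S' → Disjoint (interior (body S)) (interior (body S'))) ∧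
      (∀ x ∈ body U, x ∈ interior (body R) → ∃ S ∈ 𝒢, x ∈ body S) ∧
      ∀ S ∈ 𝒢, ∀ i, S.points i ∈ Set.range U.points ∨ S.points i ∉ interior (body R) := by
  classical
  refine ⟨(2 ^ 9) ^ (List.ofFn fun i => bco R i).length, by positivity, fun U => ?_⟩
  obtain ⟨𝒢, h1, h2, h3⟩ := exists_cut (List.ofFn fun i => bco R i) U
  have hmem : ∀ i, bco R i ∈ List.ofFn fun i => bco R i := fun i => List.mem_ofFn.2 ⟨i, rfl⟩
  refine ⟨𝒢.filter fun S => body S ⊆ body R, (Finset.card_filter_le _ _).trans h2, fun S hS => ?_,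
    fun S hS S' hS' hne => ?_, fun x hxU hxR => ?_, fun S hS i => ?_⟩
  · rw [Finset.mem_filter] at hS
    exact ⟨hS.2, h1.subset hS.1⟩
  · exact h1.nonoverlap S (Finset.mem_filter.1 hS).1 S' (Finset.mem_filter.1 hS').1 hne
  · obtain ⟨S, hS, hxS⟩ := h1.exists_mem hxU
    exact ⟨S, Finset.mem_filter.2 ⟨hS, subset_body_of_signOn
      (fun i => (h3 S hS).1 _ (hmem i)) hxS hxR⟩, hxS⟩
  -- A vertex created by the cut lies on an edge line of `R`, hence not in the interior of `R`.
  · rcases (h3 S (Finset.mem_filter.1 hS).1).2 i with h | ⟨l, hl, h⟩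
    · exact Or.inl h
    · obtain ⟨k, rfl⟩ := List.mem_ofFn.1 hl
      exact Or.inr (notMem_interior_of_bco_eq_zero h)

/-- Meshes of a triangle `R` mostly made of copies of `h T`, with good control of the remaining
triangles and of the number of vertices in small balls. -/
theorem exists_local_mesh [DecidableEq Tri] (R T : Tri) {ρ : ℝ} (hρ : 0 ≤ ρ) :
    ∃ n₁ : ℕ, ∀ δ > 0, ∀ᶠ h : ℝ in 𝓝[>] 0, ∃ 𝒯 𝒮 : Finset Tri,
      IsTriangulation 𝒯 (body R) ∧ 𝒮 ⊆ 𝒯 ∧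
      (∀ S ∈ 𝒯, Metric.diam (body S) ≤ h * Metric.diam (body T)) ∧
      (∀ S ∈ 𝒮, body S ⊆ interior (body R) ∧ (∃ σ hσ c, |σ| = h ∧ S = homTri σ hσ c T) ∧
        ∀ u ∈ vertexSet 𝒯, u ∈ body S → u ∈ Set.range S.points) ∧
      ((𝒯 \ 𝒮).card : ℝ) * h ^ 2 ≤ δ ∧
      ∀ z, (vertexSet 𝒯 ∩ Metric.closedBall z (ρ * h)).ncard ≤ n₁ := by
  obtain ⟨M, hM0, hM⟩ := exists_tile_pieces R
  choose 𝒢 hG1 hG2 hG3 hG4 hG5 using hM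
  set D := Metric.diam (body T) with hD
  have hD0 : 0 ≤ D := Metric.diam_nonneg
  set v := (volume (body T)).toReal with hv
  have hv0 : 0 < v := ENNReal.toReal_pos (volume_body_pos T).ne' (volume_body_ne_top T)
  have hvE : volume (body T) = ENNReal.ofReal v := (ENNReal.ofReal_toReal (volume_body_ne_top T)).symm
  set b := (volume (Metric.ball (0 : Plane) 1)).toReal with hb
  have hbT : volume (Metric.ball (0 : Plane) 1) ≠ ∞ := measure_ball_lt_top.ne
  have hbE : volume (Metric.ball (0 : Plane) 1) = ENNReal.ofReal b :=
    (ENNReal.ofReal_toReal hbT).symm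
  have hcard : ∀ (h : ℝ) (hh : h ≠ 0) (F : Finset (ℤ × ℤ × Bool)) (B : Set Plane) (y : ℝ),
      (∀ a ∈ F, body (tile T h hh a) ⊆ B) → volume B ≤ ENNReal.ofReal y → 0 ≤ y →
      (F.card : ℝ) * (h ^ 2 * v) ≤ y := by
    intro h hh F B y hF hB hy
    have h1 := (card_tiles_le T h hh F hF).trans hB
    rw [hvE, ← ENNReal.ofReal_mul (sq_nonneg h), ← ENNReal.ofReal_natCast,
      ← ENNReal.ofReal_mul (Nat.cast_nonneg _)] at h1
    exact (ENNReal.ofReal_le_ofReal_iff hy).1 h1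
  -- Area count: the tiles contributing a vertex in the ball of radius `ρ h` lie in that of radius
  -- `(ρ + D) h`, so at most `(ρ + D) ^ 2 b / v` occur, each with at most `M` pieces of `3`
  -- vertices.
  refine ⟨⌈(ρ + D) ^ 2 * b / v⌉₊ * (M * 3), fun δ hδ => ?_⟩
  -- Tiles meeting the boundary of `R` lie in its neighbourhood of width `h D`, whose area tends to
  -- zero; hence their number is `o(h ^ (-2))`.
  have hfr : ∀ᶠ h : ℝ in 𝓝[>] 0, volume (Metric.cthickening (h * D) (frontier (body R))) ≤
      ENNReal.ofReal (δ * v / M) := by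
    have h1 : Tendsto (fun r : ℝ => volume (Metric.cthickening r (frontier (body R)))) (𝓝 0)
        (𝓝 (volume (frontier (body R)))) :=
      tendsto_measure_cthickening_of_isCompact
        ((isCompact_body R).of_isClosed_subset isClosed_frontier (isClosed_body R).frontier_subset)
    rw [volume_frontier_body] at h1
    have h2 : Tendsto (fun h : ℝ => h * D) (𝓝[>] 0) (𝓝 0) := by
      have : Tendsto (fun h : ℝ => h * D) (𝓝 0) (𝓝 (0 * D)) := Continuous.tendsto (by fun_prop) 0
      rw [zero_mul] at this
      exact this.mono_left nhdsWithin_le_nhds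
    refine (h1.comp h2).eventually_le_const ?_
    rw [ENNReal.ofReal_pos]
    have : (0 : ℝ) < M := by exact_mod_cast hM0
    positivity
  filter_upwards [hfr, self_mem_nhdsWithin] with h hhfr hh0
  rw [Set.mem_Ioi] at hh0
  have hh : h ≠ 0 := hh0.ne'
  set τ := tile T h hh with hτ
  have hdiam : ∀ a, Metric.diam (body (τ a)) ≤ h * D := fun a => by
    have := diam_tile_le T h hh a
    rwa [abs_of_pos hh0] at this
  have hnear : ∀ (a : ℤ × ℤ × Bool) (x : Plane) (K : Set Plane), x ∈ body (τ a) → x ∈ K →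
      body (τ a) ⊆ Metric.cthickening (h * D) K := by
    intro a x K hx hxK y hy
    exact Metric.mem_cthickening_of_dist_le y x _ _ hxK ((dist_le_diam hy hx).trans (hdiam a))
  have hIfin : {a | (body (τ a) ∩ body R).Nonempty}.Finite := by
    refine (finite_tiles T h hh (B := Metric.cthickening (h * D) (body R)) ?_).subset ?_
    · exact ((isBounded_body R).cthickening).measure_lt_top.ne
    · rintro a ⟨x, hx, hxR⟩
      exact hnear a x _ hx hxR
  set I := hIfin.toFinset with hI
  have hmemI : ∀ a, a ∈ I ↔ (body (τ a) ∩ body R).Nonempty := fun a => by simp [hI]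
  classical
  -- Tiles off the boundary are kept whole; the others are cut along the edge lines of `R`, keeping
  -- the pieces inside `R`.
  set good : ℤ × ℤ × Bool → Prop := fun a => Disjoint (body (τ a)) (frontier (body R)) with hgood
  have hgoodR : ∀ a ∈ I, good a → body (τ a) ⊆ interior (body R) := by
    intro a ha hg
    have hsub : body (τ a) ⊆ body R := by
      by_contra hns
      obtain ⟨x, hx, hxR⟩ := Set.not_subset.1 hns
      obtain ⟨y, hy1, hy2⟩ := exists_mem_frontier (convex_body (τ a)).isPreconnected
        ((hmemI a).1 ha) ⟨x, hx, hxR⟩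
      exact Set.disjoint_left.1 hg hy1 hy2
    intro x hx
    by_contra hxi
    exact Set.disjoint_left.1 hg hx ⟨subset_closure (hsub hx), hxi⟩
  set 𝒫' : ℤ × ℤ × Bool → Finset Tri := fun a => if good a then {τ a} else 𝒢 (τ a) with h𝒫
  have hPg : ∀ a, good a → 𝒫' a = {τ a} := fun a ha => if_pos ha
  have hPb : ∀ a, ¬ good a → 𝒫' a = 𝒢 (τ a) := fun a ha => if_neg ha
  have hPsub : ∀ a, ∀ S ∈ 𝒫' a, body S ⊆ body (τ a) := by
    intro a S hS
    by_cases hg : good a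
    · rw [hPg a hg, Finset.mem_singleton] at hS
      rw [hS]
    · rw [hPb a hg] at hS
      exact (hG2 _ S hS).2
  have hPR : ∀ a ∈ I, ∀ S ∈ 𝒫' a, body S ⊆ body R := by
    intro a ha S hS
    by_cases hg : good a
    · rw [hPg a hg, Finset.mem_singleton] at hS
      rw [hS]
      exact (hgoodR a ha hg).trans interior_subset
    · rw [hPb a hg] at hS
      exact (hG2 _ S hS).1
  have hPcard : ∀ a, (𝒫' a).card ≤ M := by
    intro a
    by_cases hg : good a
    · rw [hPg a hg, Finset.card_singleton]; exact hM0
    · rw [hPb a hg]; exact hG1 _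
  have hPvert : ∀ a ∈ I, ∀ S ∈ 𝒫' a, ∀ i, S.points i ∈ Set.range (τ a).points ∨
      S.points i ∉ interior (body R) := by
    intro a ha S hS i
    by_cases hg : good a
    · rw [hPg a hg, Finset.mem_singleton] at hS
      rw [hS]
      exact Or.inl (Set.mem_range_self i)
    · rw [hPb a hg] at hS
      exact hG5 _ S hS i
  refine ⟨I.biUnion 𝒫', (I.filter good).image τ, ?_, ?_, ?_, ?_, ?_, ?_⟩
  · refine IsTriangulation.biUnion (A := fun a => ⋃ S ∈ 𝒫' a, body S) ?_ ?_ ?_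
    · refine Set.Subset.antisymm (Set.iUnion₂_subset fun a ha => Set.iUnion₂_subset fun S hS =>
        hPR a ha S hS) (body_subset_of_interior_subset ?_ fun x hx => ?_)
      · exact (Finset.finite_toSet I).isClosed_biUnion fun a _ =>
          (Finset.finite_toSet _).isClosed_biUnion fun S _ => isClosed_body S
      · obtain ⟨a, hxa⟩ := exists_mem_tile T h hh x
        refine Set.mem_biUnion ((hmemI a).2 ⟨x, hxa, interior_subset hx⟩) ?_
        by_cases hg : good a
        · rw [hPg a hg]
          simpa using hxa
        · rw [hPb a hg]
          obtain ⟨S, hS, hxS⟩ := hG4 (τ a) x hxa hx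
          exact Set.mem_biUnion hS hxS
    · intro a _ a' _ hne
      exact (disjoint_interior_tile T h hh hne).mono
        (interior_mono (Set.iUnion₂_subset fun S hS => hPsub a S hS))
        (interior_mono (Set.iUnion₂_subset fun S hS => hPsub a' S hS))
    · refine fun a _ => ⟨rfl, fun S hS S' hS' hne => ?_⟩
      by_cases hg : good a
      · rw [hPg a hg, Finset.mem_singleton] at hS hS'
        exact absurd (hS.trans hS'.symm) hne
      · rw [hPb a hg] at hS hS'
        exact hG3 _ S hS S' hS' hne
  · intro S hS
    obtain ⟨a, ha, rfl⟩ := Finset.mem_image.1 hS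
    rw [Finset.mem_filter] at ha
    exact Finset.mem_biUnion.2 ⟨a, ha.1, by rw [hPg a ha.2]; exact Finset.mem_singleton_self _⟩
  · intro S hS
    obtain ⟨a, ha, hSa⟩ := Finset.mem_biUnion.1 hS
    exact (diam_le_of_subset (hPsub a S hSa)).trans (hdiam a)
  · intro S hS
    obtain ⟨a, ha, rfl⟩ := Finset.mem_image.1 hS
    rw [Finset.mem_filter] at ha
    refine ⟨hgoodR a ha.1 ha.2, ?_, fun u hu hua => ?_⟩
    · obtain ⟨σ, hσ, c, h1, h2⟩ := exists_tile_eq T h hh a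
      exact ⟨σ, hσ, c, by rw [h1, abs_of_pos hh0], h2⟩
    · obtain ⟨S', hS', i, rfl⟩ := mem_vertexSet.1 hu
      obtain ⟨a', ha', hSa'⟩ := Finset.mem_biUnion.1 hS'
      -- A whole tile lies in the interior of `R`, so it contains no vertex created by cutting, only
      -- lattice points.
      rcases hPvert a' ha' S' hSa' i with ⟨i', hi'⟩ | h'
      · refine mem_range_points_of_int hua fun k => ?_
        rw [← hi']
        exact bco_vertex_tile T h hh a' a i' k
      · exact absurd (hgoodR a ha.1 ha.2 hua) h'
  · have hsub : I.biUnion 𝒫' \ (I.filter good).image τ ⊆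
        (I.filter fun a => ¬ good a).biUnion 𝒫' := by
      intro S hS
      rw [Finset.mem_sdiff] at hS
      obtain ⟨a, ha, hSa⟩ := Finset.mem_biUnion.1 hS.1
      refine Finset.mem_biUnion.2 ⟨a, Finset.mem_filter.2 ⟨ha, fun hg => hS.2 ?_⟩, hSa⟩
      rw [hPg a hg, Finset.mem_singleton] at hSa
      rw [hSa]
      exact Finset.mem_image_of_mem _ (Finset.mem_filter.2 ⟨ha, hg⟩)
    have hM0' : (0 : ℝ) < M := by exact_mod_cast hM0
    have h1 := hcard h hh (I.filter fun a => ¬ good a)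
      (Metric.cthickening (h * D) (frontier (body R))) (δ * v / M) (fun a ha => by
        obtain ⟨x, hx1, hx2⟩ := Set.not_disjoint_iff.1 (Finset.mem_filter.1 ha).2
        exact hnear a x _ hx1 hx2) hhfr (by positivity)
    have h2 : ((I.biUnion 𝒫' \ (I.filter good).image τ).card : ℝ) ≤
        (I.filter fun a => ¬ good a).card * M := by
      exact_mod_cast (Finset.card_le_card hsub).trans
        (Finset.card_biUnion_le_card_mul _ _ _ fun a _ => hPcard a)
    have h3 : ((I.filter fun a => ¬ good a).card : ℝ) * M * h ^ 2 ≤ δ := by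
      rw [le_div_iff₀ hM0'] at h1
      have : ((I.filter fun a => ¬ good a).card : ℝ) * M * h ^ 2 * v ≤ δ * v := by
        refine le_trans (le_of_eq ?_) h1
        ring
      exact le_of_mul_le_mul_right this hv0
    exact (mul_le_mul_of_nonneg_right h2 (by positivity)).trans h3
  · intro z
    set J := I.filter fun a => body (τ a) ⊆ Metric.closedBall z ((ρ + D) * h) with hJ
    have hsub : vertexSet (I.biUnion 𝒫') ∩ Metric.closedBall z (ρ * h) ⊆
        ((J.biUnion 𝒫').biUnion fun S => Finset.univ.image S.points : Finset Plane) := by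
      rintro u ⟨hu, huz⟩
      obtain ⟨S, hS, i, rfl⟩ := mem_vertexSet.1 hu
      obtain ⟨a, ha, hSa⟩ := Finset.mem_biUnion.1 hS
      rw [Finset.mem_coe, Finset.mem_biUnion]
      refine ⟨S, Finset.mem_biUnion.2 ⟨a, Finset.mem_filter.2 ⟨ha, fun y hy => ?_⟩, hSa⟩,
        Finset.mem_image_of_mem _ (Finset.mem_univ i)⟩
      have h1 := (dist_le_diam hy (hPsub a S hSa (points_mem_body S i))).trans (hdiam a)
      rw [Metric.mem_closedBall] at huz ⊢
      calc dist y z ≤ dist y (S.points i) + dist (S.points i) z := dist_triangle _ _ _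
        _ ≤ h * D + ρ * h := add_le_add h1 huz
        _ = (ρ + D) * h := by ring
    have h1 := hcard h hh J (Metric.closedBall z ((ρ + D) * h)) (((ρ + D) * h) ^ 2 * b)
      (fun a ha => (Finset.mem_filter.1 ha).2) (by
        rw [Measure.addHaar_closedBall _ _ (by positivity), hbE,
          ← ENNReal.ofReal_mul (by positivity)]
        simp) (by positivity)
    have h2 : J.card ≤ ⌈(ρ + D) ^ 2 * b / v⌉₊ := by
      have : (J.card : ℝ) ≤ (ρ + D) ^ 2 * b / v := by
        rw [le_div_iff₀ hv0]
        have h3 : (J.card : ℝ) * v * h ^ 2 ≤ (ρ + D) ^ 2 * b * h ^ 2 := by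
          refine le_trans (le_of_eq ?_) (h1.trans (le_of_eq ?_)) <;> ring
        exact le_of_mul_le_mul_right h3 (by positivity)
      exact_mod_cast this.trans (Nat.le_ceil _)
    calc (vertexSet (I.biUnion 𝒫') ∩ Metric.closedBall z (ρ * h)).ncard
        ≤ ((J.biUnion 𝒫').biUnion fun S => Finset.univ.image S.points).card := by
          rw [← Set.ncard_coe_finset]
          exact Set.ncard_le_ncard hsub (Finset.finite_toSet _)
      _ ≤ (J.biUnion 𝒫').card * 3 := Finset.card_biUnion_le_card_mul _ _ _ fun S _ =>
          Finset.card_image_le.trans (by simp)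
      _ ≤ J.card * M * 3 := Nat.mul_le_mul_right _
          (Finset.card_biUnion_le_card_mul _ _ _ fun a _ => hPcard a)
      _ ≤ ⌈(ρ + D) ^ 2 * b / v⌉₊ * (M * 3) := by
          rw [mul_assoc]; exact Nat.mul_le_mul_right _ h2

/-! ### Conforming meshes of a polygonal domain -/

/-- Hanging nodes thus lie on edges, as the splitting procedure of `exists_split_nodes` requires. -/
theorem vertex_notMem_interior {𝒯 : Finset Tri} {Ω : Set Plane} (h : IsTriangulation 𝒯 Ω) {T : Tri}
    (hT : T ∈ 𝒯) {v : Plane} (hv : v ∈ vertexSet 𝒯) : v ∉ interior (body T) := by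
  obtain ⟨S, hS, i, rfl⟩ := mem_vertexSet.1 hv
  by_cases hST : S = T
  · subst hST
    obtain ⟨j, hj⟩ : ∃ j, j ≠ i := exists_ne i
    refine notMem_interior_of_bco_eq_zero (k := j) ?_
    rw [bco_points, if_neg hj]
  · exact notMem_interior_of_disjoint (h.nonoverlap S hS T hT hST) (points_mem_body S i)

/-- Conforming meshes mostly made, inside each triangle `R` of a given triangulation, of copies of
`h • shape R`. -/
theorem exists_global_mesh [DecidableEq Tri] {Ω : Set Plane} {ℛ : Finset Tri}
    (hℛ : IsTriangulation ℛ Ω) (shape : Tri → Tri) :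
    ∃ D : ℝ, 0 < D ∧ ∀ δ > 0, ∀ᶠ h : ℝ in 𝓝[>] 0, ∃ 𝒯 𝒮 : Finset Tri,
      IsTriangulation 𝒯 Ω ∧ NoHanging 𝒯 ∧ 𝒮 ⊆ 𝒯 ∧
      (∀ S ∈ 𝒯, Metric.diam (body S) ≤ D * h) ∧
      (∀ S ∈ 𝒮, ∃ R ∈ ℛ, body S ⊆ body R ∧ ∃ σ hσ c, |σ| = h ∧ S = homTri σ hσ c (shape R)) ∧
      ((𝒯 \ 𝒮).card : ℝ) * h ^ 2 ≤ δ := by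
  set D := ∑ R ∈ ℛ, Metric.diam (body (shape R)) + 1 with hD
  have hDsum : 0 ≤ ∑ R ∈ ℛ, Metric.diam (body (shape R)) :=
    Finset.sum_nonneg fun _ _ => Metric.diam_nonneg
  have hD0 : 0 < D := by linarith
  have hDR : ∀ R ∈ ℛ, Metric.diam (body (shape R)) ≤ D := by
    intro R hR
    have := Finset.single_le_sum (f := fun R => Metric.diam (body (shape R)))
      (fun _ _ => Metric.diam_nonneg) hR
    linarith
  choose n₁ hn₁ using fun R => exists_local_mesh R (shape R) hD0.le
  -- A triangle has diameter at most `D h`, so each local mesh places at most `n₁ R` vertices on it.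
  -- Removing hanging nodes therefore replaces it by at most `2 ^ n₀` triangles, independently of
  -- `h`.
  set n₀ := ∑ R ∈ ℛ, n₁ R with hn₀
  refine ⟨D, hD0, fun δ hδ => ?_⟩
  set δ' := δ / (2 ^ n₀ * (ℛ.card + 1)) with hδ'
  have hδ'0 : 0 < δ' := by positivity
  have hev := (eventually_all_finset ℛ).2 fun R _ => hn₁ R δ' hδ'0
  filter_upwards [hev, self_mem_nhdsWithin] with h hloc hh0
  rw [Set.mem_Ioi] at hh0
  choose! 𝒯' 𝒮' h1 h2 h3 h4 h5 h6 using hloc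
  set 𝒯₀ := ℛ.biUnion 𝒯' with h𝒯₀
  set 𝒮 := ℛ.biUnion 𝒮' with h𝒮
  have htri : IsTriangulation 𝒯₀ Ω := hℛ.refine h1
  have hsub : 𝒮 ⊆ 𝒯₀ := Finset.biUnion_mono fun R hR => h2 R hR
  have hdiam : ∀ S ∈ 𝒯₀, Metric.diam (body S) ≤ D * h := by
    intro S hS
    obtain ⟨R, hR, hSR⟩ := Finset.mem_biUnion.1 hS
    refine (h3 R hR S hSR).trans ?_
    rw [mul_comm]
    exact mul_le_mul_of_nonneg_right (hDR R hR) hh0.le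
  have hvert : ∀ v ∈ vertexSet 𝒯₀, ∃ R ∈ ℛ, v ∈ vertexSet (𝒯' R) := by
    intro v hv
    obtain ⟨S, hS, hvS⟩ := mem_vertexSet.1 hv
    obtain ⟨R, hR, hSR⟩ := Finset.mem_biUnion.1 hS
    exact ⟨R, hR, mem_vertexSet.2 ⟨S, hSR, hvS⟩⟩
  set V := (finite_vertexSet 𝒯₀).toFinset with hV
  have hmemV : ∀ v, v ∈ V ↔ v ∈ vertexSet 𝒯₀ := fun v => by simp [hV]
  have hcount : ∀ T ∈ 𝒯₀,
      {v | v ∈ V ∧ v ∈ body T ∧ v ∉ Set.range T.points}.ncard ≤ n₀ := by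
    intro T hT
    have hsub' : {v | v ∈ V ∧ v ∈ body T ∧ v ∉ Set.range T.points} ⊆
        ⋃ R ∈ ℛ, vertexSet (𝒯' R) ∩ Metric.closedBall (T.points 0) (D * h) := by
      rintro v ⟨hv, hvT, -⟩
      obtain ⟨R, hR, hvR⟩ := hvert v ((hmemV v).1 hv)
      exact Set.mem_biUnion hR ⟨hvR, (dist_le_diam hvT (points_mem_body T 0)).trans (hdiam T hT)⟩
    refine (Set.ncard_le_ncard hsub' ?_).trans ((Finset.set_ncard_biUnion_le _ _).trans
      (Finset.sum_le_sum fun R hR => h6 R hR (T.points 0)))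
    exact ℛ.finite_toSet.biUnion fun R _ => (finite_vertexSet _).inter_of_left _
  have hall : ∀ T ∈ 𝒯₀, ∃ 𝒢 : Finset Tri, IsTriangulation 𝒢 (body T) ∧ 𝒢.card ≤ 2 ^ n₀ ∧
      (∀ S ∈ 𝒢, (∀ i, S.points i ∈ V) ∧ ∀ v ∈ V, v ∈ body S → v ∈ Set.range S.points) ∧
      (T ∈ 𝒮 → 𝒢 = {T}) := by
    intro T hT
    have hTV : ∀ u ∈ Set.range T.points, u ∈ V := fun u hu =>
      (hmemV u).2 (mem_vertexSet.2 ⟨T, hT, hu⟩)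
    by_cases hTS : T ∈ 𝒮
    · refine ⟨{T}, isTriangulation_singleton T, by simp [Nat.one_le_two_pow], fun S hS => ?_,
        fun _ => rfl⟩
      rw [Finset.mem_singleton] at hS
      subst hS
      refine ⟨fun i => hTV _ (Set.mem_range_self i), fun v hv hvS => ?_⟩
      obtain ⟨R, hR, hSR⟩ := Finset.mem_biUnion.1 hTS
      obtain ⟨h7, -, h8⟩ := h4 R hR S hSR
      obtain ⟨R', hR', hvR'⟩ := hvert v ((hmemV v).1 hv)
      by_cases hRR : R' = R
      · subst hRR
        exact h8 v hvR' hvS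
      -- A vertex of the mesh of another `R'` cannot be interior to `R`, whereas the whole tile lies
      -- in the interior of `R`.
      · exfalso
        obtain ⟨S', hS', i, rfl⟩ := mem_vertexSet.1 hvR'
        exact notMem_interior_of_disjoint (hℛ.nonoverlap R' hR' R hR hRR)
          ((h1 R' hR').subset hS' (points_mem_body S' i)) (h7 hvS)
    · obtain ⟨𝒢, g1, g2, g3⟩ := exists_split_nodes V n₀ T
        (fun v hv => vertex_notMem_interior htri hT ((hmemV v).1 hv)) (hcount T hT)
      exact ⟨𝒢, g1, g2, fun S hS => ⟨fun i => ((g3 S hS).1 i).elim (hTV _) id, (g3 S hS).2⟩,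
        fun h => absurd h hTS⟩
  choose! 𝒢 g1 g2 g3 g4 using hall
  refine ⟨𝒯₀.biUnion 𝒢, 𝒮, htri.refine g1, ?_, ?_, ?_, ?_, ?_⟩
  -- The splits create no vertex outside `V`, and every final triangle has as vertices all the
  -- points of `V` it contains.
  · intro S hS S' hS' i hi
    obtain ⟨T, hT, hST⟩ := Finset.mem_biUnion.1 hS
    obtain ⟨T', hT', hST'⟩ := Finset.mem_biUnion.1 hS'
    exact (g3 T' hT' S' hST').2 _ ((g3 T hT S hST).1 i) hi
  · intro S hS
    exact Finset.mem_biUnion.2 ⟨S, hsub hS, by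
      rw [g4 S (hsub hS) hS]; exact Finset.mem_singleton_self S⟩
  · intro S hS
    obtain ⟨T, hT, hST⟩ := Finset.mem_biUnion.1 hS
    exact (diam_le_of_subset ((g1 T hT).subset hST)).trans (hdiam T hT)
  · intro S hS
    obtain ⟨R, hR, hSR⟩ := Finset.mem_biUnion.1 hS
    obtain ⟨h7, h8, -⟩ := h4 R hR S hSR
    exact ⟨R, hR, h7.trans interior_subset, h8⟩
  · have hs1 : 𝒯₀.biUnion 𝒢 \ 𝒮 ⊆ (𝒯₀ \ 𝒮).biUnion 𝒢 := by
      intro S hS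
      rw [Finset.mem_sdiff] at hS
      obtain ⟨T, hT, hST⟩ := Finset.mem_biUnion.1 hS.1
      refine Finset.mem_biUnion.2 ⟨T, Finset.mem_sdiff.2 ⟨hT, fun hTS => hS.2 ?_⟩, hST⟩
      rw [g4 T hT hTS, Finset.mem_singleton] at hST
      rwa [hST]
    have hs2 : 𝒯₀ \ 𝒮 ⊆ ℛ.biUnion fun R => 𝒯' R \ 𝒮' R := by
      intro S hS
      rw [Finset.mem_sdiff] at hS
      obtain ⟨R, hR, hSR⟩ := Finset.mem_biUnion.1 hS.1
      exact Finset.mem_biUnion.2 ⟨R, hR, Finset.mem_sdiff.2 ⟨hSR, fun h =>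
        hS.2 (Finset.mem_biUnion.2 ⟨R, hR, h⟩)⟩⟩
    have c1 : ((𝒯₀.biUnion 𝒢 \ 𝒮).card : ℝ) ≤ (𝒯₀ \ 𝒮).card * 2 ^ n₀ := by
      exact_mod_cast (Finset.card_le_card hs1).trans (Finset.card_biUnion_le_card_mul _ _ _
        fun T hT => g2 T (Finset.mem_sdiff.1 hT).1)
    have c2 : ((𝒯₀ \ 𝒮).card : ℝ) ≤ ∑ R ∈ ℛ, ((𝒯' R \ 𝒮' R).card : ℝ) := by
      exact_mod_cast (Finset.card_le_card hs2).trans Finset.card_biUnion_le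
    calc ((𝒯₀.biUnion 𝒢 \ 𝒮).card : ℝ) * h ^ 2
        ≤ (∑ R ∈ ℛ, ((𝒯' R \ 𝒮' R).card : ℝ)) * 2 ^ n₀ * h ^ 2 := by
          gcongr
          exact c1.trans (by gcongr)
      _ = 2 ^ n₀ * ∑ R ∈ ℛ, ((𝒯' R \ 𝒮' R).card : ℝ) * h ^ 2 := by
          rw [← Finset.sum_mul]; ring
      _ ≤ 2 ^ n₀ * ∑ _R ∈ ℛ, δ' := by
          gcongr with R hR
          exact h5 R hR
      _ ≤ 2 ^ n₀ * ((ℛ.card + 1) * δ') := by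
          rw [Finset.sum_const, nsmul_eq_mul]
          gcongr
          linarith
      _ = δ := by
          rw [hδ']
          field_simp

/-! ### The shape function over triangles of bounded diameter -/

/-- The infimum of the local errors over the triangles of unit area and diameter at most `n`. -/
def boundedShape (m : ℕ) (p : ℝ≥0∞) (n : ℕ) (π : MvPolynomial (Fin 2) ℝ) : ℝ≥0∞ :=
  ⨅ T : {T : Tri // volume (body T) = 1 ∧ Metric.diam (body T) ≤ n}, localError m p T (evalAt π)

theorem boundedShape_antitone (m : ℕ) (p : ℝ≥0∞) (π : MvPolynomial (Fin 2) ℝ) :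
    Antitone fun n => boundedShape m p n π := by
  intro a b hab
  refine le_iInf fun T => ?_
  have hb : Metric.diam (body T.1) ≤ b := T.2.2.trans (by exact_mod_cast hab)
  exact iInf_le (fun T : {T : Tri // volume (body T) = 1 ∧ Metric.diam (body T) ≤ b} =>
    localError m p T (evalAt π)) ⟨T.1, T.2.1, hb⟩

theorem iInf_boundedShape (m : ℕ) (p : ℝ≥0∞) (π : MvPolynomial (Fin 2) ℝ) :
    ⨅ n, boundedShape m p n π = shapeFun m p π := by
  refine le_antisymm ?_ (le_iInf fun n => le_iInf fun T => iInf₂_le T.1 T.2.1)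
  refine le_iInf₂ fun T hT => ?_
  obtain ⟨n, hn⟩ := exists_nat_ge (Metric.diam (body T))
  exact (iInf_le _ n).trans
    (iInf_le (fun T : {T : Tri // volume (body T) = 1 ∧ Metric.diam (body T) ≤ n} =>
      localError m p T (evalAt π)) ⟨T, hT, hn⟩)

theorem exists_volume_eq_one (T : Tri) : ∃ S : Tri, volume (body S) = 1 := by
  have h0 := volume_body_pos T
  have h1 := volume_body_ne_top T
  have hv : 0 < (volume (body T)).toReal := ENNReal.toReal_pos h0.ne' h1
  refine ⟨homTri (√(volume (body T)).toReal)⁻¹ (by positivity) 0 T, ?_⟩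
  rw [volume_homTri, inv_pow, Real.sq_sqrt hv.le, ENNReal.ofReal_inv_of_pos hv,
    ENNReal.ofReal_toReal h1, ENNReal.inv_mul_cancel h0.ne' h1]

theorem boundedShape_ne_top {m : ℕ} (hm : 2 ≤ m) (p : ℝ≥0∞) {n : ℕ} {T : Tri}
    (hT : volume (body T) = 1) (hd : Metric.diam (body T) ≤ n) (π : MvPolynomial (Fin 2) ℝ) :
    boundedShape m p n π ≠ ∞ :=
  ne_top_of_le_ne_top (localError_ne_top hm p T (continuous_evalAt π).continuousOn)
    (iInf_le (fun T : {T : Tri // volume (body T) = 1 ∧ Metric.diam (body T) ≤ n} =>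
      localError m p T (evalAt π)) ⟨T, hT, hd⟩)

section

variable {m : ℕ} {p : ℝ≥0∞} {f : Plane → ℝ} {Ω : Set Plane}

/-- The diameter bound makes the comparison of two forms uniform over the competing triangles, so
the infimum inherits the continuity of the `m`-th derivative. The unrestricted `shapeFun` offers no
such uniformity. -/
theorem boundedShape_le_add (hm : 2 ≤ m) (hp : 1 ≤ p) (hΩ : IsPolygonalDomain Ω)
    (hf : ContDiffOn ℝ m f Ω) {z z' : Plane} (hz : z ∈ Ω) (hz' : z' ∈ Ω) {w : ℝ}
    (hw : ‖iteratedFDerivWithin ℝ m f Ω z - iteratedFDerivWithin ℝ m f Ω z'‖ ≤ w) (n : ℕ) :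
    boundedShape m p n (derivForm m f Ω z) ≤
      boundedShape m p n (derivForm m f Ω z') + ENNReal.ofReal (stab m * (w * n ^ m)) := by
  have hst : 0 < stab m := zero_lt_one.trans_le (one_le_stab m)
  have hw0 : 0 ≤ w := (norm_nonneg _).trans hw
  conv_rhs => rw [boundedShape, ENNReal.iInf_add]
  refine le_iInf fun T => (iInf_le _ T).trans ?_
  refine (localError_derivForm_le_derivForm hm hp hf hΩ.uniqueDiffOn hΩ.subset_closure_interior
    T.1 hz hz' hw).trans ?_
  rw [T.2.1, ENNReal.one_rpow, mul_one]
  gcongr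
  exact T.2.2

theorem continuousOn_boundedShape (hm : 2 ≤ m) (hp : 1 ≤ p) (hΩ : IsPolygonalDomain Ω)
    (hf : ContDiffOn ℝ m f Ω) {n : ℕ} {T : Tri} (hT : volume (body T) = 1)
    (hd : Metric.diam (body T) ≤ n) :
    ContinuousOn (fun z => boundedShape m p n (derivForm m f Ω z)) Ω := by
  have hst : 0 < stab m := zero_lt_one.trans_le (one_le_stab m)
  intro z hz
  refine (ENNReal.tendsto_nhds (boundedShape_ne_top hm p hT hd _)).2 fun ε hε => ?_
  obtain ⟨c, hc0, hc, hcε⟩ := ENNReal.lt_iff_exists_real_btwn.1 hε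
  have hc' : 0 < c := by simpa using hc
  obtain ⟨δ, hδ, hmod⟩ := exists_modulus hΩ hf (η := c / (stab m * (n ^ m + 1))) (by positivity)
  have hle : ENNReal.ofReal (stab m * (c / (stab m * (n ^ m + 1)) * n ^ m)) ≤ ε := by
    refine le_trans (ENNReal.ofReal_le_ofReal ?_) hcε.le
    have h1 : stab m * (c / (stab m * (n ^ m + 1)) * n ^ m) = c * ((n : ℝ) ^ m / (n ^ m + 1)) := by
      field_simp
    rw [h1]
    refine mul_le_of_le_one_right hc0 ((div_le_one (by positivity)).2 (by linarith))
  filter_upwards [self_mem_nhdsWithin, mem_nhdsWithin_of_mem_nhds (Metric.ball_mem_nhds z hδ)]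
    with y hy hyz
  have h1 := hmod y hy z hz hyz
  have h2 := hmod z hz y hy (by rw [dist_comm]; exact hyz)
  exact ⟨tsub_le_iff_right.2 ((boundedShape_le_add hm hp hΩ hf hz hy h2 n).trans
    (add_le_add le_rfl hle)), (boundedShape_le_add hm hp hΩ hf hy hz h1 n).trans
    (add_le_add le_rfl hle)⟩

/-- The functions `boundedShape` are eventually continuous on the compact `Ω` and decrease to
`shapeFun`, so convergence of integrals along decreasing sequences applies. The slack `3 * η` pays
for the three errors made in `exists_shapes`, and the last `η` leaves room for extra triangles. -/
theorem exists_boundedShape_lintegral_le (hm : 2 ≤ m) (hp : 1 ≤ p) (hΩ : IsPolygonalDomain Ω)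
    (hf : ContDiffOn ℝ m f Ω) {ε : ℝ} (hε : 0 < ε) :
    ∃ (n : ℕ) (η : ℝ), 0 < η ∧ (∃ T : Tri, volume (body T) = 1 ∧ Metric.diam (body T) ≤ n) ∧
      ((∫⁻ z in Ω, (boundedShape m p n (derivForm m f Ω z) + ENNReal.ofReal (3 * η)) ^
        (rexp m p)⁻¹) + ENNReal.ofReal η) ^ rexp m p ≤ shapeNorm m p f Ω + ENNReal.ofReal ε := by
  have hr := rexp_pos hm p
  have hq : 0 < (rexp m p)⁻¹ := inv_pos.2 hr
  obtain ⟨T₀, -, -⟩ := hΩ.exists_body hΩ.nonempty.some_mem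
  obtain ⟨T, hT⟩ := exists_volume_eq_one T₀
  obtain ⟨n₀, hn₀⟩ := exists_nat_ge (Metric.diam (body T))
  have hdn : ∀ n : ℕ, Metric.diam (body T) ≤ ((n₀ + n : ℕ) : ℝ) := fun n =>
    hn₀.trans (by push_cast; linarith [(Nat.cast_nonneg n : (0 : ℝ) ≤ n)])
  let η : ℕ → ℝ := fun n => 1 / ((n : ℝ) + 1)
  have hη0 : ∀ n, 0 < η n := fun n => by positivity
  have hηt : Tendsto η atTop (𝓝 0) := tendsto_one_div_add_atTop_nhds_zero_nat
  have hηa : Antitone η := fun a b hab => by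
    have : (a : ℝ) ≤ b := by exact_mod_cast hab
    exact one_div_le_one_div_of_le (by positivity) (by linarith)
  let g : ℕ → Plane → ℝ≥0∞ := fun n z =>
    (boundedShape m p (n₀ + n) (derivForm m f Ω z) + ENNReal.ofReal (3 * η n)) ^ (rexp m p)⁻¹
  have hgc : ∀ n, ContinuousOn (g n) Ω := fun n =>
    ENNReal.continuous_rpow_const.comp_continuousOn
      ((continuousOn_boundedShape hm hp hΩ hf hT (hdn n)).add continuousOn_const)
  have hga : ∀ z, Antitone fun n => g n z := fun z a b hab => by
    refine ENNReal.rpow_le_rpow (add_le_add ?_ (ENNReal.ofReal_le_ofReal ?_)) hq.le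
    · exact boundedShape_antitone m p _ (by omega)
    · exact mul_le_mul_of_nonneg_left (hηa hab) (by norm_num)
  have hgt : ∀ z, Tendsto (fun n => g n z) atTop
      (𝓝 (shapeFun m p (derivForm m f Ω z) ^ (rexp m p)⁻¹)) := fun z => by
    have h1 : Tendsto (fun n => boundedShape m p (n₀ + n) (derivForm m f Ω z)) atTop
        (𝓝 (shapeFun m p (derivForm m f Ω z))) := by
      rw [← iInf_boundedShape]
      have := tendsto_atTop_iInf (boundedShape_antitone m p (derivForm m f Ω z))
      exact this.comp (tendsto_add_atTop_nat n₀ |>.congr fun n => by omega)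
    have h2 : Tendsto (fun n => ENNReal.ofReal (3 * η n)) atTop (𝓝 0) := by
      simpa using ENNReal.tendsto_ofReal (hηt.const_mul 3)
    have h3 := h1.add h2
    rw [add_zero] at h3
    exact (ENNReal.continuous_rpow_const.tendsto _).comp h3
  have hfin : ∫⁻ z in Ω, g 0 z ≠ ∞ := by
    obtain ⟨z₀, hz₀, hmax⟩ := hΩ.isCompact.exists_isMaxOn hΩ.nonempty (hgc 0)
    refine ne_top_of_le_ne_top ?_ (setLIntegral_mono' hΩ.isCompact.measurableSet
      (g := fun _ => g 0 z₀) fun z hz => hmax hz)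
    rw [lintegral_const, Measure.restrict_apply_univ]
    refine ENNReal.mul_ne_top (ENNReal.rpow_ne_top_of_nonneg hq.le ?_)
      hΩ.isCompact.measure_lt_top.ne
    exact ENNReal.add_ne_top.2 ⟨boundedShape_ne_top hm p hT (hdn 0) _, ENNReal.ofReal_ne_top⟩
  have hlim := lintegral_tendsto_of_tendsto_of_antitone (μ := volume.restrict Ω)
    (fun n => (hgc n).aemeasurable hΩ.isCompact.measurableSet) (ae_of_all _ hga) hfin
    (ae_of_all _ hgt)
  have hlim2 := (ENNReal.continuous_rpow_const (y := rexp m p)).tendsto _ |>.comp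
    (hlim.add (show Tendsto (fun n => ENNReal.ofReal (η n)) atTop (𝓝 0) by
      simpa using ENNReal.tendsto_ofReal hηt))
  rw [add_zero, ← shapeNorm_eq hm hp] at hlim2
  rcases eq_or_ne (shapeNorm m p f Ω) ∞ with htop | htop
  · exact ⟨n₀, 1, one_pos, ⟨T, hT, hn₀⟩, by rw [htop, top_add]; exact le_top⟩
  · obtain ⟨n, hn⟩ := (hlim2.eventually_lt_const (ENNReal.lt_add_right htop
      (ENNReal.ofReal_pos.2 hε).ne')).exists
    refine ⟨n₀ + n, η n, hη0 n, ⟨T, hT, hdn n⟩, ?_⟩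
    simpa only [Function.comp_def, g] using hn.le

end

/-! ### The choice of the tile shapes -/

theorem IsTriangulation.sum_volume_mul_le {ℛ : Finset Tri} {Ω : Set Plane}
    (h : IsTriangulation ℛ Ω) (c : Tri → ℝ≥0∞) (g : Plane → ℝ≥0∞)
    (hc : ∀ R ∈ ℛ, ∀ z ∈ body R, c R ≤ g z) :
    ∑ R ∈ ℛ, volume (body R) * c R ≤ ∫⁻ z in Ω, g z := by
  have hmeas : ∀ R ∈ ℛ, MeasurableSet (interior (body R)) := fun R _ =>
    isOpen_interior.measurableSet
  calc ∑ R ∈ ℛ, volume (body R) * c R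
      = ∑ R ∈ ℛ, ∫⁻ _z in interior (body R), c R := by
        refine Finset.sum_congr rfl fun R _ => ?_
        rw [lintegral_const, Measure.restrict_apply_univ, volume_interior_body, mul_comm]
    _ ≤ ∑ R ∈ ℛ, ∫⁻ z in interior (body R), g z :=
        Finset.sum_le_sum fun R hR => setLIntegral_mono' (hmeas R hR) fun z hz =>
          hc R hR z (interior_subset hz)
    _ = ∫⁻ z in ⋃ R ∈ ℛ, interior (body R), g z :=
        (lintegral_biUnion_finset (fun R hR S hS hne => h.nonoverlap R hR S hS hne) hmeas g).symm
    _ ≤ _ := lintegral_mono_set (Set.iUnion₂_subset fun R hR => interior_subset.trans (h.subset hR))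

theorem homTri_homTri (σ : ℝ) (hσ : σ ≠ 0) (c : Plane) (ρ : ℝ) (hρ : ρ ≠ 0) (T : Tri) :
    homTri σ hσ c (homTri ρ hρ 0 T) = homTri (σ * ρ) (mul_ne_zero hσ hρ) c T := by
  refine Affine.Simplex.ext fun i => ?_
  simp only [homTri_points, hom, add_zero, smul_smul]

/-- The copies inside one `R` do not overlap and each has `h ^ 2` times the area of `shape R`;
comparison with the area of `R` bounds their number. -/
theorem card_homothetic_tiles_le {ℛ 𝒯 𝒮 : Finset Tri} {Ω : Set Plane} (h𝒯 : IsTriangulation 𝒯 Ω)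
    (h𝒮 : 𝒮 ⊆ 𝒯) (shape : Tri → Tri) (h : ℝ)
    (H : ∀ S ∈ 𝒮, ∃ R ∈ ℛ, body S ⊆ body R ∧ ∃ σ hσ c, |σ| = h ∧ S = homTri σ hσ c (shape R)) :
    (𝒮.card : ℝ) * h ^ 2 ≤
      ∑ R ∈ ℛ, (volume (body R)).toReal / (volume (body (shape R))).toReal := by
  classical
  choose! r hr hsub hS using H
  rw [Finset.card_eq_sum_card_fiberwise hr, Nat.cast_sum, Finset.sum_mul]
  refine Finset.sum_le_sum fun R _ => ?_
  have hpos : 0 < (volume (body (shape R))).toReal :=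
    ENNReal.toReal_pos (volume_body_pos _).ne' (volume_body_ne_top _)
  rw [le_div_iff₀ hpos]
  set F := 𝒮.filter fun S => r S = R
  have hF : ∀ S ∈ F, S ∈ 𝒮 ∧ r S = R := fun S hS => Finset.mem_filter.1 hS
  have h1 := sum_volume_le F id (B := body R)
    (fun S hS T hT hne => h𝒯.nonoverlap S (h𝒮 (hF S hS).1) T (h𝒮 (hF T hT).1) hne)
    fun S hS => by
      have := hsub S (hF S hS).1
      rwa [(hF S hS).2] at this
  have h2 : ∀ S ∈ F, volume (body (id S)) = ENNReal.ofReal (h ^ 2) * volume (body (shape R)) := by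
    intro S hSF
    obtain ⟨σ, hσ, c, hσh, hSe⟩ := hS S (hF S hSF).1
    rw [(hF S hSF).2] at hSe
    rw [id, hSe, volume_homTri, ← sq_abs, hσh]
  rw [Finset.sum_congr rfl h2, Finset.sum_const, nsmul_eq_mul] at h1
  have h3 := ENNReal.toReal_mono (volume_body_ne_top R) h1
  rw [ENNReal.toReal_mul, ENNReal.toReal_mul, ENNReal.toReal_ofReal (sq_nonneg h),
    ENNReal.toReal_natCast] at h3
  linarith

section

variable {m : ℕ} {p : ℝ≥0∞} {f : Plane → ℝ} {Ω : Set Plane}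

/-- The error of the form and the bound on the Taylor remainder carry the same factor under the
homothety, so everything reduces to the unit-area triangle. -/
theorem localError_homTri_le (hm : 2 ≤ m) (hp : 1 ≤ p) (hΩ : IsPolygonalDomain Ω)
    (hf : ContDiffOn ℝ m f Ω) {T : Tri} (hT : volume (body T) = 1) {d : ℝ}
    (hd : Metric.diam (body T) ≤ d) (ρ : ℝ) (hρ : ρ ≠ 0) (c : Plane)
    (hsub : body (homTri ρ hρ c T) ⊆ Ω) {z : Plane} (hz : z ∈ Ω) {w : ℝ} (hw0 : 0 ≤ w)
    (hw : ∀ y ∈ body (homTri ρ hρ c T),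
      ‖iteratedFDerivWithin ℝ m f Ω y - iteratedFDerivWithin ℝ m f Ω z‖ ≤ w) :
    localError m p (homTri ρ hρ c T) f ≤ ENNReal.ofReal (ρ ^ 2) ^ rexp m p *
      (localError m p T (evalAt (derivForm m f Ω z)) + ENNReal.ofReal (stab m * (w * d ^ m))) := by
  have hst : 0 < stab m := zero_lt_one.trans_le (one_le_stab m)
  have hd0 : 0 ≤ d := Metric.diam_nonneg.trans hd
  refine (localError_le_localError_derivForm hm hp hf hΩ.uniqueDiffOn hΩ.subset_closure_interior
    hsub hz hw).trans ?_
  rw [localError_homTri_evalAt hm p ρ hρ c T (isHomogeneous_derivForm m f Ω z), mul_add]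
  refine add_le_add le_rfl ?_
  have hdm : Metric.diam (body (homTri ρ hρ c T)) ^ m ≤ (ρ ^ 2) ^ ((m : ℝ) / 2) * d ^ m := by
    have h1 : (ρ ^ 2) ^ ((m : ℝ) / 2) = |ρ| ^ m := by
      rw [← sq_abs, ← Real.rpow_natCast_mul (abs_nonneg ρ), ← Real.rpow_natCast]
      congr 1
      push_cast
      ring
    rw [h1, ← mul_pow]
    exact pow_le_pow_left₀ Metric.diam_nonneg ((diam_homTri_le ρ hρ c T).trans
      (mul_le_mul_of_nonneg_left hd (abs_nonneg ρ))) m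
  have hρ2 : 0 < ρ ^ 2 := by positivity
  have h0 : ENNReal.ofReal (ρ ^ 2) ≠ 0 := by simpa using hρ
  rw [volume_homTri, hT, mul_one, rexp, ENNReal.rpow_add _ _ h0 ENNReal.ofReal_ne_top,
    mul_right_comm]
  gcongr
  rw [ENNReal.ofReal_rpow_of_pos hρ2, ← ENNReal.ofReal_mul (by positivity)]
  refine ENNReal.ofReal_le_ofReal ?_
  calc stab m * (w * Metric.diam (body (homTri ρ hρ c T)) ^ m)
      ≤ stab m * (w * ((ρ ^ 2) ^ ((m : ℝ) / 2) * d ^ m)) := by gcongr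
    _ = _ := by ring

/-- Equidistribution of the error. For each `R`, an almost optimal unit-area triangle is rescaled so
that its copies of ratio `σ` have error at most `(σ ^ 2) ^ rexp m p`, the same bound for all `R`.
The sum of area ratios, which is `h ^ 2` times the number of copies of ratio `h` needed, is then
close to `∫ K ^ q`. -/
theorem exists_shapes (hm : 2 ≤ m) (hp : 1 ≤ p) (hΩ : IsPolygonalDomain Ω)
    (hf : ContDiffOn ℝ m f Ω) {ε : ℝ} (hε : 0 < ε) :
    ∃ (ℛ : Finset Tri) (shape : Tri → Tri) (η : ℝ), IsTriangulation ℛ Ω ∧ 0 < η ∧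
      ENNReal.ofReal
        (∑ R ∈ ℛ, (volume (body R)).toReal / (volume (body (shape R))).toReal + η) ^ rexp m p ≤
        shapeNorm m p f Ω + ENNReal.ofReal ε ∧
      ∀ R ∈ ℛ, ∀ σ hσ c, body (homTri σ hσ c (shape R)) ⊆ body R →
        localError m p (homTri σ hσ c (shape R)) f ≤ ENNReal.ofReal (σ ^ 2) ^ rexp m p := by
  classical
  have hst : 0 < stab m := zero_lt_one.trans_le (one_le_stab m)
  have hr := rexp_pos hm p
  obtain ⟨n, η, hη, ⟨T₀, hT₀, hT₀n⟩, hA⟩ := exists_boundedShape_lintegral_le hm hp hΩ hf hε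
  set w : ℝ := η / (stab m * (n ^ m + 1)) with hw
  have hw0 : 0 < w := by positivity
  have hwη : stab m * (w * n ^ m) ≤ η := by
    have h1 : stab m * (w * n ^ m) = η * ((n : ℝ) ^ m / (n ^ m + 1)) := by
      rw [hw]; field_simp
    rw [h1]
    exact mul_le_of_le_one_right hη.le ((div_le_one (by positivity)).2 (by linarith))
  have hwη' := ENNReal.ofReal_le_ofReal hwη
  obtain ⟨δ, hδ, hmod⟩ := exists_modulus hΩ hf hw0
  obtain ⟨ℛ, hℛ, hdiam⟩ := hΩ.exists_triangulation (half_pos hδ)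
  have hosc : ∀ R ∈ ℛ, ∀ y ∈ body R, ∀ z ∈ body R,
      ‖iteratedFDerivWithin ℝ m f Ω y - iteratedFDerivWithin ℝ m f Ω z‖ ≤ w :=
    fun R hR y hy z hz => hmod y (hℛ.subset hR hy) z (hℛ.subset hR hz)
      ((dist_le_diam hy hz).trans_lt ((hdiam R hR).trans_lt (half_lt_self hδ)))
  have hex : ∀ R : Tri, ∃ T : Tri, volume (body T) = 1 ∧ Metric.diam (body T) ≤ n ∧
      localError m p T (evalAt (derivForm m f Ω (R.points 0))) ≤
        boundedShape m p n (derivForm m f Ω (R.points 0)) + ENNReal.ofReal η := by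
    intro R
    obtain ⟨T, hT⟩ := iInf_lt_iff.1 (ENNReal.lt_add_right
      (boundedShape_ne_top hm p hT₀ hT₀n (derivForm m f Ω (R.points 0)))
      (ENNReal.ofReal_pos.2 hη).ne')
    exact ⟨T.1, T.2.1, T.2.2, hT.le⟩
  choose T hT1 hTn hTe using hex
  -- The summand `η` keeps `k R` positive, so that the scaling makes sense where the error vanishes,
  -- and absorbs the Taylor remainder.
  set k : Tri → ℝ := fun R =>
    (localError m p (T R) (evalAt (derivForm m f Ω (R.points 0)))).toReal + η with hk
  have hk0 : ∀ R, 0 < k R := fun R => by positivity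
  have hkE : ∀ R, ENNReal.ofReal (k R) =
      localError m p (T R) (evalAt (derivForm m f Ω (R.points 0))) + ENNReal.ofReal η := fun R => by
    rw [hk, ENNReal.ofReal_add ENNReal.toReal_nonneg hη.le,
      ENNReal.ofReal_toReal (localError_ne_top hm p _ (continuous_evalAt _).continuousOn)]
  -- The ratio solves `(ρ ^ 2) ^ r * k = 1`, normalising the error. The scaled triangle has area `k
  -- ^ (-q)`, so the area ratio is `|R| k ^ q`.
  set ρ : Tri → ℝ := fun R => √((k R) ^ (-(rexp m p)⁻¹)) with hρ
  have hρ0 : ∀ R, ρ R ≠ 0 := fun R => (Real.sqrt_pos.2 (Real.rpow_pos_of_pos (hk0 R) _)).ne'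
  have hρ2 : ∀ R, ρ R ^ 2 = (k R) ^ (-(rexp m p)⁻¹) := fun R =>
    Real.sq_sqrt (Real.rpow_pos_of_pos (hk0 R) _).le
  refine ⟨ℛ, fun R => homTri (ρ R) (hρ0 R) 0 (T R), η, hℛ, hη, ?_, ?_⟩
  · refine (ENNReal.rpow_le_rpow ?_ hr.le).trans hA
    rw [ENNReal.ofReal_add (Finset.sum_nonneg fun R _ => by positivity) hη.le,
      ENNReal.ofReal_sum_of_nonneg fun R _ => by positivity]
    refine add_le_add ?_ le_rfl
    refine le_trans (Finset.sum_le_sum fun R hR => le_of_eq ?_)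
      (hℛ.sum_volume_mul_le (fun R => ENNReal.ofReal (k R) ^ (rexp m p)⁻¹) _ fun R hR z hz => ?_)
    · rw [volume_homTri, hT1, mul_one, hρ2,
        ENNReal.toReal_ofReal (Real.rpow_pos_of_pos (hk0 R) _).le, Real.rpow_neg (hk0 R).le,
        div_inv_eq_mul, ENNReal.ofReal_mul ENNReal.toReal_nonneg,
        ENNReal.ofReal_toReal (volume_body_ne_top R), ENNReal.ofReal_rpow_of_pos (hk0 R)]
    · refine ENNReal.rpow_le_rpow ?_ (inv_nonneg.2 hr.le)
      rw [hkE]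
      have h0 := points_mem_body R 0
      -- The three errors `η`: in the definition of `k R`, from almost optimality, and from the
      -- variation of the form within `R`.
      calc _ ≤ boundedShape m p n (derivForm m f Ω (R.points 0)) + ENNReal.ofReal η +
            ENNReal.ofReal η := add_le_add (hTe R) le_rfl
        _ ≤ boundedShape m p n (derivForm m f Ω z) + ENNReal.ofReal η + ENNReal.ofReal η +
            ENNReal.ofReal η := by
          gcongr
          exact (boundedShape_le_add hm hp hΩ hf (hℛ.subset hR h0) (hℛ.subset hR hz)
            (hosc R hR _ h0 z hz) n).trans (add_le_add le_rfl hwη')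
        _ = _ := by
          rw [add_assoc, add_assoc, ← ENNReal.ofReal_add hη.le hη.le,
            ← ENNReal.ofReal_add hη.le (by positivity)]
          congr 2
          ring
  · intro R hR σ hσ c hsub
    simp only [homTri_homTri] at hsub ⊢
    have h0 := points_mem_body R 0
    refine (localError_homTri_le hm hp hΩ hf (hT1 R) (hTn R) _ _ c (hsub.trans (hℛ.subset hR))
      (hℛ.subset hR h0) hw0.le fun y hy => hosc R hR y (hsub hy) _ h0).trans ?_
    calc _ ≤ ENNReal.ofReal ((σ * ρ R) ^ 2) ^ rexp m p * ENNReal.ofReal (k R) := by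
          rw [hkE]
          gcongr
      _ = _ := by
          rw [mul_pow, hρ2, ENNReal.ofReal_mul (sq_nonneg σ), ENNReal.mul_rpow_of_nonneg _ _ hr.le,
            mul_assoc, ENNReal.ofReal_rpow_of_pos (Real.rpow_pos_of_pos (hk0 R) _),
            ← Real.rpow_mul (hk0 R).le, neg_mul, inv_mul_cancel₀ hr.ne', Real.rpow_neg_one,
            ← ENNReal.ofReal_mul (inv_pos.2 (hk0 R)).le, inv_mul_cancel₀ (hk0 R).ne',
            ENNReal.ofReal_one, mul_one]

end

/-! ### Meshes with a prescribed number of triangles -/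

section

variable {m : ℕ} {p : ℝ≥0∞} {f : Plane → ℝ} {Ω : Set Plane}

theorem localError_le_of_diam (hm : 2 ≤ m) (hp : 1 ≤ p) (hΩ : IsPolygonalDomain Ω)
    (hf : ContDiffOn ℝ m f Ω) {W : ℝ} (hW0 : 0 ≤ W)
    (hW : ∀ y ∈ Ω, ‖iteratedFDerivWithin ℝ m f Ω y‖ ≤ W) {T : Tri} (hT : body T ⊆ Ω) {d : ℝ}
    (hd : Metric.diam (body T) ≤ d) :
    localError m p T f ≤ ENNReal.ofReal (stab m * (W * d ^ m)) * volume (body T) ^ p.toReal⁻¹ := by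
  have hst : 0 < stab m := zero_lt_one.trans_le (one_le_stab m)
  refine (localError_le_of_derivative_bound hm hp hf hΩ.uniqueDiffOn hT hW).trans ?_
  have := Metric.diam_nonneg (s := body T)
  gcongr

/-- The optimal tiles `𝒮` number at most `A h ^ (-2)`, and the `p`-th power of each error is at most
`h ^ (m p + 2)`. All other final triangles, including those added to reach `N`, lie in at most `2 δ
h ^ (-2)` triangles of diameter `D h`. The crude bound makes their contribution proportional to
total area, however many they are. -/
theorem exists_conforming_mesh (hm : 2 ≤ m) (hp : 1 ≤ p) (hpt : p ≠ ∞)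
    (hΩ : IsPolygonalDomain Ω) (hf : ContDiffOn ℝ m f Ω) {W : ℝ} (hW0 : 0 ≤ W)
    (hW : ∀ y ∈ Ω, ‖iteratedFDerivWithin ℝ m f Ω y‖ ≤ W) {D h A η δ : ℝ} (hD : 0 < D) (hh : 0 < h)
    (hδη : δ ≤ η) (hhδ : h ^ 2 ≤ δ)
    (hδ : (stab m * (W * D ^ m)) ^ p.toReal *
      (2 * δ * (D ^ 2 * (volume (Metric.ball (0 : Plane) 1)).toReal)) ≤ η)
    {𝒯 𝒮 : Finset Tri} [DecidableEq Tri] (h𝒯 : IsTriangulation 𝒯 Ω) (hnh : NoHanging 𝒯)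
    (h𝒮 : 𝒮 ⊆ 𝒯) (hdiam : ∀ S ∈ 𝒯, Metric.diam (body S) ≤ D * h)
    (herr : ∀ S ∈ 𝒮, localError m p S f ≤ ENNReal.ofReal (h ^ 2) ^ rexp m p)
    (hcard : (𝒮.card : ℝ) * h ^ 2 ≤ A) (hcard' : ((𝒯 \ 𝒮).card : ℝ) * h ^ 2 ≤ δ)
    {N : ℕ} (hN : (N : ℝ) * h ^ 2 = A + η) :
    ∃ 𝒯' : Finset Tri, IsTriangulation 𝒯' Ω ∧ 𝒯'.card = N ∧
      (∀ S ∈ 𝒯', Metric.diam (body S) ≤ D * h) ∧ IsConforming 𝒯' ∧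
      globalError m p 𝒯' f ≤ ENNReal.ofReal (h ^ m * (A + η) ^ p.toReal⁻¹) := by
  have hst : 0 < stab m := zero_lt_one.trans_le (one_le_stab m)
  have hP : 0 < p.toReal := ENNReal.toReal_pos (zero_lt_one.trans_le hp).ne' hpt
  have hA0 : 0 ≤ A := le_trans (by positivity) hcard
  have hδ0 : 0 < δ := lt_of_lt_of_le (by positivity) hhδ
  have hh2 : 0 < h ^ 2 := by positivity
  have hle : 𝒯.card ≤ N := by
    have h1 : (𝒯.card : ℝ) = 𝒮.card + (𝒯 \ 𝒮).card := by
      rw [add_comm]; exact_mod_cast (Finset.card_sdiff_add_card_eq_card h𝒮).symm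
    have h2 : (𝒯.card : ℝ) * h ^ 2 ≤ N * h ^ 2 := by rw [h1, hN]; linarith
    exact_mod_cast le_of_mul_le_mul_right h2 hh2
  obtain ⟨T₀, hT₀, hinf⟩ : ∃ T ∈ 𝒯, (frontier Ω ∩ body T).Infinite := by
    by_contra! hcon
    have hint : (interior Ω).Nonempty := by
      obtain ⟨z, hz⟩ := hΩ.nonempty
      exact closure_nonempty_iff.1 ⟨z, hΩ.subset_closure_interior hz⟩
    refine infinite_frontier hΩ.isCompact hint ((𝒯.finite_toSet.biUnion
      (t := fun T => frontier Ω ∩ body T) fun T hT => by simpa using hcon T hT).subset ?_)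
    intro x hx
    obtain ⟨T, hT, hxT⟩ := h𝒯.exists_mem (hΩ.isCompact.isClosed.frontier_subset hx)
    exact Set.mem_biUnion hT ⟨hx, hxT⟩
  obtain ⟨𝒢, h𝒢, h𝒢c, h𝒢h⟩ := exists_fill (N - 𝒯.card) h𝒯 hnh hT₀ hinf
  obtain ⟨htri, hc⟩ := h𝒯.replace hT₀ h𝒢
  set 𝒯' := 𝒯.erase T₀ ∪ 𝒢 with h𝒯'
  have hmem : ∀ S ∈ 𝒯', S ∈ 𝒯 ∨ body S ⊆ body T₀ := fun S hS => by
    rcases Finset.mem_union.1 hS with hS | hS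
    · exact Or.inl (Finset.mem_of_mem_erase hS)
    · exact Or.inr (h𝒢.subset hS)
  have hdiam' : ∀ S ∈ 𝒯', Metric.diam (body S) ≤ D * h := fun S hS => by
    rcases hmem S hS with hS | hS
    · exact hdiam S hS
    · exact (diam_le_of_subset hS).trans (hdiam T₀ hT₀)
  refine ⟨𝒯', htri, by omega, hdiam', isConforming_of_noHanging htri h𝒢h, ?_⟩
  set b := (volume (Metric.ball (0 : Plane) 1)).toReal with hb
  have hbE : volume (Metric.ball (0 : Plane) 1) = ENNReal.ofReal b :=
    (ENNReal.ofReal_toReal measure_ball_lt_top.ne).symm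
  have hsum1 : ∑ S ∈ 𝒯' with S ∈ 𝒮, localError m p S f ^ p.toReal ≤
      ENNReal.ofReal ((h ^ m) ^ p.toReal * A) := by
    have e1 : (ENNReal.ofReal (h ^ 2) ^ rexp m p) ^ p.toReal =
        ENNReal.ofReal ((h ^ m) ^ p.toReal * h ^ 2) := by
      rw [← ENNReal.rpow_mul, ENNReal.ofReal_rpow_of_pos hh2]
      congr 1
      rw [rexp, add_mul, inv_mul_cancel₀ hP.ne', Real.rpow_add hh2, Real.rpow_one,
        ← Real.rpow_natCast_mul hh.le, ← Real.rpow_natCast_mul hh.le]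
      congr 2
      push_cast
      ring
    calc ∑ S ∈ 𝒯' with S ∈ 𝒮, localError m p S f ^ p.toReal
        ≤ ∑ S ∈ 𝒯' with S ∈ 𝒮, ENNReal.ofReal ((h ^ m) ^ p.toReal * h ^ 2) :=
          Finset.sum_le_sum fun S hS => by
            rw [← e1]
            exact ENNReal.rpow_le_rpow (herr S (Finset.mem_filter.1 hS).2) hP.le
      _ ≤ ∑ S ∈ 𝒮, ENNReal.ofReal ((h ^ m) ^ p.toReal * h ^ 2) :=
          Finset.sum_le_sum_of_subset fun S hS => (Finset.mem_filter.1 hS).2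
      _ ≤ _ := by
          rw [Finset.sum_const, ← ENNReal.ofReal_nsmul, nsmul_eq_mul]
          refine ENNReal.ofReal_le_ofReal ?_
          rw [mul_left_comm]
          gcongr
  have hvol : ∑ S ∈ 𝒯' with S ∉ 𝒮, volume (body S) ≤ ENNReal.ofReal (2 * δ * (D ^ 2 * b)) := by
    -- `T₀` is counted even if it is an optimal tile, since it is broken up by the filling; the
    -- hypothesis `h ^ 2 ≤ δ` pays for it.
    set 𝒰 := insert T₀ (𝒯 \ 𝒮) with h𝒰
    have h𝒰𝒯 : ∀ R ∈ 𝒰, R ∈ 𝒯 := fun R hR => by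
      rcases Finset.mem_insert.1 hR with rfl | hR
      · exact hT₀
      · exact (Finset.mem_sdiff.1 hR).1
    calc ∑ S ∈ 𝒯' with S ∉ 𝒮, volume (body S)
        ≤ volume (⋃ R ∈ 𝒰, body R) := by
          refine sum_volume_le _ id (fun S hS T hT hne => htri.nonoverlap S
            (Finset.mem_filter.1 hS).1 T (Finset.mem_filter.1 hT).1 hne) fun S hS => ?_
          obtain ⟨hS1, hS2⟩ := Finset.mem_filter.1 hS
          rcases hmem S hS1 with hS | hS
          · exact Set.subset_biUnion_of_mem (u := fun R => body R)
              (Finset.mem_insert_of_mem (Finset.mem_sdiff.2 ⟨hS, hS2⟩))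
          · exact hS.trans (Set.subset_biUnion_of_mem (u := fun R => body R)
              (Finset.mem_insert_self _ _))
      _ ≤ ∑ R ∈ 𝒰, volume (body R) := measure_biUnion_finset_le _ _
      _ ≤ ∑ R ∈ 𝒰, ENNReal.ofReal ((D * h) ^ 2 * b) := Finset.sum_le_sum fun R hR => by
          rw [ENNReal.ofReal_mul (sq_nonneg _), ← hbE]
          exact volume_body_le R (hdiam R (h𝒰𝒯 R hR))
      _ ≤ _ := by
          rw [Finset.sum_const, ← ENNReal.ofReal_nsmul, nsmul_eq_mul]
          refine ENNReal.ofReal_le_ofReal ?_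
          have h1 : (𝒰.card : ℝ) ≤ (𝒯 \ 𝒮).card + 1 := by
            exact_mod_cast Finset.card_insert_le _ _
          have h2 : (𝒰.card : ℝ) * h ^ 2 ≤ 2 * δ := by
            calc (𝒰.card : ℝ) * h ^ 2 ≤ ((𝒯 \ 𝒮).card + 1) * h ^ 2 := by gcongr
              _ ≤ 2 * δ := by linarith
          calc (𝒰.card : ℝ) * ((D * h) ^ 2 * b) = 𝒰.card * h ^ 2 * (D ^ 2 * b) := by ring
            _ ≤ _ := by gcongr
  have hsum2 : ∑ S ∈ 𝒯' with S ∉ 𝒮, localError m p S f ^ p.toReal ≤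
      ENNReal.ofReal ((h ^ m) ^ p.toReal * η) := by
    calc ∑ S ∈ 𝒯' with S ∉ 𝒮, localError m p S f ^ p.toReal
        ≤ ∑ S ∈ 𝒯' with S ∉ 𝒮,
            ENNReal.ofReal (stab m * (W * (D * h) ^ m)) ^ p.toReal * volume (body S) := by
          refine Finset.sum_le_sum fun S hS => ?_
          have hS1 := (Finset.mem_filter.1 hS).1
          have := ENNReal.rpow_le_rpow (localError_le_of_diam hm hp hΩ hf hW0 hW
            (htri.subset hS1) (hdiam' S hS1)) hP.le
          rwa [ENNReal.mul_rpow_of_nonneg _ _ hP.le, ← ENNReal.rpow_mul (volume _),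
            inv_mul_cancel₀ hP.ne', ENNReal.rpow_one] at this
      _ ≤ ENNReal.ofReal (stab m * (W * (D * h) ^ m)) ^ p.toReal *
            ENNReal.ofReal (2 * δ * (D ^ 2 * b)) := by
          rw [← Finset.mul_sum]
          gcongr
      _ ≤ _ := by
          rw [ENNReal.ofReal_rpow_of_nonneg (by positivity) hP.le,
            ← ENNReal.ofReal_mul (by positivity)]
          refine ENNReal.ofReal_le_ofReal ?_
          have e : stab m * (W * (D * h) ^ m) = h ^ m * (stab m * (W * D ^ m)) := by
            rw [mul_pow]; ring
          rw [e, Real.mul_rpow (by positivity) (by positivity), mul_assoc]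
          gcongr
  have htot : ∑ S ∈ 𝒯', localError m p S f ^ p.toReal ≤
      ENNReal.ofReal ((h ^ m) ^ p.toReal * (A + η)) := by
    rw [← Finset.sum_filter_add_sum_filter_not 𝒯' (· ∈ 𝒮), mul_add,
      ENNReal.ofReal_add (by positivity) (mul_nonneg (by positivity) (hδ0.le.trans hδη))]
    exact add_le_add hsum1 hsum2
  have hAη : 0 ≤ A + η := by linarith
  rw [globalError, if_neg hpt, one_div]
  refine (ENNReal.rpow_le_rpow htot (inv_nonneg.2 hP.le)).trans (le_of_eq ?_)
  rw [ENNReal.ofReal_rpow_of_nonneg (by positivity) (inv_nonneg.2 hP.le),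
    Real.mul_rpow (by positivity) hAη, ← Real.rpow_mul (by positivity), mul_inv_cancel₀ hP.ne',
    Real.rpow_one]

/-- For `p = ∞` one bad triangle spoils the maximum and small total area is no help. Each
non-optimal triangle is subdivided into at most `M` pieces with diameter reduced by `3 / k`,
bringing the crude bound below `h ^ m`; hanging nodes may appear. `T₀` is subdivided too, so that
the missing triangles can be created inside a fine one. -/
theorem exists_uniform_mesh (hm : 2 ≤ m) (hΩ : IsPolygonalDomain Ω) (hf : ContDiffOn ℝ m f Ω)
    {W : ℝ} (hW0 : 0 ≤ W) (hW : ∀ y ∈ Ω, ‖iteratedFDerivWithin ℝ m f Ω y‖ ≤ W)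
    {D h A η δ : ℝ} (hD : 0 < D) (hh : 0 < h) {k M : ℕ} (hk : 0 < k) (hk1 : 3 / (k : ℝ) ≤ 1)
    (hkW : stab m * (W * (3 / k * D) ^ m) ≤ 1)
    (hM : ∀ T : Tri, ∃ 𝒢, IsTriangulation 𝒢 (body T) ∧ 𝒢.card ≤ M ∧
      ∀ S ∈ 𝒢, Metric.diam (body S) ≤ 3 / k * Metric.diam (body T))
    (hδ : (1 + 2 * M) * δ ≤ η) (hhδ : h ^ 2 ≤ δ)
    {𝒯 𝒮 : Finset Tri} [DecidableEq Tri] (h𝒯 : IsTriangulation 𝒯 Ω)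
    (h𝒮 : 𝒮 ⊆ 𝒯) (hdiam : ∀ S ∈ 𝒯, Metric.diam (body S) ≤ D * h)
    (herr : ∀ S ∈ 𝒮, localError m ∞ S f ≤ ENNReal.ofReal (h ^ 2) ^ rexp m ∞)
    (hcard : (𝒮.card : ℝ) * h ^ 2 ≤ A) (hcard' : ((𝒯 \ 𝒮).card : ℝ) * h ^ 2 ≤ δ)
    {N : ℕ} (hN : (N : ℝ) * h ^ 2 = A + η) :
    ∃ 𝒯' : Finset Tri, IsTriangulation 𝒯' Ω ∧ 𝒯'.card = N ∧
      (∀ S ∈ 𝒯', Metric.diam (body S) ≤ D * h) ∧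
      globalError m ∞ 𝒯' f ≤ ENNReal.ofReal (h ^ m) := by
  have hst : 0 < stab m := zero_lt_one.trans_le (one_le_stab m)
  have hh2 : 0 < h ^ 2 := by positivity
  have hk' : (0 : ℝ) < k := by exact_mod_cast hk
  obtain ⟨T₀, hT₀⟩ := h𝒯.nonempty hΩ.nonempty
  set 𝒰 := insert T₀ (𝒯 \ 𝒮) with h𝒰
  choose G hG hGM hGd using hM
  let 𝒢 : Tri → Finset Tri := fun T => if T ∈ 𝒰 then G T else {T}
  have h𝒢 : ∀ T, IsTriangulation (𝒢 T) (body T) := fun T => by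
    by_cases hT : T ∈ 𝒰
    · simpa [𝒢, hT] using hG T
    · simpa [𝒢, hT] using isTriangulation_singleton T
  have htri := h𝒯.refine (𝒢 := 𝒢) fun T _ => h𝒢 T
  set 𝒯₁ := 𝒯.biUnion 𝒢 with h𝒯₁
  have hfine : ∀ S ∈ 𝒯₁, S ∈ 𝒮 ∧ S ∈ 𝒯 ∨ Metric.diam (body S) ≤ 3 / k * (D * h) := fun S hS => by
    obtain ⟨T, hT, hST⟩ := Finset.mem_biUnion.1 hS
    by_cases hTU : T ∈ 𝒰
    · simp only [𝒢, hTU, if_true] at hST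
      exact Or.inr ((hGd T S hST).trans (by have := hdiam T hT; gcongr))
    · simp only [𝒢, hTU, if_false, Finset.mem_singleton] at hST
      subst hST
      refine Or.inl ⟨?_, hT⟩
      by_contra hcon
      exact hTU (Finset.mem_insert_of_mem (Finset.mem_sdiff.2 ⟨hT, hcon⟩))
  have hle : 𝒯₁.card ≤ N := by
    have h1 : (𝒯.card : ℝ) = 𝒮.card + (𝒯 \ 𝒮).card := by
      rw [add_comm]; exact_mod_cast (Finset.card_sdiff_add_card_eq_card h𝒮).symm
    have h2 : 𝒯₁.card ≤ 𝒯.card + M * 𝒰.card := by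
      calc 𝒯₁.card ≤ ∑ T ∈ 𝒯, (𝒢 T).card := Finset.card_biUnion_le
        _ ≤ ∑ T ∈ 𝒯, (1 + if T ∈ 𝒰 then M else 0) := Finset.sum_le_sum fun T _ => by
            by_cases hT : T ∈ 𝒰
            · simpa [𝒢, hT] using (hGM T).trans (Nat.le_add_left _ _)
            · simp [𝒢, hT]
        _ = 𝒯.card + ∑ T ∈ 𝒯 with T ∈ 𝒰, M := by
            rw [Finset.sum_add_distrib, Finset.sum_filter]; simp
        _ ≤ 𝒯.card + M * 𝒰.card := by
            rw [Finset.sum_const, smul_eq_mul, mul_comm]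
            gcongr
            intro T hT
            exact (Finset.mem_filter.1 hT).2
    have h3 : (𝒰.card : ℝ) ≤ (𝒯 \ 𝒮).card + 1 := by exact_mod_cast Finset.card_insert_le _ _
    have h4 : (𝒰.card : ℝ) * h ^ 2 ≤ 2 * δ := by
      calc (𝒰.card : ℝ) * h ^ 2 ≤ ((𝒯 \ 𝒮).card + 1) * h ^ 2 := by gcongr
        _ ≤ 2 * δ := by linarith
    have h5 : (𝒯₁.card : ℝ) * h ^ 2 ≤ N * h ^ 2 := by
      have h6 : (𝒯₁.card : ℝ) ≤ 𝒯.card + M * 𝒰.card := by exact_mod_cast h2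
      calc (𝒯₁.card : ℝ) * h ^ 2 ≤ (𝒯.card + M * 𝒰.card) * h ^ 2 := by gcongr
        _ = 𝒮.card * h ^ 2 + (𝒯 \ 𝒮).card * h ^ 2 + M * (𝒰.card * h ^ 2) := by rw [h1]; ring
        _ ≤ A + δ + M * (2 * δ) := by gcongr
        _ ≤ N * h ^ 2 := by rw [hN]; linarith
    exact_mod_cast le_of_mul_le_mul_right h5 hh2
  obtain ⟨T₁, hT₁⟩ := (hG T₀).nonempty (nonempty_body T₀)
  have hT₁d : Metric.diam (body T₁) ≤ 3 / k * (D * h) :=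
    (hGd T₀ T₁ hT₁).trans (by have := hdiam T₀ hT₀; gcongr)
  have hT₁m : T₁ ∈ 𝒯₁ := Finset.mem_biUnion.2 ⟨T₀, hT₀, by
    simpa [𝒢, h𝒰] using hT₁⟩
  obtain ⟨ℋ, hℋ, hℋc⟩ := exists_subdivision_card T₁ (N - 𝒯₁.card)
  obtain ⟨htri', hc⟩ := htri.replace hT₁m hℋ
  set 𝒯' := 𝒯₁.erase T₁ ∪ ℋ with h𝒯'
  have hfine' : ∀ S ∈ 𝒯', S ∈ 𝒮 ∧ S ∈ 𝒯 ∨ Metric.diam (body S) ≤ 3 / k * (D * h) := fun S hS => by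
    rcases Finset.mem_union.1 hS with hS | hS
    · exact hfine S (Finset.mem_of_mem_erase hS)
    · exact Or.inr ((diam_le_of_subset (hℋ.subset hS)).trans hT₁d)
  refine ⟨𝒯', htri', by omega, fun S hS => ?_, ?_⟩
  · rcases hfine' S hS with hS | hS
    · exact hdiam S hS.2
    · exact hS.trans (mul_le_of_le_one_left (by positivity) hk1)
  · rw [globalError, if_pos rfl]
    refine iSup₂_le fun S hS => ?_
    rcases hfine' S hS with hS' | hS'
    · refine (herr S hS'.1).trans (le_of_eq ?_)
      rw [ENNReal.ofReal_rpow_of_pos hh2, rexp, ENNReal.toReal_top, inv_zero, add_zero,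
        ← Real.rpow_natCast_mul hh.le, ← Real.rpow_natCast]
      congr 2
      push_cast
      ring
    · refine (localError_le_of_diam hm le_top hΩ hf hW0 hW (htri'.subset hS) hS').trans ?_
      rw [ENNReal.toReal_top, inv_zero, ENNReal.rpow_zero, mul_one]
      refine ENNReal.ofReal_le_ofReal ?_
      calc stab m * (W * (3 / k * (D * h)) ^ m) = stab m * (W * (3 / k * D) ^ m) * h ^ m := by
            rw [← mul_assoc (3 / (k : ℝ)), mul_pow _ h]; ring
        _ ≤ h ^ m := mul_le_of_le_one_left (by positivity) hkW

end

/-! ### The upper bound -/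

section

variable {m : ℕ} {p : ℝ≥0∞} {f : Plane → ℝ} {Ω : Set Plane}

/-- The constant is `B = A + η`: at most `A h ^ (-2)` triangles are optimal tiles, and `η h ^ (-2)`
are reserved for the others. -/
theorem exists_optimal_meshes (hm : 2 ≤ m) (hp : 1 ≤ p) (hΩ : IsPolygonalDomain Ω)
    (hf : ContDiffOn ℝ m f Ω) {ε : ℝ} (hε : 0 < ε) :
    ∃ B D : ℝ, 0 < B ∧ 0 < D ∧
      ENNReal.ofReal B ^ rexp m p ≤ shapeNorm m p f Ω + ENNReal.ofReal ε ∧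
      ∀ᶠ h : ℝ in 𝓝[>] 0, ∀ N : ℕ, (N : ℝ) * h ^ 2 = B →
        ∃ 𝒯 : Finset Tri, IsTriangulation 𝒯 Ω ∧ 𝒯.card = N ∧
          (∀ S ∈ 𝒯, Metric.diam (body S) ≤ D * h) ∧ (p ≠ ∞ → IsConforming 𝒯) ∧
          globalError m p 𝒯 f ≤ ENNReal.ofReal (h ^ m * B ^ p.toReal⁻¹) := by
  classical
  have hst : 0 < stab m := zero_lt_one.trans_le (one_le_stab m)
  obtain ⟨ℛ, shape, η, hℛ, hη, hB, herr⟩ := exists_shapes hm hp hΩ hf hε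
  set A := ∑ R ∈ ℛ, (volume (body R)).toReal / (volume (body (shape R))).toReal with hA
  have hA0 : 0 ≤ A := Finset.sum_nonneg fun R _ => by positivity
  obtain ⟨D, hD, hmesh⟩ := exists_global_mesh hℛ shape
  obtain ⟨W, hW0, hW⟩ : ∃ W : ℝ, 0 ≤ W ∧ ∀ y ∈ Ω, ‖iteratedFDerivWithin ℝ m f Ω y‖ ≤ W := by
    obtain ⟨W, hW⟩ := hΩ.isCompact.exists_bound_of_continuousOn
      (continuousOn_iteratedFDerivWithin_top hΩ hf)
    exact ⟨max W 0, le_max_right _ _, fun y hy => (hW y hy).trans (le_max_left _ _)⟩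
  refine ⟨A + η, D, by positivity, hD, hB, ?_⟩
  have htile : ∀ {h : ℝ} {𝒯 𝒮 : Finset Tri}, IsTriangulation 𝒯 Ω → 𝒮 ⊆ 𝒯 →
      (∀ S ∈ 𝒮, ∃ R ∈ ℛ, body S ⊆ body R ∧
        ∃ σ hσ c, |σ| = h ∧ S = homTri σ hσ c (shape R)) →
      (∀ S ∈ 𝒮, localError m p S f ≤ ENNReal.ofReal (h ^ 2) ^ rexp m p) ∧
        (𝒮.card : ℝ) * h ^ 2 ≤ A := by
    intro h 𝒯 𝒮 h𝒯 h𝒮 H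
    refine ⟨fun S hS => ?_, card_homothetic_tiles_le h𝒯 h𝒮 shape h H⟩
    obtain ⟨R, hR, hSR, σ, hσ, c, rfl, rfl⟩ := H S hS
    rw [sq_abs]
    exact herr R hR σ hσ c hSR
  have hsmall : ∀ δ > 0, ∀ᶠ h : ℝ in 𝓝[>] 0, h ^ 2 ≤ δ := fun δ hδ => by
    have h1 : Tendsto (fun h : ℝ => h ^ 2) (𝓝[>] 0) (𝓝 0) := by
      have : Tendsto (fun h : ℝ => h ^ 2) (𝓝 0) (𝓝 (0 ^ 2)) := (continuous_pow 2).tendsto 0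
      rw [zero_pow two_ne_zero] at this
      exact this.mono_left nhdsWithin_le_nhds
    exact (h1.eventually_lt_const hδ).mono fun _ h => h.le
  by_cases hpt : p = ∞
  · subst hpt
    -- This gives `3 / k ≤ 1`, `3 D / k ≤ 1` and `stab m * W * (3 D / k) ≤ 1`; the power `m` of a
    -- number at most `1` only decreases it.
    obtain ⟨k, hk⟩ := exists_nat_ge (3 * (D + 1) * (stab m * W + 1))
    have hsW : 0 ≤ stab m * W := by positivity
    have hk3 : 3 ≤ (k : ℝ) := by nlinarith [mul_nonneg hD.le hsW]
    have hk0 : (0 : ℝ) < k := by linarith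
    have hkW : stab m * (W * (3 / k * D) ^ m) ≤ 1 := by
      have h1 : 3 / (k : ℝ) * D * (stab m * W + 1) ≤ 1 := by
        rw [div_mul_eq_mul_div, div_mul_eq_mul_div, div_le_one hk0]
        nlinarith [mul_nonneg hD.le hsW]
      have h0 : 0 ≤ 3 / (k : ℝ) * D := by positivity
      have h2 : 3 / (k : ℝ) * D ≤ 1 := by nlinarith [mul_nonneg h0 hsW]
      have h3 : (3 / (k : ℝ) * D) ^ m ≤ 3 / (k : ℝ) * D := pow_le_of_le_one h0 h2 (by omega)
      calc stab m * (W * (3 / k * D) ^ m) = stab m * W * (3 / k * D) ^ m := by ring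
        _ ≤ stab m * W * (3 / k * D) := by gcongr
        _ ≤ 1 := by linarith
    have hk1 : 0 < k := by exact_mod_cast hk0
    obtain ⟨M, hM⟩ := exists_fine_subdivision k hk1
    -- There are at most `δ h ^ (-2)` leftover triangles; with `T₀` at most `2 δ h ^ (-2)` are cut
    -- into `M` pieces, whence `(1 + 2 M) δ ≤ η`.
    have hδ : 0 < η / (1 + 2 * M) := by positivity
    filter_upwards [hmesh _ hδ, hsmall _ hδ, self_mem_nhdsWithin] with h ⟨𝒯, 𝒮, h1, h2, h3, h4, h5, h6⟩
      hh hh0 N hN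
    obtain ⟨e1, e2⟩ := htile h1 h3 h5
    obtain ⟨𝒯', t1, t2, t3, t4⟩ := exists_uniform_mesh hm hΩ hf hW0 hW hD hh0 hk1
      ((div_le_one hk0).2 hk3) hkW hM (by field_simp; exact le_rfl) hh h1 h3 h4 e1 e2 h6 hN
    exact ⟨𝒯', t1, t2, t3, fun h => absurd rfl h, by simpa using t4⟩
  · set κ := (stab m * (W * D ^ m)) ^ p.toReal *
      (2 * (D ^ 2 * (volume (Metric.ball (0 : Plane) 1)).toReal)) with hκ
    have hκ0 : 0 ≤ κ := by positivity
    -- With this `δ`, both the leftover count `δ` and the leftover error `κ δ` stay below `η`.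
    have hδ : 0 < η / (1 + κ) := by positivity
    filter_upwards [hmesh _ hδ, hsmall _ hδ, self_mem_nhdsWithin] with h ⟨𝒯, 𝒮, h1, h2, h3, h4, h5, h6⟩
      hh hh0 N hN
    obtain ⟨e1, e2⟩ := htile h1 h3 h5
    obtain ⟨𝒯', t1, t2, t3, t4, t5⟩ := exists_conforming_mesh hm hp hpt hΩ hf hW0 hW hD hh0
      (div_le_self hη.le (by linarith)) hh
      (by
        calc _ = κ * (η / (1 + κ)) := by rw [hκ]; ring
          _ = η * (κ / (1 + κ)) := by ring
          _ ≤ η := mul_le_of_le_one_right hη.le ((div_le_one (by positivity)).2 (by linarith)))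
      h1 h2 h3 h4 e1 e2 h6 hN
    exact ⟨𝒯', t1, t2, t3, fun _ => t4, t5⟩

/-- For `h = √(B / N)` the diameters are at most `D √B N ^ (-1/2)`, and `N ^ (m / 2) h ^ m B ^ (1 /
p) = B ^ r` does not depend on `N`. -/
theorem exists_isAdmissible_limsup_le (hm : 2 ≤ m) (hp : 1 ≤ p) (hΩ : IsPolygonalDomain Ω)
    (hf : ContDiffOn ℝ m f Ω) {ε : ℝ} (hε : 0 < ε) :
    ∃ (N₀ : ℕ) (𝒯 : ℕ → Finset Tri), IsAdmissible Ω N₀ 𝒯 ∧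
      (p ≠ ∞ → ∀ N, N₀ ≤ N → IsConforming (𝒯 N)) ∧
      limsup (fun N : ℕ => (N : ℝ≥0∞) ^ ((m : ℝ) / 2) * globalError m p (𝒯 N) f) atTop ≤
        shapeNorm m p f Ω + ENNReal.ofReal ε := by
  obtain ⟨B, D, hB, hD, hBε, hmesh⟩ := exists_optimal_meshes hm hp hΩ hf hε
  have hlim : Tendsto (fun N : ℕ => √(B / N)) atTop (𝓝[>] 0) := by
    refine tendsto_nhdsWithin_iff.2 ⟨?_, ?_⟩
    · have := (Real.continuous_sqrt.tendsto 0).comp (tendsto_const_div_atTop_nhds_zero_nat B)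
      rwa [Real.sqrt_zero] at this
    · filter_upwards [eventually_ge_atTop 1] with N hN
      have : (0 : ℝ) < N := by exact_mod_cast hN
      exact Real.sqrt_pos.2 (by positivity)
  obtain ⟨N₀, hN₀⟩ := eventually_atTop.1 ((hlim.eventually hmesh).and (eventually_ge_atTop 1))
  have hex : ∀ N, N₀ ≤ N → ∃ 𝒯 : Finset Tri, IsTriangulation 𝒯 Ω ∧ 𝒯.card = N ∧
      (∀ S ∈ 𝒯, Metric.diam (body S) ≤ D * √(B / N)) ∧ (p ≠ ∞ → IsConforming 𝒯) ∧
      globalError m p 𝒯 f ≤ ENNReal.ofReal (√(B / N) ^ m * B ^ p.toReal⁻¹) := by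
    intro N hN
    obtain ⟨h1, h2⟩ := hN₀ N hN
    have hNpos : (0 : ℝ) < N := by exact_mod_cast h2
    refine h1 N ?_
    rw [Real.sq_sqrt (by positivity)]
    field_simp
  choose! 𝒯 h1 h2 h3 h4 h5 using hex
  refine ⟨N₀, 𝒯, ⟨h1, h2, D * √B, by positivity, fun N hN T hT => ?_⟩,
    fun hpt N hN => h4 N hN hpt, ?_⟩
  · refine (h3 N hN T hT).trans (le_of_eq ?_)
    rw [Real.sqrt_div hB.le, Real.rpow_neg (Nat.cast_nonneg N), ← Real.sqrt_eq_rpow, mul_assoc,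
      div_eq_mul_inv]
  · refine le_trans (limsup_le_of_le (by isBoundedDefault) ?_) hBε
    filter_upwards [eventually_ge_atTop N₀] with N hN
    have hNpos : (0 : ℝ) < N := by exact_mod_cast (hN₀ N hN).2
    calc (N : ℝ≥0∞) ^ ((m : ℝ) / 2) * globalError m p (𝒯 N) f
        ≤ (N : ℝ≥0∞) ^ ((m : ℝ) / 2) * ENNReal.ofReal (√(B / N) ^ m * B ^ p.toReal⁻¹) := by
          gcongr
          exact h5 N hN
      _ = ENNReal.ofReal B ^ rexp m p := by
          rw [← ENNReal.ofReal_natCast, ENNReal.ofReal_rpow_of_pos hNpos,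
            ← ENNReal.ofReal_mul (by positivity), ENNReal.ofReal_rpow_of_pos hB]
          congr 1
          have e : √(B / N) ^ m = B ^ ((m : ℝ) / 2) / (N : ℝ) ^ ((m : ℝ) / 2) := by
            rw [← Real.div_rpow hB.le hNpos.le, Real.sqrt_eq_rpow, ← Real.rpow_mul_natCast
              (by positivity)]
            congr 1
            ring
          rw [e, rexp, Real.rpow_add hB]
          field_simp

end

end OptimalMesh

end

/-! ### The two bounds combined -/

theorem mainTheorem1 (m : ℕ) (hm : 2 ≤ m) (p : ℝ≥0∞) (hp : 1 ≤ p)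
    (Ω : Set OptimalMesh.Plane) (hΩ : OptimalMesh.IsPolygonalDomain Ω)
    (f : OptimalMesh.Plane → ℝ) (hf : ContDiffOn ℝ m f Ω) :
    (∀ (N₀ : ℕ) (𝒯 : ℕ → Finset OptimalMesh.Tri), OptimalMesh.IsAdmissible Ω N₀ 𝒯 →
      OptimalMesh.shapeNorm m p f Ω ≤
        liminf (fun N : ℕ => (N : ℝ≥0∞) ^ ((m : ℝ) / 2) * OptimalMesh.globalError m p (𝒯 N) f)
          atTop) ∧
    (∀ ε : ℝ, 0 < ε → ∃ (N₀ : ℕ) (𝒯 : ℕ → Finset OptimalMesh.Tri),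
      OptimalMesh.IsAdmissible Ω N₀ 𝒯 ∧
      (p ≠ ∞ → ∀ N, N₀ ≤ N → OptimalMesh.IsConforming (𝒯 N)) ∧
      limsup (fun N : ℕ => (N : ℝ≥0∞) ^ ((m : ℝ) / 2) * OptimalMesh.globalError m p (𝒯 N) f)
          atTop ≤
        OptimalMesh.shapeNorm m p f Ω + ENNReal.ofReal ε) := by
  refine ⟨fun N₀ 𝒯 h => OptimalMesh.shapeNorm_le_liminf hm hp hΩ hf h,
    fun _ hε => OptimalMesh.exists_isAdmissible_limsup_le hm hp hΩ hf hε⟩
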